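/- Conventions. Links are considered up to isotopy, i.e. diagrams up to planar isotopy and Reidemeister moves; $c(\mathcal D)$ is the number of crossings of a diagram $\mathcal D$, $c(L)$ is the minimal number of crossings of a diagram of the link $L$, $\det(L)=|V_L(-1)|$ is the determinant ($V_L$ the Jones polynomial), and $\det$ of a diagram is the determinant of the link it represents. A diagram is reduced if it has no nugatory crossing. $n(T)$, $d(T)$ are the numerator and denominator closures of a tangle diagram $T$, representing the links $N(T)$, $D(T)$; $T+S$ is horizontal and $T*S$ vertical composition. Alternating tangle diagrams are of type 1 (the arc from the NW endpoint first passes under, as in the tangle $1$); $T$ is strongly alternating if it is alternating and $n(T)$, $d(T)$ are connected and reduced. The smoothings $D^c_0$, $D^c_\infty$ replace a crossing $c$ by the tangles $0$, $\infty$. A rational extension of a diagram at a crossing $c$ replaces $c$ by an alternating rational tangle diagram all of whose crossings have the same Conway sign as $c$. An almost alternating diagram $D$ with dealternator $c$ (a crossing whose change makes $D$ alternating) is dealternator reduced (resp. connected) if $D^c_0$ and $D^c_\infty$ are reduced (resp. connected) alternating diagrams. (1) Let $D$ be a dealternator reduced and dealternator connected almost alternating diagram of a quasi-alternating link, with dealternator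 $c$ regarded as the tangle $-1$ (if $c$ is regarded as the tangle $+1$ instead, replace $-\frac12,-2$ below by $\frac12,2$). Then $\det(D^c_0)\neq\det(D^c_\infty)$. Put $\omega=-\frac12$ if $\det(D^c_0)>\det(D^c_\infty)$ and $\omega=-2$ if $\det(D^c_0)<\det(D^c_\infty)$, and let $D^{c\leftarrow\omega}$ be obtained from $D$ by replacing $c$ by the tangle $\omega$. Then every rational extension $\mathcal D$ of $D^{c\leftarrow\omega}$ at either of the two crossings of $\omega$ satisfies $c(\mathcal D)\le\det(\mathcal D)$. (2) Let $T$ be a strongly alternating tangle diagram such that $N(-1+T)$ is quasi-alternating, $n(T)$ is prime and $\det(n(T))>\det(d(T))$. Let $m\ge1$ and let $t_1,\dots,t_m$ be rational tangle diagrams with $0<t_i<1$. Then $L=N(-1+t_1+\dots+t_m+T)$ satisfies $c(L)\le\det(L)$. (3) Let $T$ be a connected, locally unknotted, reduced alternating tangle diagram, let $k\ge2$ be even, $a_1,\dots,a_k\ge1$ integers, $t=[0,a_1,\dots,a_k]=1/(a_1+1/(a_2+\cdots+1/a_k))$, and let $T\star t$ be the diagram $[0,a_1,\dots,a_{k-1},a_k+T]$,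 obtained from $T$ by adding $a_k$ horizontal twists, then $a_{k-1}$ vertical twists, and so on, ending with $a_1$ vertical twists (all crossings of sign $+1$). Put $S=\left(\frac{1-t}{t}*1\right)+(T\star t)$. Then for all $m\ge1$ and all rational tangle diagrams $t_1,\dots,t_m$ with $0<t_i<1$, the link $L=N(-1+t_1+\dots+t_m+S)$ satisfies $c(L)\le\det(L)$. -/

import Mathlib

namespace Knot

/-! ### Diagrams

Tangle and link diagrams are taken in Morse position and read from bottom to top: a diagram is a
finite word of elementary layers, each acting on the vertical strands numbered `0, 1, 2, …` from
left to right.  Every planar diagram can be put in this form by a planar isotopy. -/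

/-- An elementary layer.
* `cup i`: a local minimum, creating the strands `i` and `i + 1`;
* `cap i`: a local maximum, joining the strands `i` and `i + 1`;
* `cross s i`: a crossing of the strands `i` and `i + 1`.  The overstrand has positive slope (it
  runs from bottom left to top right) if `s = true`, and negative slope if `s = false`.
  So `s` is the Conway sign of the crossing: `true` is `+1` and `false` is `-1`. -/
inductive Layer : Type
  | cup (i : ℕ) : Layer
  | cap (i : ℕ) : Layer
  | cross (s : Bool) (i : ℕ) : Layer

abbrev Word : Type := List Layer

namespace Layer

/-- Translate a layer by `k` strands to the right. -/
def shift (k : ℕ) : Layer → Layer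
  | cup i => cup (i + k)
  | cap i => cap (i + k)
  | cross s i => cross s (i + k)

def pos : Layer → ℕ
  | cup i => i
  | cap i => i
  | cross _ i => i

/-- Number of strands entering the elementary piece from below. -/
def arityIn : Layer → ℕ
  | cup _ => 0
  | cap _ => 2
  | cross _ _ => 2

/-- Number of strands leaving the elementary piece at the top. -/
def arityOut : Layer → ℕ
  | cup _ => 2
  | cap _ => 0
  | cross _ _ => 2

end Layer

open Layer

/-- Translate a diagram by `k` strands to the right. -/
def shift (k : ℕ) (w : Word) : Word := w.map (Layer.shift k)

/-- `IsTangle m n w`: the word `w` is a well-formed diagram with `m` endpoints at the bottom and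
`n` endpoints at the top. -/
def IsTangle : ℕ → ℕ → Word → Prop
  | m, n, [] => m = n
  | m, n, cup i :: w => i ≤ m ∧ IsTangle (m + 2) n w
  | m, n, cap i :: w => i + 2 ≤ m ∧ IsTangle (m - 2) n w
  | m, n, cross _ i :: w => i + 2 ≤ m ∧ IsTangle m n w

/-- Link diagrams are the diagrams without endpoints. -/
abbrev IsLinkDiagram (D : Word) : Prop := IsTangle 0 0 D

/-- The number of crossings of a diagram. -/
def crossings : Word → ℕ
  | [] => 0
  | cross _ _ :: w => crossings w + 1
  | _ :: w => crossings w

/-- The crossingless diagram of the unknot. -/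
def unknot : Word := [cup 0, cap 0]

/-! ### Isotopy -/

/-- The moves generating planar isotopy of diagrams in Morse position. -/
inductive PlanarMove : Word → Word → Prop
  /-- Layers acting on disjoint sets of strands commute. -/
  | comm (x y : Layer) (h : x.pos ≤ y.pos) :
      PlanarMove [x, y.shift x.arityOut] [y.shift x.arityIn, x]
  /-- Cancellation of a maximum against a minimum. -/
  | zigzag_left (i : ℕ) : PlanarMove [cup i, cap (i + 1)] []
  | zigzag_right (i : ℕ) : PlanarMove [cup (i + 1), cap i] []
  /-- A crossing is rotated around a minimum or a maximum. -/
  | slide_cup (s : Bool) (i : ℕ) :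
      PlanarMove [cup i, cross s (i + 1)] [cup (i + 1), cross (!s) i]
  | slide_cap (s : Bool) (i : ℕ) :
      PlanarMove [cross s (i + 1), cap i] [cross (!s) i, cap (i + 1)]

/-- The three Reidemeister moves. -/
inductive ReidemeisterMove : Word → Word → Prop
  | one_cup (s : Bool) (i : ℕ) : ReidemeisterMove [cup i, cross s i] [cup i]
  | one_cap (s : Bool) (i : ℕ) : ReidemeisterMove [cross s i, cap i] [cap i]
  | two (s : Bool) (i : ℕ) : ReidemeisterMove [cross s i, cross (!s) i] []
  | three (s : Bool) (i : ℕ) :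
      ReidemeisterMove [cross s i, cross s (i + 1), cross s i]
        [cross s (i + 1), cross s i, cross s (i + 1)]

/-- `u` and `v` are diagrams with `m` bottom and `n` top endpoints that differ by one move of
type `R` performed inside the diagram. -/
def Step (R : Word → Word → Prop) (m n : ℕ) (u v : Word) : Prop :=
  IsTangle m n u ∧ IsTangle m n v ∧
    ∃ a b l r : Word, R l r ∧ u = a ++ l ++ b ∧ v = a ++ r ++ b

/-- Planar isotopy relative to the endpoints. -/
def PlanarIsotopic (m n : ℕ) : Word → Word → Prop :=
  Relation.EqvGen (Step PlanarMove m n)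

/-- Equivalence of diagrams (planar isotopy and Reidemeister moves): the diagrams represent
isotopic links (for `m = n = 0`) or isotopic tangles. -/
def Isotopic (m n : ℕ) : Word → Word → Prop :=
  Relation.EqvGen (Step (fun l r => PlanarMove l r ∨ ReidemeisterMove l r) m n)

/-- The crossing number `c(L)` of the link `L` represented by `D`. -/
noncomputable def crossingNumber (D : Word) : ℕ :=
  sInf {k | ∃ D' : Word, Isotopic 0 0 D D' ∧ crossings D' = k}

/-! ### Connectivity of the projection -/

/-- Sweep a diagram from bottom to top.  Each strand carries a label, and two strands have the
same label when they are known to lie in the same connected piece of the projection swept so far;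
`k` is an unused label.  The result is the number of pieces that were closed off on the way,
together with the labels of the strands at the top. -/
def sweep : Word → List ℕ → ℕ → ℕ × List ℕ
  | [], ls, _ => (0, ls)
  | cup i :: w, ls, k => sweep w (ls.take i ++ [k, k] ++ ls.drop i) (k + 1)
  | cap i :: w, ls, k =>
      let x := ls.getD i 0
      let y := ls.getD (i + 1) 0
      let rest := (ls.take i ++ ls.drop (i + 2)).map fun z => if z = y then x else z
      let r := sweep w rest k
      (r.1 + (if x ∈ rest then 0 else 1), r.2)
  | cross _ i :: w, ls, k =>
      let x := ls.getD i 0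
      let y := ls.getD (i + 1) 0
      sweep w (ls.map fun z => if z = y then x else z) k

/-- The number of connected pieces of the projection of `w` (with `m` bottom endpoints) that do
not reach any endpoint.  All bottom endpoints get the label `0`, and one extra strand with this
label is kept at the far right, so that pieces reaching an endpoint are never counted.
For a link diagram (`m = 0`) this is the number of connected components of the projection. -/
def floating (m : ℕ) (w : Word) : ℕ := (sweep w (List.replicate (m + 1) 0) 1).1

/-- A link diagram is connected if its projection is connected. -/
def IsConnectedDiagram (D : Word) : Prop := floating 0 D = 1

/-- A tangle diagram with two bottom and two top endpoints is connected if its projection is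
connected, i.e. if there is neither a splitting loop nor a splitting arc. -/
def IsConnectedTangle (T : Word) : Prop :=
  (sweep T [0, 1] 2).1 = 0 ∧
    ∀ x ∈ (sweep T [0, 1] 2).2, ∀ y ∈ (sweep T [0, 1] 2).2, x = y

/-! ### Tangles with four endpoints

The endpoints are `SW`, `SE` (bottom) and `NW`, `NE` (top). -/

/-- The tangle `0`: two horizontal arcs. -/
def zeroTangle : Word := [cap 0, cup 0]

/-- The tangle `∞`: two vertical arcs. -/
def inftyTangle : Word := []

/-- The tangle `1` (for `s = true`) or `-1` (for `s = false`). -/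
def oneTangle (s : Bool) : Word := [cross s 0]

/-- The sum `T + S`: `S` is put to the right of `T`. -/
def tangleSum (T S : Word) : Word := [cup 1] ++ T ++ shift 2 S ++ [cap 1]

/-- The vertical composition `T * S`: `S` is put below `T`. -/
def tangleProd (T S : Word) : Word := S ++ T

/-- The numerator closure `n(T)`. -/
def numerator (T : Word) : Word := [cup 0] ++ T ++ [cap 0]

/-- The denominator closure `d(T)`. -/
def denominator (T : Word) : Word := [cup 0, cup 2] ++ shift 1 T ++ [cap 0, cap 0]

/-- The vertical tangle `1/2` (for `s = true`) or `-1/2` (for `s = false`). -/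
def halfTangle (s : Bool) : Word := tangleProd (oneTangle s) (oneTangle s)

/-- The horizontal tangle `2` (for `s = true`) or `-2` (for `s = false`). -/
def twoTangle (s : Bool) : Word := tangleSum (oneTangle s) (oneTangle s)

/-- `IsRational s t q`: `t` is an alternating diagram of the rational tangle with fraction `q > 0`
(for `s = true`) or `-q` (for `s = false`), obtained from one crossing of sign `s` by successively
adding crossings of the same sign on the right, on the left, at the bottom or at the top.
With `q = a₁ + 1/(a₂ + ⋯ + 1/aₙ)`, `a₁ ≥ 0` and `a₂, …, aₙ ≥ 1`, this includes the standard diagram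
of the tangle `[a₁, …, aₙ]` (resp. `[-a₁, …, -aₙ]`), whichever side the twists are put on. -/
inductive IsRational (s : Bool) : Word → ℚ → Prop
  | one : IsRational s (oneTangle s) 1
  | right {t : Word} {q : ℚ} : IsRational s t q → IsRational s (tangleSum t (oneTangle s)) (q + 1)
  | left {t : Word} {q : ℚ} : IsRational s t q → IsRational s (tangleSum (oneTangle s) t) (q + 1)
  | bottom {t : Word} {q : ℚ} :
      IsRational s t q → IsRational s (tangleProd t (oneTangle s)) (1 / (1 / q + 1))
  | top {t : Word} {q : ℚ} :
      IsRational s t q → IsRational s (tangleProd (oneTangle s) t) (1 / (1 / q + 1))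

/-! ### Diagrams with a marked crossing -/

/-- A diagram `pre ++ [cross sign pos] ++ post` with a marked crossing `c`. -/
structure MarkedDiagram : Type where
  pre : Word
  sign : Bool
  pos : ℕ
  post : Word

namespace MarkedDiagram

/-- The diagram obtained by replacing the marked crossing by the tangle diagram `t`. -/
def replace (M : MarkedDiagram) (t : Word) : Word := M.pre ++ shift M.pos t ++ M.post

/-- The underlying diagram `D`. -/
def diagram (M : MarkedDiagram) : Word := M.replace (oneTangle M.sign)

/-- The smoothing `D^c_0`. -/
def smoothZero (M : MarkedDiagram) : Word := M.replace zeroTangle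

/-- The smoothing `D^c_∞`. -/
def smoothInfty (M : MarkedDiagram) : Word := M.replace inftyTangle

/-- `N` is the diagram `D^{c ← t}` with one of the crossings of the inserted tangle `t` marked. -/
def MarksCrossingOf (M : MarkedDiagram) (t : Word) (N : MarkedDiagram) : Prop :=
  ∃ (u v : Word) (s : Bool) (j : ℕ), t = u ++ [cross s j] ++ v ∧
    N = ⟨M.pre ++ shift M.pos u, s, j + M.pos, shift M.pos v ++ M.post⟩

/-- `E` is a rational extension of the diagram at its marked crossing: the crossing is replaced by
a rational tangle diagram all of whose crossings have the same sign as that crossing. -/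
def IsRationalExtension (M : MarkedDiagram) (E : Word) : Prop :=
  ∃ (t : Word) (q : ℚ), IsRational M.sign t q ∧ E = M.replace t

end MarkedDiagram

/-- A diagram with `m` bottom endpoints is reduced if it has no nugatory crossing.  A crossing is
nugatory if some circle meets the diagram only in that crossing, passing between opposite corners;
equivalently, if one of its smoothings splits off a piece of the projection without endpoints. -/
def IsReduced (m : ℕ) (w : Word) : Prop :=
  ∀ M : MarkedDiagram, M.diagram = w →
    floating m M.smoothZero ≤ floating m w ∧ floating m M.smoothInfty ≤ floating m w

/-! ### Alternating diagrams -/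

/-- Over- and undercrossings alternate along a diagram iff every edge of the projection joins an
overpass to an underpass, i.e. iff all edges can be oriented so that they leave every crossing
along its overstrand and enter it along its understrand.  `AltRun w x y` says that `w` has such an
orientation which is `x` on the bottom and `y` on the top endpoints (`true` is upwards and `false`
is downwards). -/
def AltRun : Word → List Bool → List Bool → Prop
  | [], x, y => x = y
  | cup i :: w, x, y => ∃ b : Bool, AltRun w (x.take i ++ [b, !b] ++ x.drop i) y
  | cap i :: w, x, y =>
      (∃ b : Bool, x[i]? = some b ∧ x[i + 1]? = some (!b)) ∧
        AltRun w (x.take i ++ x.drop (i + 2)) y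
  | cross s i :: w, x, y => x[i]? = some (!s) ∧ x[i + 1]? = some s ∧ AltRun w x y

/-- Alternating link diagrams. -/
def IsAlternating (D : Word) : Prop := AltRun D [] []

/-- Alternating tangle diagrams of type 1: the arcs starting at `NW` and `SE` first pass under, and
those starting at `NE` and `SW` first pass over (the type of the tangle `1`). -/
def IsAlternatingTangle (T : Word) : Prop := AltRun T [false, true] [false, true]

/-- Strongly alternating tangle diagrams (of type 1). -/
def IsStronglyAlternating (T : Word) : Prop :=
  IsTangle 2 2 T ∧ IsAlternatingTangle T ∧
    IsConnectedDiagram (numerator T) ∧ IsReduced 0 (numerator T) ∧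
    IsConnectedDiagram (denominator T) ∧ IsReduced 0 (denominator T)

namespace MarkedDiagram

/-- The marked crossing is a dealternator: changing it makes the diagram alternating.
In particular the diagram is almost alternating. -/
def IsDealternator (M : MarkedDiagram) : Prop :=
  IsAlternating (M.replace (oneTangle (!M.sign)))

/-- Dealternator reduced: both smoothings at the dealternator are reduced alternating diagrams. -/
def IsDealternatorReduced (M : MarkedDiagram) : Prop :=
  (IsAlternating M.smoothZero ∧ IsReduced 0 M.smoothZero) ∧
    IsAlternating M.smoothInfty ∧ IsReduced 0 M.smoothInfty

/-- Dealternator connected: both smoothings at the dealternator are connected alternating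
diagrams. -/
def IsDealternatorConnected (M : MarkedDiagram) : Prop :=
  (IsAlternating M.smoothZero ∧ IsConnectedDiagram M.smoothZero) ∧
    IsAlternating M.smoothInfty ∧ IsConnectedDiagram M.smoothInfty

end MarkedDiagram

/-! ### Determinant -/

/-- The Kauffman states of a diagram.  Each state is given with the number of its `A`-smoothings
minus the number of its `A⁻¹`-smoothings.  The `A`-smoothing of a crossing joins the two regions
swept by turning the overstrand counterclockwise: it is the smoothing `∞` at a crossing of sign
`+1`, and the smoothing `0` at a crossing of sign `-1`. -/
def states : Word → List (ℤ × Word)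
  | [] => [(0, [])]
  | cross s i :: w =>
      (states w).map (fun p => (p.1 + (if s then 1 else -1), p.2)) ++
        (states w).map (fun p => (p.1 - (if s then 1 else -1), cap i :: cup i :: p.2))
  | cup i :: w => (states w).map fun p => (p.1, cup i :: p.2)
  | cap i :: w => (states w).map fun p => (p.1, cap i :: p.2)

/-- The Kauffman bracket of a link diagram, evaluated at `A` (normalized to be `1` on the
crossingless diagram of the unknot). -/
noncomputable def bracket (A : ℂ) (D : Word) : ℂ :=
  ((states D).map fun p =>
    A ^ p.1 * (-A ^ (2 : ℤ) - A ^ (-2 : ℤ)) ^ (floating 0 p.2 - 1)).sum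

/-- The determinant `det(L) = |V_L(-1)|` of the link `L` represented by `D`, where `V_L` is the
Jones polynomial: `V_L(A⁻⁴) = (-A³)^(-writhe) ⟨D⟩(A)`, and `A = exp(iπ/4)` gives `A⁻⁴ = -1`, where
the writhe factor has modulus one. -/
noncomputable def determinant (D : Word) : ℝ :=
  ‖bracket (Complex.exp (Real.pi / 4 * Complex.I)) D‖

/-! ### Quasi-alternating links -/

/-- `IsQuasiAlternating D`: the link represented by the diagram `D` is quasi-alternating, i.e. it
belongs to the smallest set of links that contains the unknot and contains every link with a
diagram having a crossing both of whose smoothings represent links of the set, with determinants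
adding up to the determinant of the link. -/
inductive IsQuasiAlternating : Word → Prop
  | unknot : IsQuasiAlternating unknot
  | isotopic {D D' : Word} :
      Isotopic 0 0 D D' → IsQuasiAlternating D → IsQuasiAlternating D'
  | crossing (M : MarkedDiagram) (hM : IsLinkDiagram M.diagram)
      (h0 : IsQuasiAlternating M.smoothZero) (h1 : IsQuasiAlternating M.smoothInfty)
      (hdet : determinant M.diagram = determinant M.smoothZero + determinant M.smoothInfty) :
      IsQuasiAlternating M.diagram

/-! ### Prime diagrams and local knots -/

/-- Closure of a diagram with one bottom and one top endpoint. -/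
def arcClosure (u : Word) : Word := [cup 0] ++ shift 1 u ++ [cap 0]

/-- Up to planar isotopy, `w` (with `m` bottom and `n` top endpoints) contains a disk meeting it in
the diagram `u` with two endpoints; `a ++ b` is `w` with this disk replaced by a plain strand. -/
def HasFactor (m n : ℕ) (w u a b : Word) : Prop :=
  ∃ p i : ℕ, IsTangle m p a ∧ IsTangle p n b ∧ i < p ∧ IsTangle 1 1 u ∧
    PlanarIsotopic m n w (a ++ shift i u ++ b)

/-- Prime link diagrams: the link is not the unknot, and every circle meeting the diagram
transversely in two points has on one side an unknotted arc. -/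
def IsPrimeDiagram (D : Word) : Prop :=
  ¬ Isotopic 0 0 D unknot ∧
    ∀ u a b : Word, HasFactor 0 0 D u a b →
      Isotopic 1 1 u [] ∨ Isotopic 0 0 (a ++ b) unknot

/-- A tangle diagram is locally unknotted if every disk inside the projection disk whose boundary
circle meets it transversely in two points meets it in a diagram of an unknotted arc. -/
def IsLocallyUnknotted (T : Word) : Prop :=
  ∀ u a b : Word, HasFactor 2 2 T u a b → Isotopic 1 1 u []

/-! ### The tangles `T ⋆ t` -/

/-- `W'` arises from `W` by adding `n` crossings `+1`, each on the left or on the right. -/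
inductive HTwist : ℕ → Word → Word → Prop
  | zero (W : Word) : HTwist 0 W W
  | right {n : ℕ} {W W' : Word} : HTwist n W W' → HTwist (n + 1) W (tangleSum W' (oneTangle true))
  | left {n : ℕ} {W W' : Word} : HTwist n W W' → HTwist (n + 1) W (tangleSum (oneTangle true) W')

/-- `W'` arises from `W` by adding `n` crossings `+1`, each at the bottom or at the top. -/
inductive VTwist : ℕ → Word → Word → Prop
  | zero (W : Word) : VTwist 0 W W
  | bottom {n : ℕ} {W W' : Word} :
      VTwist n W W' → VTwist (n + 1) W (tangleProd W' (oneTangle true))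
  | top {n : ℕ} {W W' : Word} :
      VTwist n W W' → VTwist (n + 1) W (tangleProd (oneTangle true) W')

/-- `Star T [a₁, …, a_k] W` (with `k` even): `W` is a diagram `T ⋆ t` for `t = [0, a₁, …, a_k]`,
that is, the diagram of `t` with the tangle diagram `T` inserted next to the innermost twists, or
`[0, a₁, …, a_k + T]`: starting from `T`, add `a_k` horizontal twists, then `a_{k-1}` vertical
twists, and so on up to the `a₁` vertical twists. -/
inductive Star (T : Word) : List ℕ → Word → Prop
  | nil : Star T [] T
  | cons {a b : ℕ} {l : List ℕ} {W W' W'' : Word} :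
      Star T l W → HTwist b W W' → VTwist a W' W'' → Star T (a :: b :: l) W''

/-- The continued fraction `[0, a₁, …, a_k] = 1/(a₁ + 1/(a₂ + ⋯ + 1/a_k))`. -/
def contFrac : List ℕ → ℚ
  | [] => 0
  | a :: l => 1 / (a + contFrac l)

/-- The link diagram `n(-1 + t₁ + ⋯ + t_m + S)`. -/
def insertedDiagram (ts : List Word) (S : Word) : Word :=
  numerator (tangleSum (oneTangle false) (ts.foldr tangleSum S))

/-- `ts` is a non-empty finite family of rational tangle diagrams with fractions in `(0, 1)`. -/
def IsRationalFamily (ts : List Word) : Prop :=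
  ts ≠ [] ∧ ∀ t ∈ ts, ∃ q : ℚ, 0 < q ∧ q < 1 ∧ IsRational true t q

end Knot

namespace Knot
open Layer

/-! ### Counting Boolean colourings of a projection -/

/-! At `A = exp(iπ/4)` a loop has value `-A² - A⁻² = 0`, so the Kauffman bracket is a sum over the
states with a single loop (`determinant_eq`). Loops and connected pieces are counted by Boolean
colourings that are constant on each piece: there are `2` to the number of pieces of them
(`colorings_eq_two_pow`), and these counts are values of composable transfer operators, so local
changes of a diagram can be compared locally.

Three facts carry the theorem.

Alternating diagrams have no cancellation. On a connected projection the alternating orientation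
differs from the orientation by parity of position by a constant, so the sign of each crossing is
tied to the parity of its position. The exponent of a state is then determined by its rotation
number, which is the same for all single-loop states (`exists_exponent`). Hence the determinant is
the number of single-loop states and adds up under smoothing (`determinant_eq_treeCount`,
`determinant_skein`).

A connected diagram without nugatory crossings has at least as many single-loop states as crossings
(`crossings_le_treeCount`). Single-loop states satisfy an exchange property like that of spanning
trees, and an exchange family in which every element can be moved from a fixed member has enough
members (`exists_injOn_of_exchange`).

A tangle with four endpoints equals, up to a phase, `Q` times the tangle `0` plus `iP` times the
tangle `∞` (`HasFraction`); fractions `P/Q` add under sums and their reciprocals add under vertical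
composition. For an alternating tangle, additivity of determinants forces the two coefficients into
a common phase, so `P` and `Q` are the determinants of the closures
(`hasFraction_of_isAlternatingTangle`). At a dealternator the same argument gives a difference
instead of a sum (`MarkedDiagram.determinant_replace`).

The rest is arithmetic. For the rational extensions, let `a` and `b` be the determinants of the
smoothings `0` and `∞`, both at least the number `n` of remaining crossings. A tangle of absolute
fraction `p/q < 1` gives `qa - pb = (q - p)b + q(a - b) ≥ n + q` when `a > b`, and it has at most
`q` crossings; the other case is symmetric. For `-1 + t₁ + ⋯ + t_m + T` with `P/Q` the sum of the
`t_i`, the determinant is `Pb + Q(a - b)`, where `a` and `b` now belong to the numerator and the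
denominator of `T`. This suffices if `P ≥ 2`; if `P = 1` there is one inserted tangle, a vertical
twist, and an isotopy saves one crossing (`crossingNumber_neg_one_add_le`). For the tangles `T ⋆ t`
with `t = p/q`, the summand `1 - t` in front cancels all but `x/(qB)` of the total apart from `P/Q`,
where `x` is the numerator determinant of `T` and `B` the denominator of `T ⋆ t`. The determinant is
therefore `PqB + Qx`. -/

/-- Insert two strands of colour `b` at position `i`. -/
def ins (i : ℕ) (b : Bool) (x : ℕ → Bool) : ℕ → Bool :=
  fun j => if j < i then x j else if j < i + 2 then b else x (j - 2)

/-- Delete the strands `i` and `i + 1`. -/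
def del (i : ℕ) (x : ℕ → Bool) : ℕ → Bool :=
  fun j => if j < i then x j else x (j + 2)

/-- The sum of `φ` over the colours of the top strands, taken over all colourings of the
projection of `w` that induce `x` at the bottom. -/
def tr : Word → ((ℕ → Bool) → ℕ) → (ℕ → Bool) → ℕ
  | [], φ, x => φ x
  | cup i :: w, φ, x => tr w φ (ins i false x) + tr w φ (ins i true x)
  | cap i :: w, φ, x => if x i = x (i + 1) then tr w φ (del i x) else 0
  | cross _ i :: w, φ, x => if x i = x (i + 1) then tr w φ x else 0

/-- The number of colourings of a link diagram. -/
def colorings (w : Word) : ℕ := tr w (fun _ => 1) (fun _ => false)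

/-- The transfer operator of a composite is the composite of the transfer operators, so an identity
between two local pieces persists in any surroundings. -/
theorem tr_append (a b : Word) (φ : (ℕ → Bool) → ℕ) : tr (a ++ b) φ = tr a (tr b φ) := by
  induction a with
  | nil => rfl
  | cons l a ih => cases l <;> (funext x; simp [tr, ih])

/-- Two words with the same colouring counts. -/
def TrEq (u v : Word) : Prop := ∀ φ, tr u φ = tr v φ

theorem TrEq.congr {u v : Word} (h : TrEq u v) (a b : Word) : TrEq (a ++ u ++ b) (a ++ v ++ b) := by
  intro φ
  simp only [tr_append, h _]

theorem TrEq.colorings {u v : Word} (h : TrEq u v) : colorings u = colorings v := by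
  simp only [Knot.colorings, h _]

@[simp] theorem del_ins (i : ℕ) (b : Bool) (x : ℕ → Bool) : del i (ins i b x) = x := by
  funext j
  simp only [del, ins]
  grind

theorem ins_del (i : ℕ) (x : ℕ → Bool) (h : x i = x (i + 1)) : ins i (x i) (del i x) = x := by
  funext j
  simp only [del, ins]
  grind

@[simp] theorem ins_self (i : ℕ) (b : Bool) (x : ℕ → Bool) : ins i b x i = b := by simp [ins]
@[simp] theorem ins_succ (i : ℕ) (b : Bool) (x : ℕ → Bool) : ins i b x (i + 1) = b := by simp [ins]

theorem del_succ_ins (i : ℕ) (x : ℕ → Bool) : del (i + 1) (ins i (x i) x) = x := by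
  funext j
  simp only [del, ins]
  grind

theorem del_ins_succ (i : ℕ) (x : ℕ → Bool) : del i (ins (i + 1) (x i) x) = x := by
  funext j
  simp only [del, ins]
  grind

theorem trEq_zigzag_left (i : ℕ) : TrEq [cup i, cap (i + 1)] [] := by
  intro φ; funext x
  have h2 : ∀ b, ins i b x (i + 1 + 1) = x i := by intro b; simp only [ins]; grind
  have := del_succ_ins i x
  simp only [tr, h2, ins_succ]
  cases h : x i <;> simp_all

theorem trEq_zigzag_right (i : ℕ) : TrEq [cup (i + 1), cap i] [] := by
  intro φ; funext x
  have h2 : ∀ b, ins (i + 1) b x i = x i := by intro b; simp [ins]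
  have := del_ins_succ i x
  simp only [tr, h2, ins_self]
  cases h : x i <;> simp_all

theorem tr_loop (i : ℕ) (φ : (ℕ → Bool) → ℕ) (x : ℕ → Bool) :
    tr [cup i, cap i] φ x = 2 * φ x := by
  simp [tr]; ring

theorem tr_two_mul (w : Word) (φ : (ℕ → Bool) → ℕ) (x : ℕ → Bool) (c : ℕ) :
    tr w (fun y => c * φ y) x = c * tr w φ x := by
  induction w generalizing x with
  | nil => rfl
  | cons l w ih => cases l <;> simp [tr, ih, mul_add]

theorem tr_add (w : Word) (φ ψ : (ℕ → Bool) → ℕ) (x : ℕ → Bool) :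
    tr w (fun y => φ y + ψ y) x = tr w φ x + tr w ψ x := by
  induction w generalizing x with
  | nil => rfl
  | cons l w ih =>
    cases l <;> simp only [tr, ih]
    · ring
    · split <;> simp
    · split <;> simp

theorem tr_mono (w : Word) {φ ψ : (ℕ → Bool) → ℕ} (h : ∀ x, φ x ≤ ψ x) (x : ℕ → Bool) :
    tr w φ x ≤ tr w ψ x := by
  induction w generalizing x with
  | nil => exact h x
  | cons l w ih =>
    cases l <;> simp only [tr]
    · exact add_le_add (ih _) (ih _)
    · split
      · exact ih _
      · exact le_rfl
    · split
      · exact ih _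
      · exact le_rfl

theorem colorings_loop (a b : Word) (i : ℕ) :
    colorings (a ++ [cup i, cap i] ++ b) = 2 * colorings (a ++ b) := by
  have : tr [cup i, cap i] (tr b fun _ => 1) = fun x => 2 * tr b (fun _ => 1) x := by
    funext x; exact tr_loop _ _ _
  simp only [colorings, tr_append, this, tr_two_mul]

theorem trEq_comm_cup_cap {i j : ℕ} (h : i ≤ j) :
    TrEq [cup i, cap (j + 2)] [cap j, cup i] := by
  intro φ; funext x
  have h1 : ∀ b, ins i b x (j + 2) = x j := by intro b; simp [ins]; grind
  have h2 : ∀ b, ins i b x (j + 2 + 1) = x (j + 1) := by intro b; simp [ins]; grind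
  have h3 : ∀ b, del (j + 2) (ins i b x) = ins i b (del j x) := by
    intro b; funext k; simp only [ins, del]; grind
  simp only [tr, h1, h2, h3]
  split <;> simp

theorem trEq_comm_cap_cup {i j : ℕ} (h : i ≤ j) :
    TrEq [cup (j + 2), cap i] [cap i, cup j] := by
  intro φ; funext x
  have h1 : ∀ b, ins (j + 2) b x i = x i := by intro b; simp [ins]; grind
  have h2 : ∀ b, ins (j + 2) b x (i + 1) = x (i + 1) := by intro b; simp [ins]; grind
  have h3 : ∀ b, del i (ins (j + 2) b x) = ins j b (del i x) := by
    intro b; funext k; simp only [ins, del]; grind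
  simp only [tr, h1, h2, h3]
  split <;> simp

theorem trEq_comm_cup_cup {i j : ℕ} (h : i ≤ j) :
    TrEq [cup i, cup (j + 2)] [cup j, cup i] := by
  intro φ; funext x
  have h3 : ∀ b c, ins (j + 2) b (ins i c x) = ins i c (ins j b x) := by
    intro b c; funext k; simp only [ins]; grind
  simp only [tr, h3]
  ring

theorem trEq_comm_cap_cap {i j : ℕ} (h : i ≤ j) :
    TrEq [cap i, cap j] [cap (j + 2), cap i] := by
  intro φ; funext x
  have h1 : del i x j = x (j + 2) := by simp [del]; grind
  have h2 : del i x (j + 1) = x (j + 2 + 1) := by simp [del]; grind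
  have h3 : del (j + 2) x i = x i := by simp [del]; grind
  have h4 : del (j + 2) x (i + 1) = x (i + 1) := by simp [del]; grind
  have h5 : del i (del (j + 2) x) = del j (del i x) := by funext k; simp only [del]; grind
  simp only [tr, h1, h2, h3, h4, h5]
  split <;> split <;> rfl

/-! ### Locality -/

/-- `φ` depends only on the first `n` colours. -/
def Local (n : ℕ) (φ : (ℕ → Bool) → ℕ) : Prop :=
  ∀ x y : ℕ → Bool, (∀ j < n, x j = y j) → φ x = φ y

theorem tr_local {m n : ℕ} {w : Word} (hw : IsTangle m n w) {φ : (ℕ → Bool) → ℕ}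
    (hφ : Local n φ) : Local m (tr w φ) := by
  induction w generalizing m with
  | nil => cases hw; exact hφ
  | cons l w ih =>
    intro x y hxy
    cases l with
    | cup i =>
      obtain ⟨hi, hw⟩ := hw
      have : ∀ b, tr w φ (ins i b x) = tr w φ (ins i b y) := by
        intro b
        refine ih hw _ _ fun j hj => ?_
        simp only [ins]
        grind
      simp only [tr, this]
    | cap i =>
      obtain ⟨hi, hw⟩ := hw
      have : tr w φ (del i x) = tr w φ (del i y) := by
        refine ih hw _ _ fun j hj => ?_
        simp only [del]
        grind
      simp only [tr, this, hxy i (by omega), hxy (i + 1) (by omega)]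
    | cross s i =>
      obtain ⟨hi, hw⟩ := hw
      simp only [tr, ih hw _ _ hxy, hxy i (by omega), hxy (i + 1) (by omega)]

theorem local_const (n c : ℕ) : Local n fun _ => c := fun _ _ _ => rfl

theorem colorings_eq_of_isTangle {w : Word} {n : ℕ} (hw : IsTangle 0 n w) (x : ℕ → Bool) :
    colorings w = tr w (fun _ => 1) x :=
  tr_local hw (local_const _ 1) _ _ (by simp)

/-- Constant colourings. -/
theorem le_tr_const (w : Word) (φ : (ℕ → Bool) → ℕ) (b : Bool) :
    φ (fun _ => b) ≤ tr w φ (fun _ => b) := by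
  have h1 : ∀ i, ins i b (fun _ => b) = fun _ => b := by
    intro i; funext j; simp only [ins]; grind
  have h2 : ∀ i, del i (fun _ => b) = fun _ => b := by
    intro i; funext j; simp only [del]; grind
  induction w with
  | nil => exact le_rfl
  | cons l w ih =>
    cases l with
    | cup i =>
      cases b
      · simp only [tr, h1]; omega
      · simp only [tr, h1]; omega
    | cap i => simpa [tr, h2] using ih
    | cross s i => simpa [tr] using ih

theorem IsTangle.append {l m n : ℕ} {u v : Word} (hu : IsTangle l m u) (hv : IsTangle m n v) :
    IsTangle l n (u ++ v) := by
  induction u generalizing l with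
  | nil => cases hu; exact hv
  | cons x u ih => cases x <;> exact ⟨hu.1, ih hu.2⟩

theorem isTangle_append {l n : ℕ} {u v : Word} :
    IsTangle l n (u ++ v) ↔ ∃ m, IsTangle l m u ∧ IsTangle m n v := by
  refine ⟨fun h => ?_, fun ⟨m, hu, hv⟩ => hu.append hv⟩
  induction u generalizing l with
  | nil => exact ⟨l, rfl, h⟩
  | cons x u ih =>
    cases x <;>
    · obtain ⟨m, h1, h2⟩ := ih h.2
      exact ⟨m, ⟨h.1, h1⟩, h2⟩

/-- A non-empty link diagram has to start with a minimum, and either colour of it extends to a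
constant colouring. -/
theorem two_le_colorings {w : Word} (hw : IsLinkDiagram w) (hne : w ≠ []) : 2 ≤ colorings w := by
  match w, hw, hne with
  | cup i :: w, hw, _ =>
    obtain ⟨hi, hw⟩ := hw
    obtain rfl : i = 0 := by omega
    have h : ∀ b, 1 ≤ tr w (fun _ => 1) (ins 0 b fun _ => false) := by
      intro b
      have := tr_local hw (local_const _ 1) (ins 0 b fun _ => false) (fun _ => b)
        (fun j hj => by simp only [ins]; grind)
      rw [this]
      exact le_tr_const w (fun _ => 1) b
    have h0 := h false
    have h1 := h true
    simp only [colorings, tr]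
    omega
  | cap i :: w, hw, _ => exact absurd hw.1 (by omega)
  | cross s i :: w, hw, _ => exact absurd hw.1 (by omega)

/-! ### Smoothing a crossing at most doubles the number of colourings -/

/-- `ψ'` vanishes or is a translate of `ψ`. -/
def Translate (ψ ψ' : (ℕ → Bool) → ℕ) : Prop :=
  ∀ x, ψ' x ≠ 0 → ∀ y, ψ' (fun j => xor (x j) (y j)) = ψ y

theorem ins_xor (i : ℕ) (b c : Bool) (x y : ℕ → Bool) :
    ins i (xor b c) (fun j => xor (x j) (y j)) = fun j => xor (ins i b x j) (ins i c y j) := by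
  funext j; simp only [ins]; grind

theorem del_xor (i : ℕ) (x y : ℕ → Bool) :
    del i (fun j => xor (x j) (y j)) = fun j => xor (del i x j) (del i y j) := by
  funext j; simp only [del]; grind

/-- The conditions on a colouring are linear over the field with two elements, so the extensions of
a boundary colouring form a coset whenever they exist. At a minimum the sum over both new colours
absorbs a swap of the two. -/
theorem Translate.tr {ψ ψ' : (ℕ → Bool) → ℕ} (h : Translate ψ ψ') (w : Word) :
    Translate (tr w ψ) (tr w ψ') := by
  induction w with
  | nil => exact h
  | cons l w ih =>
    cases l with
    | cup i =>
      intro x hx y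
      simp only [Knot.tr] at hx ⊢
      by_cases h0 : Knot.tr w ψ' (ins i false x) = 0
      · have h1 : Knot.tr w ψ' (ins i true x) ≠ 0 := by omega
        have e0 := ih _ h1 (ins i true y)
        have e1 := ih _ h1 (ins i false y)
        rw [← ins_xor] at e0 e1
        simp only [Bool.xor_true, Bool.not_true, Bool.xor_false] at e0 e1
        rw [e0, e1, add_comm]
      · have e0 := ih _ h0 (ins i true y)
        have e1 := ih _ h0 (ins i false y)
        rw [← ins_xor] at e0 e1
        simp only [Bool.xor_true, Bool.not_false, Bool.xor_false] at e0 e1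
        rw [e0, e1]
    | cap i =>
      intro x hx y
      simp only [Knot.tr, ne_eq, ite_eq_right_iff, Classical.not_imp] at hx ⊢
      rw [del_xor, ih _ hx.2]
      simp only [hx.1, Bool.xor_right_inj]
    | cross s i =>
      intro x hx y
      simp only [Knot.tr, ne_eq, ite_eq_right_iff, Classical.not_imp] at hx ⊢
      rw [ih _ hx.2]
      simp only [hx.1, Bool.xor_right_inj]

theorem Translate.zero {ψ ψ' : (ℕ → Bool) → ℕ} (h : Translate ψ ψ') :
    ψ' (fun _ => false) = 0 ∨ ψ' (fun _ => false) = ψ fun _ => false := by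
  by_cases h0 : ψ' (fun _ => false) = 0
  · exact Or.inl h0
  · exact Or.inr (by simpa using h _ h0 fun _ => false)

theorem translate_one : Translate (fun _ => 1) (fun _ => 1) := fun _ _ _ => rfl

/-- Colourings of the smoothed diagram split according to whether the two vertical arcs agree. Those
that agree are the colourings with the crossing; the others are absent or form a coset of the same
size. -/
theorem colorings_smoothInfty (a b : Word) (s : Bool) (i : ℕ) :
    colorings (a ++ b) = colorings (a ++ cross s i :: b) ∨
      colorings (a ++ b) = 2 * colorings (a ++ cross s i :: b) := by
  set φ := tr b fun _ => 1 with hφ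
  have hT : Translate φ φ := translate_one.tr b
  set ψ : (ℕ → Bool) → ℕ := fun x => if x i = x (i + 1) then φ x else 0 with hψ
  set ψ' : (ℕ → Bool) → ℕ := fun x => if x i = x (i + 1) then 0 else φ x with hψ'
  have h1 : Translate ψ ψ' := by
    intro x hx y
    simp only [hψ', ne_eq, ite_eq_left_iff, Classical.not_imp] at hx
    simp only [hψ, hψ', hT _ hx.2]
    have := hx.1
    cases h1 : x i <;> cases h2 : x (i + 1) <;> cases h3 : y i <;> cases h4 : y (i + 1) <;>
      simp_all
  have h2 : φ = fun x => ψ x + ψ' x := by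
    funext x; simp only [hψ, hψ']; split <;> simp
  have h3 : colorings (a ++ b) = tr a ψ (fun _ => false) + tr a ψ' (fun _ => false) := by
    rw [colorings, tr_append, ← hφ, h2, tr_add]
  have h4 : colorings (a ++ cross s i :: b) = tr a ψ (fun _ => false) := by
    rw [colorings, tr_append]; rfl
  rcases (h1.tr a).zero with h | h <;> omega

/-- The same dichotomy, applied to the arc below and the arc above. -/
theorem colorings_smoothZero (a b : Word) (s : Bool) (i : ℕ) :
    colorings (a ++ cap i :: cup i :: b) = colorings (a ++ cross s i :: b) ∨
      colorings (a ++ cap i :: cup i :: b) = 2 * colorings (a ++ cross s i :: b) := by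
  set φ := tr b fun _ => 1 with hφ
  have hT : Translate φ φ := translate_one.tr b
  set ψ : (ℕ → Bool) → ℕ := fun x => if x i = x (i + 1) then φ x else 0 with hψ
  set ψ' : (ℕ → Bool) → ℕ :=
    fun x => if x i = x (i + 1) then φ (ins i (!(x i)) (del i x)) else 0 with hψ'
  have h1 : Translate ψ ψ' := by
    intro x hx y
    simp only [hψ', ne_eq, ite_eq_right_iff, Classical.not_imp] at hx
    obtain ⟨hx1, hx2⟩ := hx
    simp only [hψ, hψ']
    by_cases hy : y i = y (i + 1)
    · have e := hT _ hx2 (ins i (y i) (del i y))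
      rw [← ins_xor, ins_del i y hy] at e
      rw [del_xor, if_pos hy, if_pos (by rw [hx1, hy]), ← e]
      congr 2
      cases x i <;> cases y i <;> rfl
    · rw [if_neg hy, if_neg]
      rw [hx1]; simpa using hy
  have h2 : tr (cap i :: cup i :: b) (fun _ => 1) = fun x => ψ x + ψ' x := by
    funext x
    simp only [tr, hψ, hψ', ← hφ]
    by_cases hx : x i = x (i + 1)
    · have e := ins_del i x hx
      cases h : x i <;> simp_all <;> omega
    · simp [hx]
  have h3 : colorings (a ++ cap i :: cup i :: b)
      = tr a ψ (fun _ => false) + tr a ψ' (fun _ => false) := by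
    rw [colorings, tr_append, h2, tr_add]
  have h4 : colorings (a ++ cross s i :: b) = tr a ψ (fun _ => false) := by
    rw [colorings, tr_append]; rfl
  rcases (h1.tr a).zero with h | h <;> omega


/-! ### Sweeping and colourings -/

/-- The colours of a list of strands, extended by `false`. -/
def ofList (l : List Bool) : ℕ → Bool := fun j => l.getD j false

theorem ofList_insert (l : List Bool) (i : ℕ) (a b : Bool) (hi : i ≤ l.length) (j : ℕ) :
    ofList (l.take i ++ [a, b] ++ l.drop i) j =
      if j < i then ofList l j else if j = i then a else if j = i + 1 then b
        else ofList l (j - 2) := by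
  simp only [ofList, List.getD_eq_getElem?_getD, List.append_assoc]
  rcases lt_or_ge j i with h | h
  · rw [List.getElem?_append_left (by simp; omega), if_pos h]
    simp [h]
  · rw [List.getElem?_append_right (by simp; omega), if_neg (by omega)]
    simp only [List.length_take, min_eq_left hi]
    obtain ⟨k, rfl⟩ := Nat.exists_eq_add_of_le h
    rcases k with _ | _ | k
    · simp
    · simp
    · simp [show i + (k + 1 + 1) - i = k + 2 by omega]
      congr 2

theorem ofList_ins (l : List Bool) (i : ℕ) (b : Bool) (hi : i ≤ l.length) :
    ofList (l.take i ++ [b, b] ++ l.drop i) = ins i b (ofList l) := by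
  funext j
  rw [ofList_insert l i b b hi]
  simp only [ins]
  grind

theorem ofList_del (l : List Bool) (i : ℕ) (hi : i ≤ l.length) :
    ofList (l.take i ++ l.drop (i + 2)) = del i (ofList l) := by
  funext j
  simp only [ofList, del, List.getD_eq_getElem?_getD]
  rcases lt_or_ge j i with h | h
  · rw [List.getElem?_append_left (by simp; omega), if_pos h]
    simp [h]
  · rw [List.getElem?_append_right (by simp; omega), if_neg (by omega)]
    simp only [List.length_take, min_eq_left hi, List.getElem?_drop]
    congr 2; omega

/-- The colours of strands with labels `ls`, where the labels in `s` have colour `true`. -/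
def pad (s : Finset ℕ) (ls : List ℕ) : ℕ → Bool := ofList (ls.map fun z => decide (z ∈ s))

theorem pad_apply (s : Finset ℕ) (ls : List ℕ) (j : ℕ) (hj : j < ls.length) :
    pad s ls j = decide (ls.getD j 0 ∈ s) := by
  simp [pad, ofList, List.getD_eq_getElem?_getD, hj]

theorem pad_congr {s t : Finset ℕ} {ls ls' : List ℕ} (f : ℕ → ℕ) (hls : ls' = ls.map f)
    (h : ∀ z ∈ ls, z ∈ s ↔ f z ∈ t) : pad s ls = pad t ls' := by
  subst hls
  simp only [pad, List.map_map]
  congr 1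
  refine List.map_congr_left fun z hz => ?_
  simp [h z hz]

theorem sum_powerset_range_erase {K y : ℕ} (hy : y < K) (H : Finset ℕ → ℕ) :
    ∑ s ∈ (Finset.range K).powerset, H s =
      ∑ s ∈ ((Finset.range K).erase y).powerset, (H s + H (insert y s)) := by
  conv_lhs => rw [← Finset.insert_erase (Finset.mem_range.mpr hy)]
  rw [Finset.sum_powerset_insert (Finset.notMem_erase _ _), Finset.sum_add_distrib]

theorem notMem_of_mem_powerset_erase {K y : ℕ} {s : Finset ℕ}
    (hs : s ∈ ((Finset.range K).erase y).powerset) : y ∉ s := fun h =>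
  Finset.notMem_erase y _ (Finset.mem_powerset.mp hs h)

/-- Prescribing equal colours for the labels `x` and `y` halves the choices; once the strands
labelled `y` are relabelled `x`, the colour of `y` is free and restores the factor. -/
theorem two_mul_sum_identify {K x y : ℕ} (hy : y < K) (hxy : x ≠ y) (G G' : Finset ℕ → ℕ)
    (h1 : ∀ s, y ∉ s → x ∈ s → G (insert y s) = G' s) (h2 : ∀ s, y ∉ s → x ∉ s → G s = G' s)
    (h3 : ∀ s, y ∉ s → G' (insert y s) = G' s) :
    2 * ∑ s ∈ (Finset.range K).powerset, (if (x ∈ s ↔ y ∈ s) then G s else 0) =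
      ∑ s ∈ (Finset.range K).powerset, G' s := by
  rw [sum_powerset_range_erase hy, sum_powerset_range_erase hy, Finset.mul_sum]
  refine Finset.sum_congr rfl fun s hs => ?_
  have hs := notMem_of_mem_powerset_erase hs
  by_cases hx : x ∈ s
  · simp [hx, hs, h1 s hs hx, h3 s hs, two_mul]
  · simp [hx, hs, hxy, h2 s hs hx, h3 s hs, two_mul]

theorem getD_mem {ls : List ℕ} {i : ℕ} (hi : i < ls.length) : ls.getD i 0 ∈ ls := by
  simp [List.getD_eq_getElem?_getD, hi]

theorem split_two (ls : List ℕ) (i : ℕ) (hi : i + 2 ≤ ls.length) :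
    ls = ls.take i ++ (ls.getD i 0 :: ls.getD (i + 1) 0 :: ls.drop (i + 2)) := by
  conv_lhs => rw [← List.take_append_drop i ls]
  congr 1
  rw [List.drop_eq_getElem_cons (by omega), List.drop_eq_getElem_cons (by omega)]
  simp [List.getD_eq_getElem?_getD, show i < ls.length by omega, show i + 1 < ls.length by omega]

-- The invariant that ties the sweep to colourings. Labels are coloured by the set `s` of those with
-- colour `true`. All labels below the fixed bound `K`, used or not, are summed over, so both sides
-- stay comparable when labels are created or merged; the powers of two correct for the labels
-- present at the bottom and at the top.
set_option maxHeartbeats 1000000 in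
theorem sweep_colorings (φ : (ℕ → Bool) → ℕ) {n K : ℕ} (w : Word) (ls : List ℕ) (k : ℕ)
    (hw : IsTangle ls.length n w) (hls : ∀ l ∈ ls, l < k) (hK : k + w.length ≤ K) :
    (∑ s ∈ (Finset.range K).powerset, tr w φ (pad s ls)) * 2 ^ ls.toFinset.card =
      2 ^ ((sweep w ls k).1 + (sweep w ls k).2.toFinset.card) *
        ∑ s ∈ (Finset.range K).powerset, φ (pad s (sweep w ls k).2) := by
  induction w generalizing ls k with
  | nil => simp [sweep, tr, mul_comm]
  | cons l w ih =>
    simp only [List.length_cons] at hK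
    cases l with
    | cup i =>
      obtain ⟨hi, hw⟩ := hw
      set ls' := ls.take i ++ [k, k] ++ ls.drop i with hls'
      have hmem : ∀ z, z ∈ ls' ↔ z = k ∨ z ∈ ls := by
        intro z
        conv_rhs => rw [← List.take_append_drop i ls]
        simp only [hls', List.mem_append, List.mem_cons, List.not_mem_nil]
        tauto
      have hkls : k ∉ ls := fun h => lt_irrefl _ (hls k h)
      have hcard : ls'.toFinset.card = ls.toFinset.card + 1 := by
        have : ls'.toFinset = insert k ls.toFinset := by ext z; simp [hmem]
        rw [this, Finset.card_insert_of_notMem (by simpa using hkls)]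
      have hlen : ls'.length = ls.length + 2 := by
        simp [hls']; omega
      have IH := ih ls' (k + 1) (by rw [hlen]; exact hw)
        (fun z hz => by rcases (hmem z).1 hz with h | h
                        · omega
                        · have := hls z h; omega) (by omega)
      have hpad : ∀ s, pad s ls' = ins i (decide (k ∈ s)) (pad s ls) := by
        intro s
        rw [pad, pad, ← ofList_ins _ _ _ (by simpa using hi), hls']
        simp
      have hpad' : ∀ s, k ∉ s → pad (insert k s) ls = pad s ls := by
        intro s hs
        refine pad_congr id (by simp) fun z hz => ?_
        have : z ≠ k := fun h => hkls (h ▸ hz)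
        simp [this]
      -- On the left the fresh label `k` is an idle bit and the minimum sums over both colours; on
      -- the right the bit of `k` is the colour of the minimum.
      have key : ∑ s ∈ (Finset.range K).powerset, tr (cup i :: w) φ (pad s ls) =
          2 * ∑ s ∈ (Finset.range K).powerset, tr w φ (pad s ls') := by
        have hkK : k < K := by omega
        rw [sum_powerset_range_erase hkK, sum_powerset_range_erase hkK, Finset.mul_sum]
        refine Finset.sum_congr rfl fun s hs => ?_
        have hs := notMem_of_mem_powerset_erase hs
        simp [tr, hpad, hpad' s hs, hs]
        ring
      simp only [sweep]
      rw [key, ← hls', ← IH, hcard]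
      ring
    | cap i =>
      obtain ⟨hi, hw⟩ := hw
      set x := ls.getD i 0 with hx
      set y := ls.getD (i + 1) 0 with hy
      set rest' := ls.take i ++ ls.drop (i + 2) with hrest'
      set f : ℕ → ℕ := fun z => if z = y then x else z with hf
      set rest := rest'.map f with hrest
      have hmem : ∀ z, z ∈ ls ↔ z = x ∨ z = y ∨ z ∈ rest' := by
        intro z
        rw [split_two ls i hi]
        simp only [hrest', List.mem_append, List.mem_cons, ← hx, ← hy]
        tauto
      have hlen : rest.length = ls.length - 2 := by
        simp [hrest, hrest']; omega
      have hxk : x < k := hls _ ((hmem x).2 (Or.inl rfl))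
      have hyk : y < k := hls _ ((hmem y).2 (Or.inr (Or.inl rfl)))
      have IH := ih rest k (by rw [hlen]; exact hw)
        (fun z hz => by
          obtain ⟨u, hu, rfl⟩ := List.mem_map.1 hz
          have := hls u ((hmem u).2 (Or.inr (Or.inr hu)))
          simp only [hf]; split <;> omega) (by omega)
      have hpadx : ∀ s, pad s ls i = decide (x ∈ s) := fun s => pad_apply _ _ _ (by omega)
      have hpady : ∀ s, pad s ls (i + 1) = decide (y ∈ s) := fun s => pad_apply _ _ _ (by omega)
      have hdel : ∀ s, del i (pad s ls) = pad s rest' := by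
        intro s
        rw [pad, pad, ← ofList_del _ _ (by simp; omega), hrest']
        simp
      have htr : ∀ s, tr (cap i :: w) φ (pad s ls) =
          if (x ∈ s ↔ y ∈ s) then tr w φ (pad s rest') else 0 := by
        intro s
        simp only [tr, hpadx, hpady, hdel, decide_eq_decide]
      have hd : (insert x rest.toFinset).card = rest.toFinset.card + if x ∈ rest then 0 else 1 := by
        by_cases h : x ∈ rest
        · simp [h]
        · rw [Finset.card_insert_of_notMem (by simpa using h), if_neg h]
      simp only [sweep, ← hx, ← hy, ← hrest', htr]
      change _ = 2 ^ ((sweep w rest k).1 + (if x ∈ rest then 0 else 1) +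
        (sweep w rest k).2.toFinset.card) *
          ∑ s ∈ (Finset.range K).powerset, φ (pad s (sweep w rest k).2)
      -- If the two strands already share a label nothing merges, and a piece closes off exactly
      -- when no other strand carries that label. Otherwise the label `y` disappears.
      by_cases hxy : x = y
      · have hrr : rest = rest' := by
          rw [hrest]
          conv_rhs => rw [← List.map_id rest']
          refine List.map_congr_left fun z _ => ?_
          simp only [hf, hxy, id]; split <;> simp_all
        have hset : ls.toFinset = insert x rest.toFinset := by
          ext z
          simp only [List.mem_toFinset, hmem, hrr, Finset.mem_insert, ← hxy]
          tauto
        rw [hset, hd]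
        simp only [← hxy, iff_self, if_true]
        rw [hrr] at IH ⊢
        rw [add_right_comm, pow_add, pow_add 2 ((sweep w rest' k).1 + _), ← mul_assoc, IH]
        ring
      · have hset : ls.toFinset.card = (insert x rest.toFinset).card + 1 := by
          have hyl : y ∈ ls.toFinset := by simp [hmem]
          rw [← Finset.card_erase_add_one hyl]
          congr 2
          ext z
          simp only [Finset.mem_erase, List.mem_toFinset, hmem, Finset.mem_insert, hrest,
            List.mem_map, hf]
          constructor
          · rintro ⟨h1, h2 | h2 | h2⟩
            · exact Or.inl h2
            · exact absurd h2 h1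
            · exact Or.inr ⟨z, h2, if_neg h1⟩
          · rintro (rfl | ⟨u, hu, rfl⟩)
            · exact ⟨hxy, Or.inl rfl⟩
            · split
              · exact ⟨hxy, Or.inl rfl⟩
              · exact ⟨by assumption, Or.inr (Or.inr hu)⟩
        have key := two_mul_sum_identify (K := K) (by omega) hxy
          (fun s => tr w φ (pad s rest')) (fun s => tr w φ (pad s rest))
          (fun s hys hxs => by
            have : pad (insert y s) rest' = pad s rest := pad_congr f hrest fun z _ => by
              simp only [hf]; split <;> simp_all
            simp only [this])
          (fun s hys hxs => by
            have : pad s rest' = pad s rest := pad_congr f hrest fun z _ => by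
              simp only [hf]; split <;> simp_all
            simp only [this])
          (fun s hys => by
            have : pad (insert y s) rest = pad s rest := pad_congr id (by simp) fun z hz => by
              obtain ⟨u, hu, rfl⟩ := List.mem_map.1 hz
              simp only [hf, id]; split <;> simp_all
            simp only [this])
        rw [hset, hd]
        rw [← key] at IH
        simp only [pow_add, pow_one] at IH ⊢
        linear_combination (2 ^ (if x ∈ rest then 0 else 1)) * IH
    | cross c i =>
      obtain ⟨hi, hw⟩ := hw
      set x := ls.getD i 0 with hx
      set y := ls.getD (i + 1) 0 with hy
      set f : ℕ → ℕ := fun z => if z = y then x else z with hf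
      set rest := ls.map f with hrest
      have hxl : x ∈ ls := getD_mem (by omega)
      have hyl : y ∈ ls := getD_mem (by omega)
      have hxk : x < k := hls _ hxl
      have hyk : y < k := hls _ hyl
      have IH := ih rest k (by rw [hrest, List.length_map]; exact hw)
        (fun z hz => by
          obtain ⟨u, hu, rfl⟩ := List.mem_map.1 hz
          have := hls u hu
          simp only [hf]; split <;> omega) (by omega)
      have hpadx : ∀ s, pad s ls i = decide (x ∈ s) := fun s => pad_apply _ _ _ (by omega)
      have hpady : ∀ s, pad s ls (i + 1) = decide (y ∈ s) := fun s => pad_apply _ _ _ (by omega)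
      have htr : ∀ s, tr (cross c i :: w) φ (pad s ls) =
          if (x ∈ s ↔ y ∈ s) then tr w φ (pad s ls) else 0 := by
        intro s
        simp only [tr, hpadx, hpady, decide_eq_decide]
      simp only [sweep, ← hx, ← hy, htr]
      change _ = 2 ^ ((sweep w rest k).1 + (sweep w rest k).2.toFinset.card) *
          ∑ s ∈ (Finset.range K).powerset, φ (pad s (sweep w rest k).2)
      by_cases hxy : x = y
      · have hrr : rest = ls := by
          rw [hrest]
          conv_rhs => rw [← List.map_id ls]
          refine List.map_congr_left fun z _ => ?_
          simp only [hf, hxy, id]; split <;> simp_all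
        simp only [← hxy, iff_self, if_true]
        rw [hrr] at IH ⊢
        exact IH
      · have hset : ls.toFinset.card = rest.toFinset.card + 1 := by
          rw [← Finset.card_erase_add_one (List.mem_toFinset.2 hyl)]
          congr 2
          ext z
          simp only [Finset.mem_erase, List.mem_toFinset, hrest, List.mem_map, hf]
          constructor
          · rintro ⟨h1, h2⟩
            exact ⟨z, h2, if_neg h1⟩
          · rintro ⟨u, hu, rfl⟩
            split
            · exact ⟨hxy, hxl⟩
            · exact ⟨by assumption, hu⟩
        have key := two_mul_sum_identify (K := K) (by omega) hxy
          (fun s => tr w φ (pad s ls)) (fun s => tr w φ (pad s rest))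
          (fun s hys hxs => by
            have : pad (insert y s) ls = pad s rest := pad_congr f hrest fun z _ => by
              simp only [hf]; split <;> simp_all
            simp only [this])
          (fun s hys hxs => by
            have : pad s ls = pad s rest := pad_congr f hrest fun z _ => by
              simp only [hf]; split <;> simp_all
            simp only [this])
          (fun s hys => by
            have : pad (insert y s) rest = pad s rest := pad_congr id (by simp) fun z hz => by
              obtain ⟨u, hu, rfl⟩ := List.mem_map.1 hz
              simp only [hf, id]; split <;> simp_all
            simp only [this])
        rw [hset, pow_succ]
        rw [← key] at IH
        linear_combination IH

theorem length_sweep {m n : ℕ} (w : Word) (ls : List ℕ) (k : ℕ) (hm : ls.length = m)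
    (hw : IsTangle m n w) : (sweep w ls k).2.length = n := by
  induction w generalizing ls k m with
  | nil => cases hw; exact hm
  | cons l w ih =>
    cases l with
    | cup i => exact ih _ _ (by have := hw.1; simp; omega) hw.2
    | cap i => exact ih _ _ (by have := hw.1; simp; omega) hw.2
    | cross s i => exact ih _ _ (by simpa using hm) hw.2

/-- A well-formed diagram stays well-formed when strands are added on the right. -/
theorem IsTangle.add_right {m n : ℕ} {w : Word} (hw : IsTangle m n w) (k : ℕ) :
    IsTangle (m + k) (n + k) w := by
  induction w generalizing m with
  | nil => cases hw; rfl
  | cons l w ih =>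
    cases l with
    | cup i => exact ⟨by have := hw.1; omega, by have := ih hw.2; rwa [add_right_comm] at this⟩
    | cap i =>
      exact ⟨by have := hw.1; omega,
        by have := ih hw.2; rwa [show m - 2 + k = m + k - 2 by have := hw.1; omega] at this⟩
    | cross s i => exact ⟨by have := hw.1; omega, ih hw.2⟩

/-- The sweep in `floating` carries one additional strand, on which the closed diagram does not act.
Exactly one label is present at the start and at the end, so these contributions cancel in
`sweep_colorings`. -/
theorem colorings_eq_two_pow {w : Word} (hw : IsLinkDiagram w) :
    colorings w = 2 ^ floating 0 w := by
  have h1 : IsTangle 1 1 w := hw.add_right 1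
  have hlen := length_sweep w [0] 1 (by simp) h1
  have key := sweep_colorings (fun _ => 1) (K := 1 + w.length) w [0] 1
    (by simpa using h1) (by simp) le_rfl
  have hc : ∀ s, tr w (fun _ => 1) (pad s [0]) = colorings w := fun s =>
    (colorings_eq_of_isTangle hw _).symm
  have hcard : (sweep w [0] 1).2.toFinset.card = 1 := by
    obtain ⟨a, ha⟩ := List.length_eq_one_iff.1 hlen
    simp [ha]
  have hfl : floating 0 w = (sweep w [0] 1).1 := rfl
  simp only [hc, hcard, Finset.sum_const, Finset.card_powerset, Finset.card_range, smul_eq_mul,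
    mul_one, List.toFinset_cons, List.toFinset_nil, insert_empty_eq,
    Finset.card_singleton, ← hfl] at key
  have h2 : (2 : ℕ) ^ (1 + w.length) * 2 ≠ 0 := by positivity
  refine Nat.eq_of_mul_eq_mul_left (Nat.pos_of_ne_zero h2) ?_
  linear_combination key

theorem floating_le_one_iff {w : Word} (hw : IsLinkDiagram w) :
    floating 0 w ≤ 1 ↔ colorings w ≤ 2 := by
  rw [colorings_eq_two_pow hw]
  constructor
  · intro h
    calc 2 ^ floating 0 w ≤ 2 ^ 1 := Nat.pow_le_pow_right (by norm_num) h
      _ = 2 := by norm_num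
  · intro h
    by_contra h'
    have : 2 ^ 2 ≤ 2 ^ floating 0 w := Nat.pow_le_pow_right (by norm_num) (by omega)
    omega

theorem IsConnectedDiagram.colorings {w : Word} (hw : IsLinkDiagram w) (h : IsConnectedDiagram w) :
    colorings w = 2 := by
  rw [colorings_eq_two_pow hw, h]; norm_num


/-! ### Reduction of crossingless diagrams -/

/-- Crossingless words. -/
def IsFlat (u : Word) : Prop := ∀ l ∈ u, ∀ s i, l ≠ cross s i

theorem IsFlat.append {u v : Word} (hu : IsFlat u) (hv : IsFlat v) : IsFlat (u ++ v) := by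
  intro l hl
  rcases List.mem_append.1 hl with h | h
  · exact hu l h
  · exact hv l h

/-- Rewriting rules that move maxima below minima, together with the number of loops removed. -/
inductive FlatRule : Word → ℕ → Word → Prop
  | zigzag_left (i : ℕ) : FlatRule [cup i, cap (i + 1)] 0 []
  | zigzag_right (i : ℕ) : FlatRule [cup (i + 1), cap i] 0 []
  | loop (i : ℕ) : FlatRule [cup i, cap i] 1 []
  | comm_left (i j : ℕ) (h : i ≤ j) : FlatRule [cup i, cap (j + 2)] 0 [cap j, cup i]
  | comm_right (i j : ℕ) (h : i ≤ j) : FlatRule [cup (j + 2), cap i] 0 [cap i, cup j]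

/-- `FlatRed u k v`: the word `u` reduces to `v`, with the removal of `k` loops. -/
inductive FlatRed : Word → ℕ → Word → Prop
  | refl (u : Word) : FlatRed u 0 u
  | head {a b l r v : Word} {k k' : ℕ} : FlatRule l k r → FlatRed (a ++ r ++ b) k' v →
      FlatRed (a ++ l ++ b) (k + k') v

theorem FlatRed.trans {u v w : Word} {k k' : ℕ} (h : FlatRed u k v) (h' : FlatRed v k' w) :
    FlatRed u (k + k') w := by
  induction h with
  | refl u => simpa using h'
  | head hr _ ih => rw [add_assoc]; exact .head hr (ih h')

theorem FlatRed.congr {u v : Word} {k : ℕ} (h : FlatRed u k v) (a b : Word) :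
    FlatRed (a ++ u ++ b) k (a ++ v ++ b) := by
  induction h with
  | refl u => exact .refl _
  | @head a' b' l r v k k' hr _ ih =>
    have := FlatRed.head (a := a ++ a') (b := b' ++ b) (k' := k') (v := a ++ v ++ b) hr
      (by simpa using ih)
    simpa using this

theorem FlatRed.cons {u v : Word} {k : ℕ} (h : FlatRed u k v) (l : Layer) :
    FlatRed (l :: u) k (l :: v) := by
  simpa using h.congr [l] []

/-- The minimum is pushed upwards through the maxima: at each one it cancels, closes a loop, or
passes. -/
theorem exists_flatRed_cup_caps (caps : Word) (hcaps : ∀ l ∈ caps, ∃ i, l = cap i) (i : ℕ) :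
    ∃ k caps' cups', FlatRed (cup i :: caps) k (caps' ++ cups') ∧
      (∀ l ∈ caps', ∃ i, l = cap i) ∧ (∀ l ∈ cups', ∃ i, l = cup i) := by
  induction caps generalizing i with
  | nil => exact ⟨0, [], [cup i], .refl _, by simp, by simp⟩
  | cons c caps ih =>
    obtain ⟨j, rfl⟩ := hcaps c (by simp)
    have hcaps' : ∀ l ∈ caps, ∃ i, l = cap i := fun l hl => hcaps l (by simp [hl])
    have key : (∃ k, FlatRule [cup i, cap j] k []) ∨
        ∃ i' j', FlatRule [cup i, cap j] 0 [cap j', cup i'] := by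
      rcases lt_trichotomy i j with h | h | h
      · rcases Nat.lt_or_ge (i + 1) j with h' | h'
        · obtain ⟨j', rfl⟩ := Nat.exists_eq_add_of_le h'
          refine Or.inr ⟨i, i + j', ?_⟩
          have := FlatRule.comm_left i (i + j') (by omega)
          rwa [show i + j' + 2 = i + 1 + 1 + j' by omega] at this
        · obtain rfl : j = i + 1 := by omega
          exact Or.inl ⟨0, .zigzag_left i⟩
      · subst h; exact Or.inl ⟨1, .loop i⟩
      · rcases Nat.lt_or_ge (j + 1) i with h' | h'
        · obtain ⟨i', rfl⟩ := Nat.exists_eq_add_of_le h'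
          refine Or.inr ⟨j + i', j, ?_⟩
          have := FlatRule.comm_right j (j + i') (by omega)
          rwa [show j + i' + 2 = j + 1 + 1 + i' by omega] at this
        · obtain rfl : i = j + 1 := by omega
          exact Or.inl ⟨0, .zigzag_right j⟩
    rcases key with ⟨k, hk⟩ | ⟨i', j', hk⟩
    · refine ⟨k + 0, caps, [], ?_, hcaps', by simp⟩
      simpa using FlatRed.head (a := []) (b := caps) hk (.refl _)
    · obtain ⟨k, caps', cups', h1, h2, h3⟩ := ih hcaps' i'
      refine ⟨0 + k, cap j' :: caps', cups', ?_, ?_, h3⟩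
      · exact FlatRed.head (a := []) (b := caps) hk (by simpa using h1.cons (cap j'))
      · intro l hl
        rcases List.mem_cons.1 hl with rfl | hl
        · exact ⟨_, rfl⟩
        · exact h2 l hl

/-- Every crossingless diagram reduces to maxima followed by minima. -/
theorem exists_flatRed (u : Word) (hu : IsFlat u) :
    ∃ k caps cups, FlatRed u k (caps ++ cups) ∧
      (∀ l ∈ caps, ∃ i, l = cap i) ∧ (∀ l ∈ cups, ∃ i, l = cup i) := by
  induction u with
  | nil => exact ⟨0, [], [], .refl _, by simp, by simp⟩
  | cons l u ih =>
    obtain ⟨k, caps, cups, h1, h2, h3⟩ := ih fun x hx => hu x (by simp [hx])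
    cases l with
    | cup i =>
      obtain ⟨k', caps', cups', g1, g2, g3⟩ := exists_flatRed_cup_caps caps h2 i
      refine ⟨k + k', caps', cups' ++ cups, ?_, g2, ?_⟩
      · have := (h1.cons (cup i)).trans (by simpa using g1.congr [] cups)
        simpa using this
      · intro l hl
        rcases List.mem_append.1 hl with hl | hl
        · exact g3 l hl
        · exact h3 l hl
    | cap i =>
      refine ⟨k, cap i :: caps, cups, h1.cons _, ?_, h3⟩
      intro l hl
      rcases List.mem_cons.1 hl with rfl | hl
      · exact ⟨_, rfl⟩
      · exact h2 l hl
    | cross s i => exact absurd rfl (hu (cross s i) (by simp) s i)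

theorem FlatRule.isTangle {l r : Word} {k m n : ℕ} (h : FlatRule l k r) (hl : IsTangle m n l) :
    IsTangle m n r := by
  cases h <;> simp only [IsTangle] at hl ⊢ <;> omega

theorem FlatRed.isTangle {u v : Word} {k m n : ℕ} (h : FlatRed u k v) (hu : IsTangle m n u) :
    IsTangle m n v := by
  induction h with
  | refl u => exact hu
  | head hr _ ih =>
    apply ih
    rw [isTangle_append] at hu ⊢
    obtain ⟨p, hu, hb⟩ := hu
    rw [isTangle_append] at hu
    obtain ⟨q, ha, hl⟩ := hu
    exact ⟨p, ha.append (hr.isTangle hl), hb⟩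

theorem FlatRule.colorings {l r : Word} {k : ℕ} (h : FlatRule l k r) (a b : Word) :
    colorings (a ++ l ++ b) = 2 ^ k * colorings (a ++ r ++ b) := by
  cases h with
  | zigzag_left i => simp only [pow_zero, one_mul]; exact ((trEq_zigzag_left i).congr a b).colorings
  | zigzag_right i =>
    simp only [pow_zero, one_mul]; exact ((trEq_zigzag_right i).congr a b).colorings
  | loop i => simpa using colorings_loop a b i
  | comm_left i j h =>
    simp only [pow_zero, one_mul]; exact ((trEq_comm_cup_cap h).congr a b).colorings
  | comm_right i j h =>
    simp only [pow_zero, one_mul]; exact ((trEq_comm_cap_cup h).congr a b).colorings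

theorem FlatRed.colorings {u v : Word} {k : ℕ} (h : FlatRed u k v) (a b : Word) :
    colorings (a ++ u ++ b) = 2 ^ k * colorings (a ++ v ++ b) := by
  induction h with
  | refl u => simp
  | @head a' b' l r v k k' hr _ ih =>
    have := hr.colorings (a ++ a') (b' ++ b)
    simp only [List.append_assoc] at this ih ⊢
    rw [this, ih, pow_add]; ring

/-! ### Rotation numbers of crossingless diagrams -/

/-- The rotation number, in half turns, of a crossingless diagram whose strands at even positions
are oriented upwards and whose strands at odd positions are oriented downwards. -/
def rotation : Word → ℤ
  | [] => 0
  | cup i :: w => (-1) ^ i + rotation w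
  | cap i :: w => (-1) ^ i + rotation w
  | cross _ _ :: w => rotation w

theorem rotation_append (a b : Word) : rotation (a ++ b) = rotation a + rotation b := by
  induction a with
  | nil => simp [rotation]
  | cons l a ih => cases l <;> simp [rotation, ih, add_assoc]

/-- A removed loop contributes `2` or `-2`, that is `2` modulo `4`, and the other rules preserve the
rotation number. Half of it thus has the parity of the number of loops. -/
theorem FlatRule.rotation {l r : Word} {k : ℕ} (h : FlatRule l k r) :
    (∃ e : ℤ, rotation l = rotation r + 2 * k + 4 * e) ∧ (k = 0 → rotation l = rotation r) := by
  cases h with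
  | zigzag_left i => simp [Knot.rotation, pow_succ]
  | zigzag_right i => simp [Knot.rotation, pow_succ]
  | loop i =>
    simp only [Knot.rotation]
    rcases neg_one_pow_eq_or ℤ i with h | h <;> simp only [h]
    · exact ⟨⟨0, by norm_num⟩, by norm_num⟩
    · exact ⟨⟨-1, by norm_num⟩, by norm_num⟩
  | comm_left i j h =>
    have : Knot.rotation [cup i, cap (j + 2)] = Knot.rotation [cap j, cup i] := by
      simp [Knot.rotation, pow_succ]; ring
    exact ⟨⟨0, by rw [this]; simp⟩, fun _ => this⟩
  | comm_right i j h =>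
    have : Knot.rotation [cup (j + 2), cap i] = Knot.rotation [cap i, cup j] := by
      simp [Knot.rotation, pow_succ]; ring
    exact ⟨⟨0, by rw [this]; simp⟩, fun _ => this⟩

theorem FlatRed.rotation {u v : Word} {k : ℕ} (h : FlatRed u k v) :
    (∃ e : ℤ, rotation u = rotation v + 2 * k + 4 * e) ∧ (k = 0 → rotation u = rotation v) := by
  induction h with
  | refl u => exact ⟨⟨0, by simp⟩, fun _ => rfl⟩
  | head hr _ ih =>
    obtain ⟨⟨e, he⟩, h0⟩ := hr.rotation
    obtain ⟨⟨e', he'⟩, h0'⟩ := ih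
    simp only [rotation_append] at *
    refine ⟨⟨e + e', ?_⟩, fun h => ?_⟩
    · push_cast; linarith
    · have := h0 (by omega)
      have := h0' (by omega)
      linarith

theorem isTangle_caps {m n : ℕ} {u : Word} (hu : ∀ l ∈ u, ∃ i, l = cap i) (h : IsTangle m n u) :
    m = n + 2 * u.length := by
  induction u generalizing m with
  | nil => exact h
  | cons l u ih =>
    obtain ⟨i, rfl⟩ := hu l (by simp)
    have := ih (fun x hx => hu x (by simp [hx])) h.2
    have := h.1
    simp only [List.length_cons]; omega

theorem isTangle_cups {m n : ℕ} {u : Word} (hu : ∀ l ∈ u, ∃ i, l = cup i) (h : IsTangle m n u) :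
    n = m + 2 * u.length := by
  induction u generalizing m with
  | nil => exact h.symm
  | cons l u ih =>
    obtain ⟨i, rfl⟩ := hu l (by simp)
    have := ih (fun x hx => hu x (by simp [hx])) h.2
    simp only [List.length_cons]; omega

theorem exists_flatRed_nil {u : Word} (hu : IsFlat u) (h : IsLinkDiagram u) :
    ∃ k, FlatRed u k [] := by
  obtain ⟨k, caps, cups, h1, h2, h3⟩ := exists_flatRed u hu
  have ht := h1.isTangle h
  obtain ⟨p, hp, hq⟩ := isTangle_append.1 ht
  have e1 := isTangle_caps h2 hp
  have e2 := isTangle_cups h3 hq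
  have e3 : caps = [] := List.length_eq_zero_iff.1 (by omega)
  have e4 : cups = [] := List.length_eq_zero_iff.1 (by omega)
  subst e3 e4
  exact ⟨k, h1⟩

theorem exists_flatRed_cap {u : Word} (hu : IsFlat u) (h : IsTangle 2 0 u) :
    ∃ k, FlatRed u k [cap 0] := by
  obtain ⟨k, caps, cups, h1, h2, h3⟩ := exists_flatRed u hu
  have ht := h1.isTangle h
  obtain ⟨p, hp, hq⟩ := isTangle_append.1 ht
  have e1 := isTangle_caps h2 hp
  have e2 := isTangle_cups h3 hq
  have e4 : cups = [] := List.length_eq_zero_iff.1 (by omega)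
  obtain ⟨c, rfl⟩ : ∃ c, caps = [c] := List.length_eq_one_iff.1 (by omega)
  obtain ⟨i, rfl⟩ := h2 c (by simp)
  have := hp.1
  obtain rfl : i = 0 := by omega
  subst e4
  exact ⟨k, h1⟩

/-- A crossingless tangle diagram with four endpoints is the tangle `0` or `∞`, up to loops. -/
theorem exists_flatRed_zero_or_infty {u : Word} (hu : IsFlat u) (h : IsTangle 2 2 u) :
    ∃ k, FlatRed u k zeroTangle ∨ FlatRed u k inftyTangle := by
  obtain ⟨k, caps, cups, h1, h2, h3⟩ := exists_flatRed u hu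
  have ht := h1.isTangle h
  obtain ⟨p, hp, hq⟩ := isTangle_append.1 ht
  have e1 := isTangle_caps h2 hp
  have e2 := isTangle_cups h3 hq
  rcases Nat.eq_zero_or_pos caps.length with h0 | h0
  · have e3 : caps = [] := List.length_eq_zero_iff.1 h0
    have e4 : cups = [] := List.length_eq_zero_iff.1 (by omega)
    subst e3 e4
    exact ⟨k, Or.inr h1⟩
  · obtain ⟨c, rfl⟩ : ∃ c, caps = [c] := List.length_eq_one_iff.1 (by omega)
    obtain ⟨d, rfl⟩ : ∃ c, cups = [c] := List.length_eq_one_iff.1 (by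
      simp at e1; omega)
    obtain ⟨i, rfl⟩ := h2 c (by simp)
    obtain ⟨j, rfl⟩ := h3 d (by simp)
    have := hp.1
    have := hq.1
    simp at e1
    obtain rfl : i = 0 := by omega
    obtain rfl : j = 0 := by omega
    exact ⟨k, Or.inl h1⟩

theorem colorings_nil : colorings [] = 1 := rfl

/-- The number of loops of a crossingless diagram and its rotation number have the same parity. -/
theorem exists_colorings_rotation {u : Word} (hu : IsFlat u) (h : IsLinkDiagram u) :
    ∃ k : ℕ, colorings u = 2 ^ k ∧ ∃ e : ℤ, rotation u = 2 * k + 4 * e := by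
  obtain ⟨k, hk⟩ := exists_flatRed_nil hu h
  refine ⟨k, by simpa [colorings_nil] using hk.colorings [] [], ?_⟩
  obtain ⟨e, he⟩ := hk.rotation.1
  exact ⟨e, by simpa [rotation] using he⟩

/-- A single loop starting upwards on the left has rotation number one. -/
theorem rotation_eq_two {u : Word} (hu : IsFlat u) (h : IsLinkDiagram u) (hc : colorings u = 2) :
    rotation u = 2 := by
  match u, hu, h, hc with
  | [], _, _, hc => simp [colorings_nil] at hc
  | cap i :: w, _, hw, _ => exact absurd hw.1 (by omega)
  | cross s i :: w, _, hw, _ => exact absurd hw.1 (by omega)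
  | cup i :: w, hu, hw, hc =>
    obtain ⟨hi, hw⟩ := hw
    obtain rfl : i = 0 := by omega
    obtain ⟨k, hk⟩ := exists_flatRed_cap (fun l hl => hu l (by simp [hl])) hw
    have h1 := hk.colorings [cup 0] []
    have h2 := colorings_loop [] [] 0
    simp only [List.append_nil, List.nil_append, List.cons_append, colorings_nil] at h1 h2
    rw [hc, h2] at h1
    -- A further removed loop would give at least four colourings.
    have hk0 : k = 0 := by
      rcases k with _ | k
      · rfl
      · rw [pow_succ] at h1
        have : 0 < 2 ^ k := by positivity
        omega
    have h3 := hk.rotation.2 hk0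
    simp [rotation, h3]

/-- Of the two smoothings of a crossing in a Kauffman state, one doubles the number of colourings
that take equal values on all four edges, and the other one preserves it. -/
theorem colorings_flat_smoothings {a b : Word} {s : Bool} {i : ℕ} (ha : IsFlat a) (hb : IsFlat b)
    (h : IsLinkDiagram (a ++ cross s i :: b)) :
    (colorings (a ++ b) = colorings (a ++ cross s i :: b) ∧
      colorings (a ++ cap i :: cup i :: b) = 2 * colorings (a ++ cross s i :: b)) ∨
    (colorings (a ++ b) = 2 * colorings (a ++ cross s i :: b) ∧
      colorings (a ++ cap i :: cup i :: b) = colorings (a ++ cross s i :: b)) := by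
  have hab : IsLinkDiagram (a ++ b) := by
    obtain ⟨p, h1, h2⟩ := isTangle_append.1 h
    exact h1.append h2.2
  have hab' : IsLinkDiagram (a ++ cap i :: cup i :: b) := by
    obtain ⟨p, h1, h2⟩ := isTangle_append.1 h
    refine h1.append ⟨h2.1, ?_, ?_⟩
    · have := h2.1; omega
    · have := h2.1
      rw [Nat.sub_add_cancel (by omega)]; exact h2.2
  obtain ⟨k, hk, e, he⟩ := exists_colorings_rotation (ha.append hb) hab
  obtain ⟨k', hk', e', he'⟩ := exists_colorings_rotation (u := a ++ cap i :: cup i :: b)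
    (ha.append (fun l hl => by
      rcases List.mem_cons.1 hl with rfl | hl
      · simp
      rcases List.mem_cons.1 hl with rfl | hl
      · simp
      exact hb l hl)) hab'
  -- The smoothings differ by a maximum and a minimum at the same position, so their rotation
  -- numbers differ by `2` modulo `4` and their loop numbers have opposite parity. This excludes
  -- that both counts are equal.
  have hne : colorings (a ++ b) ≠ colorings (a ++ cap i :: cup i :: b) := by
    rw [hk, hk']
    intro hkk
    have : k = k' := Nat.pow_right_injective le_rfl hkk
    subst this
    simp only [rotation_append, rotation] at he he'
    rcases neg_one_pow_eq_or ℤ i with h | h <;> simp only [h] at he' <;> omega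
  have h1 := colorings_smoothInfty a b s i
  have h2 := colorings_smoothZero a b s i
  omega


/-! ### The Kauffman bracket at a primitive eighth root of unity -/

/-- The value of `A` that computes determinants. -/
noncomputable def rootA : ℂ := Complex.exp (Real.pi / 4 * Complex.I)

theorem rootA_ne_zero : rootA ≠ 0 := Complex.exp_ne_zero _

theorem rootA_sq : rootA ^ 2 = Complex.I := by
  have h : Complex.exp (Real.pi / 2 * Complex.I) = Complex.I := Complex.exp_pi_div_two_mul_I
  rw [rootA, ← Complex.exp_nat_mul]
  refine Eq.trans ?_ h
  congr 1; push_cast; ring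

theorem rootA_inv : rootA⁻¹ = -Complex.I * rootA := by
  refine inv_eq_of_mul_eq_one_right ?_
  linear_combination (-Complex.I) * rootA_sq - Complex.I_sq

theorem norm_rootA : ‖rootA‖ = 1 := by
  rw [rootA, show (Real.pi / 4 * Complex.I : ℂ) = ((Real.pi / 4 : ℝ) : ℂ) * Complex.I by
    push_cast; ring]
  exact Complex.norm_exp_ofReal_mul_I _

theorem norm_rootA_zpow (k : ℤ) : ‖rootA ^ k‖ = 1 := by
  rw [norm_zpow, norm_rootA, one_zpow]

/-- Sums over Kauffman states. -/
noncomputable def stateSum (w : Word) (f : ℤ × Word → ℂ) : ℂ := ((states w).map f).sum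

theorem stateSum_nil (f : ℤ × Word → ℂ) : stateSum [] f = f (0, []) := by simp [stateSum, states]

theorem stateSum_cup (i : ℕ) (w : Word) (f : ℤ × Word → ℂ) :
    stateSum (cup i :: w) f = stateSum w fun p => f (p.1, cup i :: p.2) := by
  simp [stateSum, states, Function.comp_def]

theorem stateSum_cap (i : ℕ) (w : Word) (f : ℤ × Word → ℂ) :
    stateSum (cap i :: w) f = stateSum w fun p => f (p.1, cap i :: p.2) := by
  simp [stateSum, states, Function.comp_def]

/-- The exponent of the smoothing `∞`. -/
def sgn (s : Bool) : ℤ := if s then 1 else -1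

theorem stateSum_cross (s : Bool) (i : ℕ) (w : Word) (f : ℤ × Word → ℂ) :
    stateSum (cross s i :: w) f = stateSum w (fun p => f (p.1 + sgn s, p.2)) +
      stateSum w (fun p => f (p.1 - sgn s, cap i :: cup i :: p.2)) := by
  simp [stateSum, states, Function.comp_def, sgn]

theorem stateSum_add (w : Word) (f g : ℤ × Word → ℂ) :
    stateSum w (fun p => f p + g p) = stateSum w f + stateSum w g := by
  simp [stateSum, List.sum_map_add]

theorem stateSum_mul_left (w : Word) (c : ℂ) (f : ℤ × Word → ℂ) :
    stateSum w (fun p => c * f p) = c * stateSum w f := by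
  simp [stateSum, List.sum_map_mul_left]

theorem stateSum_congr {w : Word} {f g : ℤ × Word → ℂ} (h : ∀ p ∈ states w, f p = g p) :
    stateSum w f = stateSum w g := by
  rw [stateSum, stateSum, List.map_congr_left h]

theorem stateSum_append (a b : Word) (f : ℤ × Word → ℂ) :
    stateSum (a ++ b) f =
      stateSum a fun p => stateSum b fun q => f (p.1 + q.1, p.2 ++ q.2) := by
  induction a generalizing f with
  | nil => simp [stateSum_nil]
  | cons l a ih =>
    cases l with
    | cup i => simp [stateSum_cup, ih]
    | cap i => simp [stateSum_cap, ih]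
    | cross s i => simp [stateSum_cross, ih, add_right_comm, sub_eq_add_neg]

theorem stateSum_comm (a b : Word) (f : ℤ × Word → ℤ × Word → ℂ) :
    (stateSum a fun p => stateSum b fun q => f p q) =
      stateSum b fun q => stateSum a fun p => f p q := by
  induction a generalizing f with
  | nil => simp [stateSum_nil]
  | cons l a ih =>
    cases l with
    | cup i => simp only [stateSum_cup]; exact ih _
    | cap i => simp only [stateSum_cap]; exact ih _
    | cross s i => simp only [stateSum_cross, stateSum_add]; rw [ih, ih]

theorem stateSum_flat {u : Word} (hu : IsFlat u) (f : ℤ × Word → ℂ) :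
    stateSum u f = f (0, u) := by
  induction u generalizing f with
  | nil => exact stateSum_nil f
  | cons l u ih =>
    have hu' : IsFlat u := fun x hx => hu x (by simp [hx])
    cases l with
    | cup i => rw [stateSum_cup, ih hu']
    | cap i => rw [stateSum_cap, ih hu']
    | cross s i => exact absurd rfl (hu (cross s i) (by simp) s i)

theorem isFlat_of_mem_states {w : Word} {p : ℤ × Word} (hp : p ∈ states w) : IsFlat p.2 := by
  induction w generalizing p with
  | nil => simp [states] at hp; simp [hp, IsFlat]
  | cons l w ih =>
    cases l with
    | cup i =>
      obtain ⟨q, hq, rfl⟩ := List.mem_map.1 hp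
      intro x hx s j
      rcases List.mem_cons.1 hx with rfl | hx
      · simp
      · exact ih hq x hx s j
    | cap i =>
      obtain ⟨q, hq, rfl⟩ := List.mem_map.1 hp
      intro x hx s j
      rcases List.mem_cons.1 hx with rfl | hx
      · simp
      · exact ih hq x hx s j
    | cross c i =>
      rcases List.mem_append.1 hp with hp | hp
      · obtain ⟨q, hq, rfl⟩ := List.mem_map.1 hp
        have := ih hq
        exact this
      · obtain ⟨q, hq, rfl⟩ := List.mem_map.1 hp
        intro x hx s j
        rcases List.mem_cons.1 hx with rfl | hx
        · simp
        rcases List.mem_cons.1 hx with rfl | hx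
        · simp
        · exact ih hq x hx s j

theorem IsTangle.of_mem_states {m n : ℕ} {w : Word} {p : ℤ × Word} (hw : IsTangle m n w)
    (hp : p ∈ states w) : IsTangle m n p.2 := by
  induction w generalizing p m with
  | nil => simp [states] at hp; simpa [hp] using hw
  | cons l w ih =>
    cases l with
    | cup i =>
      obtain ⟨q, hq, rfl⟩ := List.mem_map.1 hp
      exact ⟨hw.1, ih hw.2 hq⟩
    | cap i =>
      obtain ⟨q, hq, rfl⟩ := List.mem_map.1 hp
      exact ⟨hw.1, ih hw.2 hq⟩
    | cross c i =>
      rcases List.mem_append.1 hp with hp | hp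
      · obtain ⟨q, hq, rfl⟩ := List.mem_map.1 hp
        have := ih hw.2 hq
        exact this
      · obtain ⟨q, hq, rfl⟩ := List.mem_map.1 hp
        have := hw.1
        refine ⟨hw.1, by omega, ?_⟩
        rw [Nat.sub_add_cancel (by omega)]
        exact ih hw.2 hq

/-- The indicator of crossingless diagrams with one loop. -/
noncomputable def weight (u : Word) : ℂ := if colorings u ≤ 2 then 1 else 0

/-- The Kauffman bracket at `A = rootA`. -/
noncomputable def kb (w : Word) : ℂ := stateSum w fun p => rootA ^ p.1 * weight p.2

/-- The value of a loop vanishes at `rootA`, so a state with at least two loops contributes nothing.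
The truncated exponent `floating - 1` is `0` for zero and for one loop, in agreement with `weight`.
-/
theorem determinant_eq {D : Word} (hD : IsLinkDiagram D) : determinant D = ‖kb D‖ := by
  have hδ : -rootA ^ (2 : ℤ) - rootA ^ (-2 : ℤ) = 0 := by
    have h1 : rootA ^ (2 : ℤ) = Complex.I := by exact_mod_cast rootA_sq
    rw [zpow_neg, h1, Complex.inv_I]; ring
  rw [determinant, bracket, kb, stateSum]
  congr 2
  refine List.map_congr_left fun p hp => ?_
  change rootA ^ p.1 * (-rootA ^ (2 : ℤ) - rootA ^ (-2 : ℤ)) ^ (floating 0 p.2 - 1) = _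
  rw [hδ, weight]
  congr 1
  have := floating_le_one_iff (hD.of_mem_states hp)
  by_cases h : floating 0 p.2 ≤ 1
  · rw [if_pos (this.1 h), show floating 0 p.2 - 1 = 0 by omega, pow_zero]
  · rw [if_neg fun h' => h (this.2 h'), zero_pow (by omega)]

theorem weight_of_trEq {l r : Word} (h : TrEq l r) (a b : Word) :
    weight (a ++ l ++ b) = weight (a ++ r ++ b) := by
  rw [weight, weight, (h.congr a b).colorings]

/-- The surroundings must be non-empty: a loop added to the empty diagram is the unknot, of weight
one. -/
theorem weight_loop {a b : Word} (h : IsLinkDiagram (a ++ b)) (hne : a ++ b ≠ []) (i : ℕ) :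
    weight (a ++ [cup i, cap i] ++ b) = 0 := by
  have := two_le_colorings h hne
  rw [weight, colorings_loop, if_neg (by omega)]

theorem kb_append (a l b : Word) :
    kb (a ++ l ++ b) = stateSum a fun p => stateSum b fun q => rootA ^ (p.1 + q.1) *
      stateSum l fun t => rootA ^ t.1 * weight (p.2 ++ t.2 ++ q.2) := by
  simp only [kb, stateSum_append, ← stateSum_mul_left]
  refine stateSum_congr fun p _ => ?_
  rw [stateSum_comm]
  refine stateSum_congr fun q _ => stateSum_congr fun t _ => ?_
  rw [← mul_assoc, ← zpow_add₀ rootA_ne_zero]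
  congr 2; ring

/-- A local rule that holds in crossingless surroundings holds everywhere. -/
theorem kb_of_local {l r : Word} {c : ℂ}
    (h : ∀ u v, IsFlat u → IsFlat v → IsLinkDiagram (u ++ l ++ v) →
      (stateSum l fun t => rootA ^ t.1 * weight (u ++ t.2 ++ v)) =
        c * stateSum r fun t => rootA ^ t.1 * weight (u ++ t.2 ++ v))
    {a b : Word} (hl : IsLinkDiagram (a ++ l ++ b)) :
    kb (a ++ l ++ b) = c * kb (a ++ r ++ b) := by
  rw [kb_append, kb_append, ← stateSum_mul_left]
  refine stateSum_congr fun p hp => ?_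
  rw [← stateSum_mul_left]
  refine stateSum_congr fun q hq => ?_
  have : IsLinkDiagram (p.2 ++ l ++ q.2) := by
    obtain ⟨m, h1, h2⟩ := isTangle_append.1 hl
    obtain ⟨n, h3, h4⟩ := isTangle_append.1 h1
    exact ((h3.of_mem_states hp).append h4).append (h2.of_mem_states hq)
  rw [h _ _ (isFlat_of_mem_states hp) (isFlat_of_mem_states hq) this]
  ring

theorem isFlat_nil : IsFlat [] := by simp [IsFlat]

/-- The skein relation. -/
theorem kb_skein (a b : Word) (s : Bool) (i : ℕ) :
    kb (a ++ cross s i :: b) = rootA ^ sgn s * kb (a ++ b) +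
      rootA ^ (-sgn s) * kb (a ++ cap i :: cup i :: b) := by
  simp only [kb, stateSum_append, stateSum_cross, stateSum_cap, stateSum_cup, stateSum_add,
    ← stateSum_mul_left]
  congr 1
  · refine stateSum_congr fun p _ => stateSum_congr fun q _ => ?_
    rw [← mul_assoc, ← zpow_add₀ rootA_ne_zero]
    congr 2; ring
  · refine stateSum_congr fun p _ => stateSum_congr fun q _ => ?_
    rw [← mul_assoc, ← zpow_add₀ rootA_ne_zero]
    congr 2; ring

/-! ### Invariance -/

theorem TrEq.trans {u v w : Word} (h : TrEq u v) (h' : TrEq v w) : TrEq u w :=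
  fun φ => (h φ).trans (h' φ)

theorem TrEq.symm {u v : Word} (h : TrEq u v) : TrEq v u := fun φ => (h φ).symm

theorem trEq_comm_e_cup {i j : ℕ} (h : i ≤ j) :
    TrEq [cap i, cup i, cup (j + 2)] [cup (j + 2), cap i, cup i] :=
  (by simpa using (trEq_comm_cup_cup h).congr [cap i] [] :
    TrEq [cap i, cup i, cup (j + 2)] [cap i, cup j, cup i]).trans
    (by simpa using (trEq_comm_cap_cup h).symm.congr [] [cup i])

theorem trEq_comm_e_cap {i j : ℕ} (h : i ≤ j) :
    TrEq [cap i, cup i, cap (j + 2)] [cap (j + 2), cap i, cup i] :=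
  (by simpa using (trEq_comm_cup_cap h).congr [cap i] [] :
    TrEq [cap i, cup i, cap (j + 2)] [cap i, cap j, cup i]).trans
    (by simpa using (trEq_comm_cap_cap h).congr [] [cup i])

theorem trEq_comm_cup_e {i j : ℕ} (h : i ≤ j) :
    TrEq [cup i, cap (j + 2), cup (j + 2)] [cap j, cup j, cup i] :=
  (by simpa using (trEq_comm_cup_cap h).congr [] [cup (j + 2)] :
    TrEq [cup i, cap (j + 2), cup (j + 2)] [cap j, cup i, cup (j + 2)]).trans
    (by simpa using (trEq_comm_cup_cup h).congr [cap j] [])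

theorem trEq_comm_cap_e {i j : ℕ} (h : i ≤ j) :
    TrEq [cap i, cap j, cup j] [cap (j + 2), cup (j + 2), cap i] :=
  (by simpa using (trEq_comm_cap_cap h).congr [] [cup j] :
    TrEq [cap i, cap j, cup j] [cap (j + 2), cap i, cup j]).trans
    (by simpa using (trEq_comm_cap_cup h).symm.congr [cap (j + 2)] [])

theorem trEq_comm_e_e {i j : ℕ} (h : i ≤ j) :
    TrEq [cap i, cup i, cap (j + 2), cup (j + 2)] [cap (j + 2), cup (j + 2), cap i, cup i] :=
  (by simpa using (trEq_comm_cup_e h).congr [cap i] [] :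
    TrEq [cap i, cup i, cap (j + 2), cup (j + 2)] [cap i, cap j, cup j, cup i]).trans
    (by simpa using (trEq_comm_cap_e h).congr [] [cup i])

-- After smoothing, both sides of a move are matched state by state with equal exponents, so only
-- colouring counts of crossingless words are compared. Rotating a crossing exchanges its smoothings
-- `0` and `∞`, which is why the sign changes in the slide moves.
set_option linter.unusedSimpArgs false in
theorem kb_planarMove {l r : Word} (h : PlanarMove l r) {a b : Word}
    (hl : IsLinkDiagram (a ++ l ++ b)) : kb (a ++ l ++ b) = kb (a ++ r ++ b) := by
  rw [kb_of_local (c := 1) (r := r) _ hl, one_mul]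
  intro u v _ _ _
  have W := fun {l r : Word} (h : TrEq l r) => weight_of_trEq h u v
  cases h with
  | comm x y h =>
    cases x with
    | cup i =>
      cases y with
      | cup j =>
        replace h : i ≤ j := h
        have := W (trEq_comm_cup_cup h)
        simpa [Layer.shift, arityIn, arityOut, stateSum_cup, stateSum_cap, stateSum_nil] using this
      | cap j =>
        replace h : i ≤ j := h
        have := W (trEq_comm_cup_cap h)
        simpa [Layer.shift, arityIn, arityOut, stateSum_cup, stateSum_cap, stateSum_nil] using this
      | cross s j =>
        replace h : i ≤ j := h
        have := W (trEq_comm_cup_e h)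
        simp at this
        simp [Layer.shift, arityIn, arityOut, stateSum_cup, stateSum_cap, stateSum_nil,
          stateSum_cross, this]
    | cap i =>
      cases y with
      | cup j =>
        replace h : i ≤ j := h
        have := W (trEq_comm_cap_cup h)
        simpa [Layer.shift, arityIn, arityOut, stateSum_cup, stateSum_cap, stateSum_nil]
          using this.symm
      | cap j =>
        replace h : i ≤ j := h
        have := W (trEq_comm_cap_cap h)
        simpa [Layer.shift, arityIn, arityOut, stateSum_cup, stateSum_cap, stateSum_nil] using this
      | cross s j =>
        replace h : i ≤ j := h
        have := W (trEq_comm_cap_e h)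
        simp at this
        simp [Layer.shift, arityIn, arityOut, stateSum_cup, stateSum_cap, stateSum_nil,
          stateSum_cross, this]
    | cross c i =>
      cases y with
      | cup j =>
        replace h : i ≤ j := h
        have := W (trEq_comm_e_cup h)
        simp at this
        simp [Layer.shift, arityIn, arityOut, stateSum_cup, stateSum_cap, stateSum_nil,
          stateSum_cross, this]
      | cap j =>
        replace h : i ≤ j := h
        have := W (trEq_comm_e_cap h)
        simp at this
        simp [Layer.shift, arityIn, arityOut, stateSum_cup, stateSum_cap, stateSum_nil,
          stateSum_cross, this]
      | cross s j =>
        replace h : i ≤ j := h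
        have := W (trEq_comm_e_e h)
        simp at this
        simp [Layer.shift, arityIn, arityOut, stateSum_cup, stateSum_cap, stateSum_nil,
          stateSum_cross, this]
        rw [show -sgn c + sgn s = sgn s - sgn c by ring,
          show -sgn s + sgn c = sgn c - sgn s by ring, add_comm (sgn s) (sgn c),
          show -sgn s - sgn c = -sgn c - sgn s by ring]
        ring
  | zigzag_left i =>
    have := W (trEq_zigzag_left i)
    simpa [stateSum_cup, stateSum_cap, stateSum_nil] using this
  | zigzag_right i =>
    have := W (trEq_zigzag_right i)
    simpa [stateSum_cup, stateSum_cap, stateSum_nil] using this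
  | slide_cup s i =>
    have h1 := W (by simpa using (trEq_zigzag_left i).congr [] [cup (i + 1)] :
      TrEq [cup i, cap (i + 1), cup (i + 1)] [cup (i + 1)])
    have h2 := W (by simpa using (trEq_zigzag_right i).congr [] [cup i] :
      TrEq [cup (i + 1), cap i, cup i] [cup i])
    simp at h1 h2
    cases s <;> simp [stateSum_cup, stateSum_cap, stateSum_nil, stateSum_cross, h1, h2, sgn,
      add_comm]
  | slide_cap s i =>
    have h1 := W (by simpa using (trEq_zigzag_right i).congr [cap (i + 1)] [] :
      TrEq [cap (i + 1), cup (i + 1), cap i] [cap (i + 1)])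
    have h2 := W (by simpa using (trEq_zigzag_left i).congr [cap i] [] :
      TrEq [cap i, cup i, cap (i + 1)] [cap i])
    simp at h1 h2
    cases s <;> simp [stateSum_cup, stateSum_cap, stateSum_nil, stateSum_cross, h1, h2, sgn,
      add_comm]

-- States with an additional loop vanish. The first move then leaves a single state and costs a
-- factor `A` or `A⁻¹`; the second and third moves follow from `A² + A⁻² = 0`.
set_option linter.unusedSimpArgs false in
theorem kb_reidemeisterMove {l r : Word} (h : ReidemeisterMove l r) {a b : Word}
    (hl : IsLinkDiagram (a ++ l ++ b)) : ‖kb (a ++ l ++ b)‖ = ‖kb (a ++ r ++ b)‖ := by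
  suffices h' : ∃ k : ℤ, ∀ u v, IsFlat u → IsFlat v → IsLinkDiagram (u ++ l ++ v) →
      (stateSum l fun t => rootA ^ t.1 * weight (u ++ t.2 ++ v)) =
        rootA ^ k * stateSum r fun t => rootA ^ t.1 * weight (u ++ t.2 ++ v) by
    obtain ⟨k, hk⟩ := h'
    rw [kb_of_local hk hl, norm_mul, norm_rootA_zpow, one_mul]
  have e2 : rootA ^ 2 + rootA⁻¹ ^ 2 = 0 := by
    rw [inv_pow, rootA_sq, Complex.inv_I, add_neg_cancel]
  have e3 : rootA * rootA⁻¹ = 1 := mul_inv_cancel₀ rootA_ne_zero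
  have e4 : rootA + rootA⁻¹ ^ 3 = 0 := by linear_combination rootA⁻¹ * e2 - rootA * e3
  have e5 : rootA⁻¹ + rootA ^ 3 = 0 := by linear_combination rootA * e2 - rootA⁻¹ * e3
  cases h with
  | one_cup s i =>
    refine ⟨sgn s, fun u v _ _ huv => ?_⟩
    have hne : u ++ ([cup i] ++ v) ≠ [] := by simp
    have hld : IsLinkDiagram (u ++ ([cup i] ++ v)) := by
      simp only [List.append_assoc] at huv
      obtain ⟨p, h1, h2⟩ := isTangle_append.1 huv
      exact h1.append ⟨h2.1, h2.2.2⟩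
    have := weight_loop hld hne i
    simp at this
    simp [stateSum_cup, stateSum_cap, stateSum_nil, stateSum_cross, this]
  | one_cap s i =>
    refine ⟨sgn s, fun u v _ _ huv => ?_⟩
    have hne : (u ++ [cap i]) ++ v ≠ [] := by simp
    have hld : IsLinkDiagram ((u ++ [cap i]) ++ v) := by
      simp only [List.append_assoc] at huv ⊢
      obtain ⟨p, h1, h2⟩ := isTangle_append.1 huv
      exact h1.append ⟨h2.1, h2.2.2⟩
    have := weight_loop hld hne i
    simp at this
    simp [stateSum_cup, stateSum_cap, stateSum_nil, stateSum_cross, this]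
  | two s i =>
    refine ⟨0, fun u v _ _ huv => ?_⟩
    have hne : (u ++ [cap i]) ++ ([cup i] ++ v) ≠ [] := by simp
    have hld : IsLinkDiagram ((u ++ [cap i]) ++ ([cup i] ++ v)) := by
      simp only [List.append_assoc] at huv ⊢
      obtain ⟨p, h1, h2⟩ := isTangle_append.1 huv
      refine h1.append ⟨h2.1, ?_, ?_⟩
      · have := h2.1; omega
      · have := h2.1
        rw [Nat.sub_add_cancel (by omega)]; exact h2.2.2
    have := weight_loop hld hne i
    simp at this
    cases s <;>
    · simp [stateSum_cup, stateSum_cap, stateSum_nil, stateSum_cross, this, sgn]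
      linear_combination (weight (u ++ cap i :: cup i :: v)) * e2
  | three s i =>
    refine ⟨0, fun u v _ _ huv => ?_⟩
    have h1 : weight (u ++ [cap i, cup i, cap (i + 1), cup (i + 1), cap i, cup i] ++ v) =
        weight (u ++ [cap i, cup i] ++ v) := weight_of_trEq
      ((by simpa using (trEq_zigzag_left i).congr [cap i] [cup (i + 1), cap i, cup i] :
          TrEq [cap i, cup i, cap (i + 1), cup (i + 1), cap i, cup i]
            [cap i, cup (i + 1), cap i, cup i]).trans
        (by simpa using (trEq_zigzag_right i).congr [cap i] [cup i])) u v
    have h2 : weight (u ++ [cap (i + 1), cup (i + 1), cap i, cup i, cap (i + 1), cup (i + 1)] ++ v) =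
        weight (u ++ [cap (i + 1), cup (i + 1)] ++ v) := weight_of_trEq
      ((by simpa using
          (trEq_zigzag_right i).congr [cap (i + 1)] [cup i, cap (i + 1), cup (i + 1)] :
          TrEq [cap (i + 1), cup (i + 1), cap i, cup i, cap (i + 1), cup (i + 1)]
            [cap (i + 1), cup i, cap (i + 1), cup (i + 1)]).trans
        (by simpa using (trEq_zigzag_left i).congr [cap (i + 1)] [cup (i + 1)])) u v
    have h3 : ∀ j, i ≤ j → j ≤ i + 1 →
        weight (u ++ [cap j, cup j, cap j, cup j] ++ v) = 0 := by
      intro j hj hj'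
      have hne : (u ++ [cap j]) ++ ([cup j] ++ v) ≠ [] := by simp
      have hld : IsLinkDiagram ((u ++ [cap j]) ++ ([cup j] ++ v)) := by
        simp only [List.append_assoc] at huv ⊢
        obtain ⟨p, h1, h2⟩ := isTangle_append.1 huv
        have h4 := h2.2.1
        have h5 := h2.2.2.2
        refine h1.append ⟨by omega, by omega, ?_⟩
        rw [Nat.sub_add_cancel (by omega)]; exact h5
      have := weight_loop hld hne j
      simpa using this
    have h4 := h3 i le_rfl (by omega)
    have h5 := h3 (i + 1) (by omega) le_rfl
    simp at h1 h2 h4 h5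
    cases s <;> simp [stateSum_cup, stateSum_cap, stateSum_nil, stateSum_cross, sgn, h1, h2, h4, h5]
    · linear_combination (weight (u ++ cap i :: cup i :: v) -
        weight (u ++ cap (i + 1) :: cup (i + 1) :: v)) * e5
    · linear_combination (weight (u ++ cap i :: cup i :: v) -
        weight (u ++ cap (i + 1) :: cup (i + 1) :: v)) * e4

/-- The determinant is an isotopy invariant. -/
theorem Isotopic.determinant_eq {D D' : Word} (h : Isotopic 0 0 D D') :
    determinant D = determinant D' := by
  induction h with
  | rel D D' h =>
    obtain ⟨hD, hD', a, b, l, r, hlr, rfl, rfl⟩ := h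
    rw [Knot.determinant_eq hD, Knot.determinant_eq hD']
    rcases hlr with h | h
    · rw [kb_planarMove h hD]
    · exact kb_reidemeisterMove h hD
  | refl D => rfl
  | symm _ _ _ ih => exact ih.symm
  | trans _ _ _ _ _ ih ih' => exact ih.trans ih'

theorem determinant_unknot : determinant unknot = 1 := by
  have h : IsLinkDiagram unknot := by simp [unknot, IsTangle]
  have h2 : colorings unknot = 2 := by
    simpa [colorings_nil, unknot] using colorings_loop [] [] 0
  have hf : IsFlat unknot := by simp [IsFlat, unknot]
  rw [determinant_eq h, kb, stateSum_flat hf]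
  simp [weight, h2]

/-- The unknot has determinant one, and determinants add along the recursion. For an almost
alternating diagram this will say that the determinants of the two smoothings at the dealternator
differ. -/
theorem IsQuasiAlternating.determinant_pos {D : Word} (h : IsQuasiAlternating D) :
    0 < determinant D := by
  induction h with
  | unknot => simp [determinant_unknot]
  | isotopic h _ ih => rwa [← h.determinant_eq]
  | crossing M _ _ _ hdet ih0 ih1 => rw [hdet]; exact add_pos ih0 ih1


/-! ### Alternating diagrams -/

/-- The number of Kauffman states with a single loop. -/
def treeCount (w : Word) : ℕ :=
  ((states w).map fun p => if colorings p.2 ≤ 2 then 1 else 0).sum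

theorem treeCount_eq_stateSum (w : Word) : (treeCount w : ℂ) = stateSum w fun p => weight p.2 := by
  rw [treeCount, stateSum]
  induction states w with
  | nil => simp
  | cons p l ih => simp [ih, weight]

theorem treeCount_skein (a b : Word) (s : Bool) (i : ℕ) :
    treeCount (a ++ cross s i :: b) = treeCount (a ++ b) + treeCount (a ++ cap i :: cup i :: b) := by
  have : (treeCount (a ++ cross s i :: b) : ℂ) =
      (treeCount (a ++ b) + treeCount (a ++ cap i :: cup i :: b) : ℕ) := by
    push_cast
    simp only [treeCount_eq_stateSum, stateSum_append, stateSum_cross, stateSum_cap, stateSum_cup,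
      stateSum_add]
  exact_mod_cast this

/-! ### Comparison of the alternating orientation with parity -/

/-- The parity of a position. -/
def par (j : ℕ) : Bool := decide (j % 2 = 1)

theorem par_succ (j : ℕ) : par (j + 1) = !(par j) := by
  simp only [par]
  grind

theorem par_add_two (j : ℕ) : par (j + 2) = par j := by
  simp only [par]
  grind

/-- Colourings with prescribed colours at the crossings. -/
def patternCount : Word → List Bool → (ℕ → Bool) → ℕ
  | [], _, _ => 1
  | cup i :: w, p, x => patternCount w p (ins i false x) + patternCount w p (ins i true x)
  | cap i :: w, p, x => if x i = x (i + 1) then patternCount w p (del i x) else 0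
  | cross _ _ :: _, [], _ => 0
  | cross _ i :: w, v :: p, x => if x i = x (i + 1) ∧ x i = v then patternCount w p x else 0

/-- A colouring determines its pattern of colours at the crossings, so distinct patterns count
disjoint sets of colourings. The length condition matters because `patternCount` ignores surplus
entries of a pattern. -/
theorem sum_patternCount_le (w : Word) (S : Finset (List Bool)) (x : ℕ → Bool)
    (hS : ∀ p ∈ S, p.length = crossings w) :
    ∑ p ∈ S, patternCount w p x ≤ tr w (fun _ => 1) x := by
  induction w generalizing S x with
  | nil =>
    have : S.card ≤ 1 := Finset.card_le_one.2 fun p hp q hq => by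
      rw [List.length_eq_zero_iff.1 (hS p hp), List.length_eq_zero_iff.1 (hS q hq)]
    simpa [patternCount, tr] using this
  | cons l w ih =>
    cases l with
    | cup i =>
      simp only [patternCount, tr, Finset.sum_add_distrib]
      exact add_le_add (ih S _ hS) (ih S _ hS)
    | cap i =>
      simp only [patternCount, tr]
      split
      · exact ih S _ hS
      · simp
    | cross s i =>
      simp only [tr]
      have hinj : Set.InjOn (List.cons (x i)) (List.cons (x i) ⁻¹' ↑S) :=
        List.cons_injective.injOn
      rw [← Finset.sum_preimage (List.cons (x i)) S hinj]
      · by_cases hx : x i = x (i + 1)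
        · simp only [patternCount, hx, and_self, if_true]
          refine ih _ _ fun p hp => ?_
          have := hS _ (Finset.mem_preimage.1 hp)
          simpa [crossings] using this
        · simp [patternCount, hx]
      · intro p hp hpr
        cases p with
        | nil => rfl
        | cons v p =>
          simp only [patternCount]
          rw [if_neg]
          rintro ⟨-, rfl⟩
          exact hpr ⟨p, rfl⟩

theorem patternCount_congr {m n : ℕ} {w : Word} (hw : IsTangle m n w) (p : List Bool)
    {x y : ℕ → Bool} (hxy : ∀ j < m, x j = y j) : patternCount w p x = patternCount w p y := by
  induction w generalizing m p x y with
  | nil => rfl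
  | cons l w ih =>
    cases l with
    | cup i =>
      obtain ⟨hi, hw⟩ := hw
      have : ∀ b, patternCount w p (ins i b x) = patternCount w p (ins i b y) := by
        intro b
        refine ih hw _ fun j hj => ?_
        simp only [ins]
        grind
      simp only [patternCount, this]
    | cap i =>
      obtain ⟨hi, hw⟩ := hw
      have : patternCount w p (del i x) = patternCount w p (del i y) := by
        refine ih hw _ fun j hj => ?_
        simp only [del]
        grind
      simp only [patternCount, this, hxy i (by omega), hxy (i + 1) (by omega)]
    | cross s i =>
      obtain ⟨hi, hw⟩ := hw
      cases p with
      | nil => rfl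
      | cons v p =>
        simp only [patternCount, ih hw p hxy, hxy i (by omega), hxy (i + 1) (by omega)]

theorem one_le_patternCount_const (w : Word) (b : Bool) :
    1 ≤ patternCount w (List.replicate (crossings w) b) (fun _ => b) := by
  have h1 : ∀ i, ins i b (fun _ => b) = fun _ => b := by
    intro i; funext j; simp only [ins]; grind
  have h2 : ∀ i, del i (fun _ => b) = fun _ => b := by
    intro i; funext j; simp only [del]; grind
  induction w with
  | nil => exact le_rfl
  | cons l w ih =>
    cases l with
    | cup i =>
      cases b
      · simp only [patternCount, crossings, h1]; omega
      · simp only [patternCount, crossings, h1]; omega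
    | cap i => simpa [patternCount, crossings, h2] using ih
    | cross s i => simpa [patternCount, crossings, List.replicate_succ] using ih

/-- The colours at the crossings of the colouring that compares an alternating orientation with
the orientation given by the parity of the position. -/
def altPattern : Word → List Bool
  | [] => []
  | cross s i :: w => xor (!s) (par i) :: altPattern w
  | _ :: w => altPattern w

theorem length_altPattern (w : Word) : (altPattern w).length = crossings w := by
  induction w with
  | nil => rfl
  | cons l w ih => cases l <;> simp [altPattern, crossings, ih]

/-- The two strands at an extremum, and the two strands at a crossing, carry opposite orientations
and have positions of opposite parity. The sum of orientation and parity is therefore a colouring.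
-/
theorem one_le_patternCount_alt {n : ℕ} (w : Word) (x y : List Bool)
    (hw : IsTangle x.length n w) (h : AltRun w x y) :
    1 ≤ patternCount w (altPattern w) (fun j => xor (ofList x j) (par j)) := by
  induction w generalizing x with
  | nil => exact le_rfl
  | cons l w ih =>
    cases l with
    | cup i =>
      obtain ⟨hi, hw⟩ := hw
      obtain ⟨b, hb⟩ := h
      have := ih _ (by
        rwa [show (x.take i ++ [b, !b] ++ x.drop i).length = x.length + 2 by
          simp; omega]) hb
      have e : (fun j => xor (ofList (x.take i ++ [b, !b] ++ x.drop i) j) (par j)) =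
          ins i (xor b (par i)) fun j => xor (ofList x j) (par j) := by
        funext j
        rw [ofList_insert _ _ _ _ hi]
        simp only [ins]
        rcases lt_trichotomy j i with h | rfl | h
        · simp [h]
        · simp
        · rcases Nat.eq_or_lt_of_le (Nat.succ_le_of_lt h) with rfl | h'
          · simp [par_succ]
          · obtain ⟨k, rfl⟩ : ∃ k, j = k + 2 := ⟨j - 2, by omega⟩
            simp [show ¬ k + 2 < i by omega, show ¬ k + 2 = i by omega,
              show ¬ k + 1 = i by omega, show ¬ k < i by omega, par_add_two]
      rw [e] at this
      simp only [patternCount, altPattern]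
      cases h : xor b (par i) <;> rw [h] at this <;> omega
    | cap i =>
      obtain ⟨hi, hw⟩ := hw
      obtain ⟨⟨b, h1, h2⟩, h3⟩ := h
      have := ih _ (by simpa [show i ≤ x.length by omega, show i + (x.length - (i + 2)) =
        x.length - 2 by omega] using hw) h3
      have e : (fun j => xor (ofList (x.take i ++ x.drop (i + 2)) j) (par j)) =
          del i fun j => xor (ofList x j) (par j) := by
        rw [ofList_del _ _ (by omega)]
        funext j
        simp only [del, par_add_two]
        split <;> rfl
      rw [e] at this
      simp only [patternCount, altPattern]
      rw [if_pos]
      · exact this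
      · simp [ofList, List.getD_eq_getElem?_getD, h1, h2, par_succ]
    | cross s i =>
      obtain ⟨hi, hw⟩ := hw
      obtain ⟨h1, h2, h3⟩ := h
      have := ih x hw h3
      simp only [patternCount, altPattern]
      rw [if_pos]
      · exact this
      · simp [ofList, List.getD_eq_getElem?_getD, h1, h2, par_succ]

/-- A connected projection has only the constant colourings. A comparison pattern different from
both constant patterns would produce a third colouring. -/
theorem altPattern_of_alternating {w : Word} (hw : IsLinkDiagram w) (h : IsAlternating w)
    (hc : colorings w ≤ 2) : ∃ b, altPattern w = List.replicate (crossings w) b := by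
  by_contra! hne
  have h0 := one_le_patternCount_const w false
  have h1 := one_le_patternCount_const w true
  rw [patternCount_congr hw (y := fun _ => false) _ (by simp)] at h1
  have h2 := one_le_patternCount_alt w [] [] hw h
  rw [patternCount_congr hw (y := fun _ => false) _ (by simp)] at h2
  have hpos : crossings w ≠ 0 := by
    intro h0
    apply hne true
    rw [h0, List.replicate_zero, ← List.length_eq_zero_iff, length_altPattern, h0]
  have hft : List.replicate (crossings w) true ≠ List.replicate (crossings w) false := by
    obtain ⟨n, hn⟩ := Nat.exists_eq_succ_of_ne_zero hpos
    simp [hn, List.replicate_succ]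
  have := sum_patternCount_le w {altPattern w, List.replicate (crossings w) true,
    List.replicate (crossings w) false} (fun _ => false) (by
      simp only [Finset.mem_insert, Finset.mem_singleton]
      rintro p (rfl | rfl | rfl) <;> simp [length_altPattern])
  rw [Finset.sum_insert (by simp [hne]), Finset.sum_insert (by simpa using hft),
    Finset.sum_singleton] at this
  have : 3 ≤ colorings w := by
    rw [colorings]; omega
  omega

/-! ### Exponents of single-loop states and additivity of determinants -/

theorem tr_le_of_mem_states {w : Word} {p : ℤ × Word} (hp : p ∈ states w)
    (φ : (ℕ → Bool) → ℕ) (x : ℕ → Bool) : tr w φ x ≤ tr p.2 φ x := by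
  induction w generalizing p x with
  | nil => simp [states] at hp; simp [hp]
  | cons l w ih =>
    cases l with
    | cup i =>
      obtain ⟨q, hq, rfl⟩ := List.mem_map.1 hp
      exact add_le_add (ih hq _) (ih hq _)
    | cap i =>
      obtain ⟨q, hq, rfl⟩ := List.mem_map.1 hp
      simp only [tr]
      split
      · exact ih hq _
      · exact le_rfl
    | cross c i =>
      rcases List.mem_append.1 hp with hp | hp
      · obtain ⟨q, hq, rfl⟩ := List.mem_map.1 hp
        simp only [tr]
        split
        · exact ih hq _
        · exact Nat.zero_le _
      · obtain ⟨q, hq, rfl⟩ := List.mem_map.1 hp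
        simp only [tr]
        split
        · rename_i hx
          have h := ih hq x
          have e := ins_del i x hx
          cases h' : x i <;> rw [h'] at e <;> rw [e] <;> omega
        · exact le_rfl

/-- Replacing the smoothing `∞` by `0` lowers the exponent by `2 sgn s` and raises the rotation
number by `2 (-1)^i`; the hypothesis makes the two changes cancel in `p.1 + κ * rotation p.2`. -/
theorem rotation_of_mem_states {w : Word} {κ : ℤ}
    (h : ∀ s i, cross s i ∈ w → sgn s = κ * (-1) ^ i) :
    ∃ K : ℤ, ∀ p ∈ states w, p.1 + κ * rotation p.2 = K := by
  induction w with
  | nil => exact ⟨0, by simp [states, rotation]⟩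
  | cons l w ih =>
    obtain ⟨K, hK⟩ := ih fun s i hs => h s i (by simp [hs])
    cases l with
    | cup i =>
      refine ⟨K + κ * (-1) ^ i, fun p hp => ?_⟩
      obtain ⟨q, hq, rfl⟩ := List.mem_map.1 hp
      simp only [rotation, ← hK q hq]; ring
    | cap i =>
      refine ⟨K + κ * (-1) ^ i, fun p hp => ?_⟩
      obtain ⟨q, hq, rfl⟩ := List.mem_map.1 hp
      simp only [rotation, ← hK q hq]; ring
    | cross s i =>
      refine ⟨K + sgn s, fun p hp => ?_⟩
      have hs := h s i (by simp)
      rcases List.mem_append.1 hp with hp | hp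
      · obtain ⟨q, hq, rfl⟩ := List.mem_map.1 hp
        change q.1 + sgn s + κ * rotation q.2 = K + sgn s
        rw [← hK q hq]; ring
      · obtain ⟨q, hq, rfl⟩ := List.mem_map.1 hp
        change q.1 - sgn s + κ * ((-1) ^ i + ((-1) ^ i + rotation q.2)) = K + sgn s
        rw [← hK q hq]; linear_combination -2 * hs

theorem altPattern_mem {w : Word} {b : Bool} {n : ℕ} (h : altPattern w = List.replicate n b)
    {s : Bool} {i : ℕ} (hs : cross s i ∈ w) : xor (!s) (par i) = b := by
  have : xor (!s) (par i) ∈ altPattern w := by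
    clear h
    induction w with
    | nil => simp at hs
    | cons l w ih =>
      rcases List.mem_cons.1 hs with rfl | hs'
      · simp [altPattern]
      · have := ih hs'
        cases l with
        | cross s i => exact List.mem_cons_of_mem _ this
        | _ => exact this
  rw [h] at this
  exact (List.mem_replicate.1 this).2

theorem neg_one_pow_eq_par (i : ℕ) : (-1 : ℤ) ^ i = if par i then -1 else 1 := by
  rcases Nat.even_or_odd i with h | h
  · have : par i = false := by simp [par, Nat.even_iff.1 h]
    simp [h.neg_one_pow, this]
  · have : par i = true := by simp [par, Nat.odd_iff.1 h]
    simp [h.neg_one_pow, this]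

/-- All single-loop states of an alternating diagram contribute with the same exponent. -/
theorem exists_exponent {w : Word} (hw : IsLinkDiagram w) (h : IsAlternating w) :
    ∃ K : ℤ, ∀ p ∈ states w, colorings p.2 ≤ 2 → p.1 = K := by
  by_cases hne : w = []
  · subst hne; exact ⟨0, by simp [states]⟩
  by_cases hc : colorings w ≤ 2
  · obtain ⟨b, hb⟩ := altPattern_of_alternating hw h hc
    -- The constant comparison colour `b` expresses the sign of every crossing through the parity of
    -- its position, with `κ` as the factor.
    obtain ⟨K, hK⟩ := rotation_of_mem_states (w := w) (κ := if b then -1 else 1) (by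
      intro s i hs
      have := altPattern_mem hb hs
      rw [neg_one_pow_eq_par, ← this]
      cases s <;> cases par i <;> simp [sgn])
    refine ⟨K - (if b then -1 else 1) * 2, fun p hp hpc => ?_⟩
    have hp2 : IsLinkDiagram p.2 := hw.of_mem_states hp
    have hpne : p.2 ≠ [] := by
      intro h0
      match w, hw, hne, hp with
      | cup i :: w, _, _, hp =>
        obtain ⟨q, hq, rfl⟩ := List.mem_map.1 hp
        simp at h0
      | cap i :: w, hw, _, _ => exact absurd hw.1 (by omega)
      | cross s i :: w, hw, _, _ => exact absurd hw.1 (by omega)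
    have h2 := two_le_colorings hp2 hpne
    have := rotation_eq_two (isFlat_of_mem_states hp) hp2 (by omega)
    rw [← hK p hp, this]; ring
  -- A disconnected projection has no state with a single loop, because smoothing never decreases
  -- the number of colourings.
  · refine ⟨0, fun p hp hpc => absurd (le_trans (tr_le_of_mem_states hp _ _) hpc) hc⟩

/-- The determinant of an alternating diagram is the number of its single-loop states. -/
theorem determinant_eq_treeCount {w : Word} (hw : IsLinkDiagram w) (h : IsAlternating w) :
    determinant w = treeCount w := by
  obtain ⟨K, hK⟩ := exists_exponent hw h
  have : kb w = rootA ^ K * treeCount w := by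
    rw [treeCount_eq_stateSum, ← stateSum_mul_left, kb]
    refine stateSum_congr fun p hp => ?_
    by_cases hc : colorings p.2 ≤ 2
    · rw [hK p hp hc]
    · simp [weight, hc]
  rw [determinant_eq hw, this, norm_mul, norm_rootA_zpow, one_mul, Complex.norm_natCast]

theorem altRun_append {u v : Word} {x z : List Bool} :
    AltRun (u ++ v) x z ↔ ∃ y, AltRun u x y ∧ AltRun v y z := by
  induction u generalizing x with
  | nil => simp [AltRun]
  | cons l u ih =>
    cases l with
    | cup i => simp only [List.cons_append, AltRun, ih]; tauto
    | cap i => simp only [List.cons_append, AltRun, ih]; tauto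
    | cross s i => simp only [List.cons_append, AltRun, ih]; tauto

theorem IsAlternating.smoothInfty {a b : Word} {s : Bool} {i : ℕ}
    (h : IsAlternating (a ++ cross s i :: b)) : IsAlternating (a ++ b) := by
  obtain ⟨y, h1, h2⟩ := altRun_append.1 h
  exact altRun_append.2 ⟨y, h1, h2.2.2⟩

theorem IsAlternating.smoothZero {a b : Word} {s : Bool} {i : ℕ}
    (h : IsAlternating (a ++ cross s i :: b)) : IsAlternating (a ++ cap i :: cup i :: b) := by
  obtain ⟨y, h1, h2, h3, h4⟩ := altRun_append.1 h
  refine altRun_append.2 ⟨y, h1, ⟨!s, h2, by simpa using h3⟩, !s, ?_⟩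
  obtain ⟨hi, e1⟩ := List.getElem?_eq_some_iff.1 h2
  obtain ⟨hi', e2⟩ := List.getElem?_eq_some_iff.1 h3
  have : List.take i (List.take i y ++ List.drop (i + 2) y) ++ [!s, !(!s)] ++
      List.drop i (List.take i y ++ List.drop (i + 2) y) = y := by
    rw [List.take_append_of_le_length (by simp; omega), List.take_take, min_self,
      List.drop_append_of_le_length (by simp; omega), List.drop_eq_nil_of_le (by simp)]
    conv_rhs => rw [← List.take_append_drop i y, List.drop_eq_getElem_cons hi,
      List.drop_eq_getElem_cons hi', e1, e2]
    simp
  rw [this]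
  exact h4

theorem IsTangle.smoothInfty {m n : ℕ} {a b : Word} {s : Bool} {i : ℕ}
    (h : IsTangle m n (a ++ cross s i :: b)) : IsTangle m n (a ++ b) := by
  obtain ⟨p, h1, h2⟩ := isTangle_append.1 h
  exact h1.append h2.2

theorem IsTangle.smoothZero {m n : ℕ} {a b : Word} {s : Bool} {i : ℕ}
    (h : IsTangle m n (a ++ cross s i :: b)) : IsTangle m n (a ++ cap i :: cup i :: b) := by
  obtain ⟨p, h1, h2⟩ := isTangle_append.1 h
  have := h2.1
  refine h1.append ⟨h2.1, by omega, ?_⟩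
  rw [Nat.sub_add_cancel (by omega)]; exact h2.2

/-- Determinants of alternating diagrams are additive under smoothing. -/
theorem determinant_skein {a b : Word} {s : Bool} {i : ℕ}
    (hw : IsLinkDiagram (a ++ cross s i :: b)) (h : IsAlternating (a ++ cross s i :: b)) :
    determinant (a ++ cross s i :: b) =
      determinant (a ++ b) + determinant (a ++ cap i :: cup i :: b) := by
  rw [determinant_eq_treeCount hw h, determinant_eq_treeCount hw.smoothInfty h.smoothInfty,
    determinant_eq_treeCount hw.smoothZero h.smoothZero, treeCount_skein]
  push_cast; rfl


/-! ### The number of single-loop states -/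

/-- A crossing with the smoothing prescribed by `v`. -/
def piece (s : Bool) (i : ℕ) : Option Bool → Word
  | none => [cross s i]
  | some true => []
  | some false => [cap i, cup i]

/-- Smooth the crossings as prescribed by `m`. -/
def smooth : Word → (ℕ → Option Bool) → Word
  | [], _ => []
  | cross s i :: w, m => piece s i (m 0) ++ smooth w fun k => m (k + 1)
  | l :: w, m => l :: smooth w m

theorem smooth_congr (w : Word) {m m' : ℕ → Option Bool} (h : ∀ k < crossings w, m k = m' k) :
    smooth w m = smooth w m' := by
  induction w generalizing m m' with
  | nil => rfl
  | cons l w ih =>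
    cases l with
    | cup i => simp only [smooth, ih (m := m) (m' := m') h]
    | cap i => simp only [smooth, ih (m := m) (m' := m') h]
    | cross s i =>
      simp only [smooth, h 0 (by simp [crossings])]
      rw [ih fun k hk => h (k + 1) (by simpa [crossings] using hk)]

theorem smooth_none (w : Word) : smooth w (fun _ => none) = w := by
  induction w with
  | nil => rfl
  | cons l w ih => cases l <;> simp [smooth, piece, ih]

theorem IsTangle.piece_append {p n : ℕ} {b : Word} {s : Bool} {i : ℕ} (hi : i + 2 ≤ p)
    (h : IsTangle p n b) (v : Option Bool) : IsTangle p n (piece s i v ++ b) := by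
  match v with
  | none => exact ⟨hi, h⟩
  | some true => exact h
  | some false =>
    refine ⟨hi, by omega, ?_⟩
    rwa [Nat.sub_add_cancel (by omega)]

theorem IsTangle.smooth {p n : ℕ} {w : Word} (h : IsTangle p n w) (m : ℕ → Option Bool) :
    IsTangle p n (smooth w m) := by
  induction w generalizing p m with
  | nil => exact h
  | cons l w ih =>
    cases l with
    | cup i => exact ⟨h.1, ih h.2 m⟩
    | cap i => exact ⟨h.1, ih h.2 m⟩
    | cross s i => exact (ih h.2 _).piece_append h.1 _

theorem smooth_ne_nil {w : Word} (h : IsLinkDiagram w) (hne : w ≠ []) (m : ℕ → Option Bool) :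
    smooth w m ≠ [] := by
  match w, h, hne with
  | cup i :: w, _, _ => simp [smooth]
  | cap i :: w, h, _ => exact absurd h.1 (by omega)
  | cross s i :: w, h, _ => exact absurd h.1 (by omega)

theorem isFlat_smooth (w : Word) (c : ℕ → Bool) : IsFlat (smooth w fun k => some (c k)) := by
  induction w generalizing c with
  | nil => exact isFlat_nil
  | cons l w ih =>
    cases l with
    | cup i =>
      intro x hx
      rcases List.mem_cons.1 hx with rfl | hx
      · simp
      · exact ih c x hx
    | cap i =>
      intro x hx
      rcases List.mem_cons.1 hx with rfl | hx
      · simp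
      · exact ih c x hx
    | cross s i =>
      refine IsFlat.append ?_ (ih fun k => c (k + 1))
      show IsFlat (piece s i (some (c 0)))
      cases c 0 <;> simp [IsFlat, piece]

theorem smooth_update (w : Word) (m : ℕ → Option Bool) {j : ℕ} (hj : j < crossings w) :
    ∃ a s i b, ∀ v, smooth w (Function.update m j v) = a ++ (piece s i v ++ b) := by
  induction w generalizing m j with
  | nil => simp [crossings] at hj
  | cons l w ih =>
    cases l with
    | cup i =>
      obtain ⟨a, s, i', b, h⟩ := ih m hj
      exact ⟨cup i :: a, s, i', b, fun v => by simp [smooth, h]⟩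
    | cap i =>
      obtain ⟨a, s, i', b, h⟩ := ih m hj
      exact ⟨cap i :: a, s, i', b, fun v => by simp [smooth, h]⟩
    | cross s i =>
      rcases j with _ | j
      · refine ⟨[], s, i, smooth w fun k => m (k + 1), fun v => ?_⟩
        simp [smooth]
      · obtain ⟨a, s', i', b, h⟩ := ih (fun k => m (k + 1)) (j := j) (by simpa [crossings] using hj)
        refine ⟨piece s i (m 0) ++ a, s', i', b, fun v => ?_⟩
        have e : (fun k => Function.update m (j + 1) v (k + 1)) =
            Function.update (fun k => m (k + 1)) j v := by
          funext k
          simp [Function.update_apply]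
        simp [smooth, e, h]

/-! ### Partial smoothings and flips of a state -/

/-- The smoothings `c`, with the crossings in `F` kept. -/
def keep (c F : ℕ → Bool) (k : ℕ) : Option Bool := if F k then none else some (c k)

/-- Keeping a crossing imposes the condition that the colours around it agree. The colourings that
satisfy the conditions in `F ∪ G` are the intersection of those for `F` and those for `G`, and the
first inequality is inclusion-exclusion inside the colourings of the state. -/
theorem tr_keep (w : Word) (φ : (ℕ → Bool) → ℕ) (c F G : ℕ → Bool) (x : ℕ → Bool) :
    let N := fun F => tr (smooth w (keep c F)) φ x
    N F + N G ≤ N (fun k => F k || G k) + N (fun _ => false) ∧ N (fun k => F k || G k) ≤ N F ∧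
      N (fun k => F k || G k) ≤ N G ∧ N F ≤ N (fun _ => false) ∧ N G ≤ N (fun _ => false) := by
  induction w generalizing c F G x with
  | nil => simp [smooth]
  | cons l w ih =>
    cases l with
    | cup i =>
      have h0 := ih c F G (ins i false x)
      have h1 := ih c F G (ins i true x)
      simp only [smooth, tr] at *
      omega
    | cap i =>
      have h0 := ih c F G (del i x)
      simp only [smooth, tr] at *
      split
      · exact h0
      · simp
    | cross s i =>
      have hx := ih (fun k => c (k + 1)) (fun k => F (k + 1)) (fun k => G (k + 1)) x
      have h0 := ih (fun k => c (k + 1)) (fun k => F (k + 1)) (fun k => G (k + 1))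
        (ins i false (del i x))
      have h1 := ih (fun k => c (k + 1)) (fun k => F (k + 1)) (fun k => G (k + 1))
        (ins i true (del i x))
      have e : ∀ F : ℕ → Bool, (fun k => keep c F (k + 1)) =
        keep (fun k => c (k + 1)) fun k => F (k + 1) := fun F => rfl
      have hd := ins_del i x
      simp only [smooth, e]
      cases hF : F 0 <;> cases hG : G 0 <;> cases hc : c 0 <;>
        by_cases hi : x i = x (i + 1) <;>
        simp only [keep, hF, hG, hc, piece, tr, hi, Bool.or_false, Bool.or_true,
          Bool.false_eq_true, if_false, if_true, List.nil_append, List.cons_append] at * <;>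
        first
        | omega
        | (cases hxi : x (i + 1) <;> rw [hxi] at hd <;> have hd := hd trivial <;> rw [hd] at * <;>
            omega)

/-- If every colouring satisfies each single condition, it satisfies all of them. -/
theorem tr_keep_finset (w : Word) (φ : (ℕ → Bool) → ℕ) (c : ℕ → Bool) (x : ℕ → Bool)
    (F : Finset ℕ)
    (h : ∀ j ∈ F, tr (smooth w (keep c fun k => decide (k = j))) φ x =
      tr (smooth w (keep c fun _ => false)) φ x) :
    tr (smooth w (keep c fun k => decide (k ∈ F))) φ x =
      tr (smooth w (keep c fun _ => false)) φ x := by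
  induction F using Finset.induction_on with
  | empty => simp
  | insert j F hj ih =>
    have h1 := ih fun k hk => h k (by simp [hk])
    have h2 := h j (by simp)
    have := tr_keep w φ c (fun k => decide (k = j)) (fun k => decide (k ∈ F)) x
    simp only [Finset.mem_insert, Bool.decide_or] at *
    omega

/-- The number of loops of a state, as the number of colourings. -/
def loopColorings (w : Word) (c : ℕ → Bool) : ℕ := colorings (smooth w fun k => some (c k))

theorem keep_false (c : ℕ → Bool) : keep c (fun _ => false) = fun k => some (c k) := by
  funext k; simp [keep]

theorem loopColorings_flip {w : Word} (hw : IsLinkDiagram w) (c : ℕ → Bool) {j : ℕ}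
    (hj : j < crossings w) :
    let X := colorings (smooth w (keep c fun k => decide (k = j)))
    (loopColorings w c = X ∧ loopColorings w (Function.update c j (!(c j))) = 2 * X) ∨
    (loopColorings w c = 2 * X ∧ loopColorings w (Function.update c j (!(c j))) = X) := by
  obtain ⟨a, s, i, b, h⟩ := smooth_update w (fun k => some (c k)) hj
  have e : ∀ v, (fun k => some (Function.update c j v k)) =
      Function.update (fun k => some (c k)) j (some v) := by
    intro v; funext k; simp only [Function.update_apply]; split <;> rfl
  have e1 : ∀ v, loopColorings w (Function.update c j v) = colorings (a ++ (piece s i (some v) ++ b)) := by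
    intro v
    rw [loopColorings, e, h]
  have e2 : loopColorings w c = colorings (a ++ (piece s i (some (c j)) ++ b)) := by
    rw [← e1, Function.update_eq_self]
  have e3 : keep c (fun k => decide (k = j)) = Function.update (fun k => some (c k)) j none := by
    funext k; simp only [keep, Function.update_apply, decide_eq_true_eq]
  have hlink : IsLinkDiagram (a ++ cross s i :: b) := by
    have := hw.smooth (Function.update (fun k => some (c k)) j none)
    rwa [h] at this
  have hf := isFlat_smooth w (Function.update c j true)
  rw [e, h] at hf
  have ha : IsFlat a := fun l hl => hf l (by simp [hl])
  have hb : IsFlat b := fun l hl => hf l (by simp [hl])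
  have key := colorings_flat_smoothings ha hb hlink
  simp only [e1, e2, e3, h]
  cases c j <;> simp only [piece, Bool.not_true, Bool.not_false, List.nil_append,
    List.cons_append] <;> tauto

/-- The augmentation step. If keeping the crossings in `F` connects different loops, then some
single crossing of `F` already does, by `tr_keep_finset`, and changing its smoothing merges two
loops. -/
theorem exists_flip {w : Word} (hw : IsLinkDiagram w) (c : ℕ → Bool) (F : Finset ℕ)
    (hF : ∀ j ∈ F, j < crossings w)
    (h : colorings (smooth w (keep c fun k => decide (k ∈ F))) < loopColorings w c) :
    ∃ j ∈ F, loopColorings w c = 2 * loopColorings w (Function.update c j (!(c j))) := by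
  by_contra! hne
  refine absurd (tr_keep_finset w (fun _ => 1) c (fun _ => false) F fun j hj => ?_) ?_
  · have := loopColorings_flip hw c (hF j hj)
    have h2 := hne j hj
    rw [keep_false]
    simp only [loopColorings, colorings] at *
    omega
  · rw [keep_false]; exact h.ne

/-- A state with the fewest loops works: as long as there are several loops, connectedness of the
projection supplies a crossing whose flip merges two of them. -/
theorem exists_single_loop {w : Word} (hw : IsLinkDiagram w) (hc : colorings w ≤ 2) :
    ∃ c, loopColorings w c ≤ 2 := by
  by_contra! hne
  obtain ⟨c, hmin⟩ : ∃ c, ∀ c', loopColorings w c ≤ loopColorings w c' := by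
    exact ⟨Function.argmin (loopColorings w), fun c' => Function.argmin_le (loopColorings w) c'⟩
  obtain ⟨j, -, hj⟩ := exists_flip hw c (Finset.range (crossings w)) (by simp) (by
    have : smooth w (keep c fun k => decide (k ∈ Finset.range (crossings w))) = w := by
      conv_rhs => rw [← smooth_none w]
      refine smooth_congr w fun k hk => by simp [keep, hk]
    rw [this]
    exact lt_of_le_of_lt hc (hne c))
  have h1 := hmin (Function.update c j (!(c j)))
  have h2 := hne c
  omega

/-- The states are listed once for each choice of smoothings, so choices that differ at some
crossing occupy different entries. Only the first `crossings w` values of a choice matter. -/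
theorem sum_le_sum_states {ι : Type*} (w : Word) (h : Word → ℕ) (T : Finset ι)
    (c : ι → ℕ → Bool)
    (hc : ∀ p ∈ T, ∀ q ∈ T, (∀ k < crossings w, c p k = c q k) → p = q) :
    ∑ p ∈ T, h (smooth w fun k => some (c p k)) ≤ ((states w).map fun p => h p.2).sum := by
  induction w generalizing h T c with
  | nil =>
    have : T.card ≤ 1 := Finset.card_le_one.2 fun p hp q hq => hc p hp q hq (by simp [crossings])
    simp only [smooth, states, Finset.sum_const, smul_eq_mul, List.map_cons, List.map_nil,
      List.sum_cons, List.sum_nil, add_zero]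
    nlinarith
  | cons l w ih =>
    cases l with
    | cup i =>
      simpa [smooth, states, Function.comp_def] using ih (fun u => h (cup i :: u)) T c hc
    | cap i =>
      simpa [smooth, states, Function.comp_def] using ih (fun u => h (cap i :: u)) T c hc
    | cross s i =>
      rw [← Finset.sum_filter_add_sum_filter_not T (fun p => c p 0 = true)]
      simp only [states, List.map_append, List.map_map, List.sum_append, Function.comp_def]
      refine add_le_add ?_ ?_
      · refine le_trans (le_of_eq ?_) (ih h (T.filter fun p => c p 0 = true)
          (fun p k => c p (k + 1)) ?_)
        · refine Finset.sum_congr rfl fun p hp => ?_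
          simp [smooth, (Finset.mem_filter.1 hp).2, piece]
        · intro p hp q hq hpq
          rw [Finset.mem_filter] at hp hq
          refine hc p hp.1 q hq.1 fun k hk => ?_
          rcases k with _ | k
          · rw [hp.2, hq.2]
          · exact hpq k (by simpa [crossings] using hk)
      · refine le_trans (le_of_eq ?_) (ih (fun u => h (cap i :: cup i :: u))
          (T.filter fun p => ¬ c p 0 = true) (fun p k => c p (k + 1)) ?_)
        · refine Finset.sum_congr rfl fun p hp => ?_
          have := (Finset.mem_filter.1 hp).2
          simp only [Bool.not_eq_true] at this
          simp [smooth, this, piece]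
        · intro p hp q hq hpq
          rw [Finset.mem_filter] at hp hq
          refine hc p hp.1 q hq.1 fun k hk => ?_
          rcases k with _ | k
          · have h1 := hp.2
            have h2 := hq.2
            simp only [Bool.not_eq_true] at h1 h2
            rw [h1, h2]
          · exact hpq k (by simpa [crossings] using hk)

theorem one_le_treeCount {w : Word} (hw : IsLinkDiagram w) (hc : colorings w ≤ 2) :
    1 ≤ treeCount w := by
  obtain ⟨c, h⟩ := exists_single_loop hw hc
  have := sum_le_sum_states w (fun u => if colorings u ≤ 2 then 1 else 0) {()} (fun _ => c)
    (by simp)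
  simp only [Finset.sum_singleton] at this
  rw [loopColorings] at h
  rw [if_pos h] at this
  exact this

/-! ### An exchange property for families of sets -/

theorem pair_eq_pair {a b c d : ℕ} (h : ({a, b} : Finset ℕ) = {c, d}) :
    a = c ∧ b = d ∨ a = d ∧ b = c := by
  have h1 : a ∈ ({c, d} : Finset ℕ) := by rw [← h]; simp
  have h2 : b ∈ ({c, d} : Finset ℕ) := by rw [← h]; simp
  have h3 : c ∈ ({a, b} : Finset ℕ) := by rw [h]; simp
  have h4 : d ∈ ({a, b} : Finset ℕ) := by rw [h]; simp
  simp only [Finset.mem_insert, Finset.mem_singleton] at h1 h2 h3 h4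
  omega

theorem quadruple_ne_pair {u v x y c d : ℕ} (huv : u ≠ v) (hu : u ≠ x) (hv : v ≠ x) :
    ({u, v, x, y} : Finset ℕ) ≠ {c, d} := by
  intro h
  have h1 : u ∈ ({c, d} : Finset ℕ) := by rw [← h]; simp
  have h2 : v ∈ ({c, d} : Finset ℕ) := by rw [← h]; simp
  have h3 : x ∈ ({c, d} : Finset ℕ) := by rw [← h]; simp
  simp only [Finset.mem_insert, Finset.mem_singleton] at h1 h2 h3
  omega

theorem quadruple_eq_quadruple {u v x y x' y' : ℕ} (hu : u ≠ x) (hv : v ≠ x)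
    (h : ({u, v, x, y} : Finset ℕ) = {u, v, x', y'}) : x = x' ∨ x = y' := by
  have h1 : x ∈ ({u, v, x', y'} : Finset ℕ) := by rw [← h]; simp
  simp only [Finset.mem_insert, Finset.mem_singleton] at h1
  omega

/-- The possible sets attached to a mutual pair `{x, y}` by an exchange with `{u, v}`. -/
def ExchangeSet (u v x y : ℕ) (S : Finset ℕ) : Prop :=
  S = {u, v, x, y} ∨ S = {u, x} ∨ S = {v, x}

/-- The element `x` is visible in all three shapes, and the four-element shape is never a pair;
hence different mutual pairs receive different sets. -/
theorem ExchangeSet.inj {u v x y x' y' : ℕ} {S : Finset ℕ} (h : ExchangeSet u v x y S)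
    (h' : ExchangeSet u v x' y' S) (huv : u ≠ v) (hu : u ≠ x) (hv : v ≠ x) (hu' : u ≠ x')
    (hv' : v ≠ x') : x = x' ∨ x = y' := by
  rcases h with rfl | rfl | rfl <;> rcases h' with h' | h' | h'
  · exact quadruple_eq_quadruple hu hv h'
  · exact absurd h' (quadruple_ne_pair huv hu hv)
  · exact absurd h' (quadruple_ne_pair huv hu hv)
  · exact absurd h'.symm (quadruple_ne_pair huv hu' hv')
  · have := pair_eq_pair h'; omega
  · have := pair_eq_pair h'; omega
  · exact absurd h'.symm (quadruple_ne_pair huv hu' hv')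
  · have := pair_eq_pair h'; omega
  · have := pair_eq_pair h'; omega

theorem ExchangeSet.eq_pair {u v x y c d : ℕ} {S : Finset ℕ} (h : ExchangeSet u v x y S)
    (h' : S = {c, d}) (huv : u ≠ v) (hu : u ≠ x) (hv : v ≠ x) :
    u = c ∧ x = d ∨ u = d ∧ x = c ∨ v = c ∧ x = d ∨ v = d ∧ x = c := by
  rcases h with rfl | rfl | rfl
  · exact absurd h' (quadruple_ne_pair huv hu hv)
  · have := pair_eq_pair h'; omega
  · have := pair_eq_pair h'; omega

/-- A family of sets containing `∅` and, for every `i < n`, a pair `{i, ν i}`, which satisfies an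
exchange property for disjoint pairs, has at least `n` members. -/
theorem exists_injOn_of_exchange (n : ℕ) (B : Finset ℕ → Prop) (h0 : B ∅)
    (h1 : ∀ i < n, ∃ j < n, j ≠ i ∧ B {i, j})
    (h2 : ∀ u v x y, u < n → v < n → x < n → y < n → [u, v, x, y].Nodup → B {u, v} → B {x, y} →
      B {u, v, x, y} ∨ B {u, x} ∨ B {v, x}) :
    ∃ F : ℕ → Finset ℕ, (∀ i < n, B (F i) ∧ F i ⊆ Finset.range n) ∧
      Set.InjOn F (Set.Iio n) := by
  choose! ν hν hn hB using h1
  have hsub : ∀ i < n, ({i, ν i} : Finset ℕ) ⊆ Finset.range n := by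
    intro i hi z hz
    have := hν i hi
    simp only [Finset.mem_insert, Finset.mem_singleton] at hz
    rw [Finset.mem_range]
    omega
  -- The sets `{i, ν i}` collide only along mutual pairs, where `ν` exchanges `i` and `j`.
  have hpair : ∀ i < n, ∀ j < n, ({i, ν i} : Finset ℕ) = {j, ν j} →
      i = j ∨ (ν i = j ∧ ν j = i) := by
    intro i hi j hj h
    have := pair_eq_pair h
    omega
  -- Every mutual pair leaves one of its indices without a set. One mutual pair `{u, ν u}` is fixed:
  -- `u` takes `∅`, the smaller member of each other mutual pair takes a set obtained by exchange
  -- with `{u, ν u}`, and all remaining indices keep `{i, ν i}`.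
  by_cases hM : ∃ u < n, ν (ν u) = u ∧ u < ν u
  · obtain ⟨u, hu, huu, hlt⟩ := hM
    have hv := hν u hu
    have hne : ∀ x < n, ν (ν x) = x → x < ν x → x ≠ u → u ≠ x ∧ ν u ≠ x ∧ u ≠ ν x ∧ ν u ≠ ν x := by
      intro x hx hxx hxlt hxu
      refine ⟨fun h => hxu h.symm, ?_, ?_, ?_⟩ <;> intro h
      · rw [← h, huu] at hxlt; omega
      · rw [h, hxx] at hlt; omega
      · rw [← h, huu] at hxx; omega
    have hG : ∀ x, x < n → ν (ν x) = x → x < ν x → x ≠ u → ∃ S, B S ∧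
        ExchangeSet u (ν u) x (ν x) S := by
      intro x hx hxx hxlt hxu
      have hd := hne x hx hxx hxlt hxu
      have hnd : [u, ν u, x, ν x].Nodup := by
        simp only [List.nodup_cons, List.mem_cons, List.not_mem_nil, or_false, not_or,
          not_false_eq_true, List.nodup_nil, and_true]
        omega
      rcases h2 u (ν u) x (ν x) hu hv hx (hν x hx) hnd (hB u hu) (hB x hx) with h | h | h
      · exact ⟨_, h, Or.inl rfl⟩
      · exact ⟨_, h, Or.inr (Or.inl rfl)⟩
      · exact ⟨_, h, Or.inr (Or.inr rfl)⟩
    choose! G hG hG' using hG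
    clear h2
    have hGne : ∀ x, x < n → ν (ν x) = x → x < ν x → x ≠ u → G x ≠ ∅ := by
      intro x hx c1 c2 c3 h
      rcases hG' x hx c1 c2 c3 with h' | h' | h' <;> rw [h] at h' <;>
        exact absurd h'.symm (Finset.insert_ne_empty _ _)
    -- If an exchange set is some `{i, ν i}`, it is `{u, x}` or `{ν u, x}`. The indices `u` and `x`
    -- are smaller members of mutual pairs and excluded, and `i = ν u` would give `ν i = u` instead
    -- of `x`.
    have hGpair : ∀ x, x < n → ν (ν x) = x → x < ν x → x ≠ u → ∀ i < n,
        ¬ (ν (ν i) = i ∧ i < ν i) → G x ≠ {i, ν i} := by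
      intro x hx c1 c2 c3 i hi hni h
      have hd := hne x hx c1 c2 c3
      rcases (hG' x hx c1 c2 c3).eq_pair h hlt.ne hd.1 hd.2.1 with h | h | h | h
      · rw [← h.1] at hni; exact hni ⟨huu, hlt⟩
      · rw [← h.2] at hni; exact hni ⟨c1, c2⟩
      · rw [← h.1, huu] at h; omega
      · rw [← h.2] at hni; exact hni ⟨c1, c2⟩
    refine ⟨fun i => if ν (ν i) = i ∧ i < ν i then (if i = u then ∅ else G i) else {i, ν i},
      fun i hi => ?_, ?_⟩
    · dsimp only
      split_ifs with c1 c2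
      · exact ⟨h0, by simp⟩
      · refine ⟨hG i hi c1.1 c1.2 c2, ?_⟩
        have s1 := hsub i hi
        have s2 := hsub u hu
        rw [Finset.insert_subset_iff, Finset.singleton_subset_iff] at s1 s2
        rcases hG' i hi c1.1 c1.2 c2 with h | h | h <;> rw [h] <;>
          simp only [Finset.insert_subset_iff, Finset.singleton_subset_iff, s1, s2, and_self]
      · exact ⟨hB i hi, hsub i hi⟩
    · intro i hi j hj hij
      rw [Set.mem_Iio] at hi hj
      dsimp only at hij
      by_cases ci : ν (ν i) = i ∧ i < ν i
      · rw [if_pos ci] at hij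
        by_cases cj : ν (ν j) = j ∧ j < ν j
        · rw [if_pos cj] at hij
          by_cases di : i = u
          · rw [if_pos di] at hij
            by_cases dj : j = u
            · rw [di, dj]
            · rw [if_neg dj] at hij
              exact absurd hij.symm (hGne j hj cj.1 cj.2 dj)
          · rw [if_neg di] at hij
            by_cases dj : j = u
            · rw [if_pos dj] at hij
              exact absurd hij (hGne i hi ci.1 ci.2 di)
            · rw [if_neg dj] at hij
              have a1 := hG' i hi ci.1 ci.2 di
              rw [hij] at a1
              have d1 := hne i hi ci.1 ci.2 di
              have d2 := hne j hj cj.1 cj.2 dj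
              rcases a1.inj (hG' j hj cj.1 cj.2 dj) hlt.ne d1.1 d1.2.1 d2.1 d2.2.1 with h | h
              · exact h
              · have h3 := ci.2
                rw [h, cj.1] at h3
                have := cj.2
                omega
        · rw [if_neg cj] at hij
          by_cases di : i = u
          · rw [if_pos di] at hij
            exact absurd hij.symm (Finset.insert_ne_empty _ _)
          · rw [if_neg di] at hij
            exact absurd hij (hGpair i hi ci.1 ci.2 di j hj cj)
      · rw [if_neg ci] at hij
        by_cases cj : ν (ν j) = j ∧ j < ν j
        · rw [if_pos cj] at hij
          by_cases dj : j = u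
          · rw [if_pos dj] at hij
            exact absurd hij (Finset.insert_ne_empty _ _)
          · rw [if_neg dj] at hij
            exact absurd hij.symm (hGpair j hj cj.1 cj.2 dj i hi ci)
        · rw [if_neg cj] at hij
          rcases hpair i hi j hj hij with h | ⟨h, h'⟩
          · exact h
          · rw [h, h'] at ci
            rw [h', h] at cj
            omega
  · push Not at hM
    refine ⟨fun i => {i, ν i}, fun i hi => ⟨hB i hi, hsub i hi⟩, fun i hi j hj hij => ?_⟩
    rcases hpair i hi j hj hij with h | ⟨h, h'⟩
    · exact h
    · have a1 := hM i hi
      have a2 := hM j hj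
      rw [h, h'] at a1
      rw [h', h] at a2
      have := a1 rfl
      have := a2 rfl
      omega

/-! ### The exchange property of single-loop states -/

/-- A connected diagram without nugatory crossings has at least as many single-loop states as
crossings. -/
theorem crossings_le_treeCount {w : Word} (hw : IsLinkDiagram w) (hc : colorings w ≤ 2)
    (hred : ∀ a s i b, w = a ++ cross s i :: b →
      colorings (a ++ b) ≤ 2 ∧ colorings (a ++ cap i :: cup i :: b) ≤ 2) :
    crossings w ≤ treeCount w := by
  by_cases hne : w = []
  · simp [hne, crossings]
  obtain ⟨c, hc0⟩ := exists_single_loop hw hc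
  -- States are recorded by the set of crossings at which they differ from the single-loop state
  -- `c`; `B` selects the single-loop states.
  let flip : Finset ℕ → ℕ → Bool := fun S k => xor (c k) (decide (k ∈ S))
  have hflip : ∀ S j, Function.update (flip S) j (!(flip S j)) =
      flip (if j ∈ S then S.erase j else insert j S) := by
    intro S j
    funext k
    simp only [flip, Function.update_apply]
    by_cases hk : k = j
    · subst hk
      by_cases hS : k ∈ S <;> simp [hS]
    · by_cases hS : j ∈ S <;> simp [hS, hk]
  let B : Finset ℕ → Prop := fun S => loopColorings w (flip S) ≤ 2
  have hB0 : B ∅ := by simpa [B, flip] using hc0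
  have two_le : ∀ m, 2 ≤ colorings (smooth w m) := fun m =>
    two_le_colorings (hw.smooth m) (smooth_ne_nil hw hne m)
  -- A flip always changes the number of loops by one, and a single loop can only become two.
  have hdouble : ∀ S, B S → ∀ j < crossings w, j ∉ S → loopColorings w (flip (insert j S)) = 4 := by
    intro S hS j hj hjS
    have h1 := loopColorings_flip hw (flip S) hj
    rw [hflip, if_neg hjS] at h1
    have h2 := two_le (keep (flip S) fun k => decide (k = j))
    have h3 : loopColorings w (flip S) ≤ 2 := hS
    simp only at h1
    omega
  -- Flipping `i` creates two loops. Since `i` is not nugatory, the projection with only this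
  -- crossing smoothed is still connected, so the flip of another crossing `j` rejoins the loops.
  obtain ⟨F, hF, hinj⟩ := exists_injOn_of_exchange (crossings w) B hB0 (by
    intro i hi
    have h4 : loopColorings w (flip {i}) = 4 := by
      have := hdouble ∅ hB0 i hi (by simp)
      simpa using this
    obtain ⟨j, hj, hB⟩ := exists_flip hw (flip {i}) ((Finset.range (crossings w)).erase i)
      (fun j hj => Finset.mem_range.1 (Finset.mem_of_mem_erase hj)) (by
        rw [h4]
        obtain ⟨a, s, p, b, h⟩ := smooth_update w (fun _ => none) hi
        have h1 := h none
        rw [show Function.update (fun _ => (none : Option Bool)) i none = fun _ => none by simp,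
          smooth_none] at h1
        have h2 := hred a s p b h1
        have h3 : smooth w (keep (flip {i}) fun k =>
            decide (k ∈ (Finset.range (crossings w)).erase i)) =
            smooth w (Function.update (fun _ => none) i (some (flip {i} i))) := by
          refine smooth_congr w fun k hk => ?_
          by_cases hki : k = i
          · subst hki; simp [keep]
          · simp [keep, hki, hk]
        rw [h3, h]
        cases flip {i} i
        · exact lt_of_le_of_lt h2.2 (by omega)
        · exact lt_of_le_of_lt h2.1 (by omega))
    rw [Finset.mem_erase, Finset.mem_range] at hj
    rw [hflip, if_neg (by simpa using hj.1), h4] at hB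
    refine ⟨j, hj.2, hj.1, ?_⟩
    rw [Finset.pair_comm]
    show loopColorings w (flip {j, i}) ≤ 2
    omega) (by
    intro u v x y hu hv hx hy hnd huv hxy
    simp only [List.nodup_cons, List.mem_cons, List.not_mem_nil, or_false, not_or,
      not_false_eq_true, List.nodup_nil, and_true] at hnd
    have h4 := hdouble {u, v} huv x hx (by
      simp only [Finset.mem_insert, Finset.mem_singleton]; omega)
    obtain ⟨j, hj, hB⟩ := exists_flip hw (flip {x, u, v}) {u, v, y} (by
        intro j hj
        simp only [Finset.mem_insert, Finset.mem_singleton] at hj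
        omega) (by
      rw [h4]
      have h1 := (tr_keep w (fun _ => 1) (flip {x, y}) (fun k => decide (k ∈ ({u, v, y} : Finset ℕ)))
        (fun k => decide (k ∈ ({u, v, y} : Finset ℕ))) (fun _ => false)).2.2.2.1
      have h2 : loopColorings w (flip {x, y}) ≤ 2 := hxy
      -- The two-loop state `{x, u, v}` and the single-loop state `{x, y}` differ only at `u`, `v`
      -- and `y`. With these crossings kept both give the same connected projection, so a flip at
      -- one of the three rejoins the loops; the three choices are the three alternatives of the
      -- exchange property.
      have h3 : (keep (flip {x, u, v}) fun k => decide (k ∈ ({u, v, y} : Finset ℕ))) =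
          keep (flip {x, y}) fun k => decide (k ∈ ({u, v, y} : Finset ℕ)) := by
        funext k
        simp only [keep, flip, Finset.mem_insert, Finset.mem_singleton, decide_eq_true_eq]
        split_ifs with hk
        · rfl
        · push Not at hk
          simp [hk]
      rw [h3]
      dsimp only at h1
      rw [keep_false] at h1
      exact lt_of_le_of_lt (le_trans h1 h2) (by omega))
    rw [hflip, h4] at hB
    have hB' : loopColorings w (flip (if j ∈ ({x, u, v} : Finset ℕ) then
      ({x, u, v} : Finset ℕ).erase j else insert j {x, u, v})) ≤ 2 := by omega
    simp only [Finset.mem_insert, Finset.mem_singleton] at hj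
    rcases hj with rfl | rfl | rfl
    · rw [if_pos (by simp)] at hB'
      right; right
      have e : ({x, j, v} : Finset ℕ).erase j = {v, x} := by
        ext k; simp only [Finset.mem_erase, Finset.mem_insert, Finset.mem_singleton]; omega
      rwa [e] at hB'
    · rw [if_pos (by simp)] at hB'
      right; left
      have e : ({x, u, j} : Finset ℕ).erase j = {u, x} := by
        ext k; simp only [Finset.mem_erase, Finset.mem_insert, Finset.mem_singleton]; omega
      rwa [e] at hB'
    · rw [if_neg (by simp only [Finset.mem_insert, Finset.mem_singleton]; omega)] at hB'
      left
      have e : insert j ({x, u, v} : Finset ℕ) = {u, v, x, j} := by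
        ext k; simp only [Finset.mem_insert, Finset.mem_singleton]; omega
      rwa [e] at hB')
  have hsum := sum_le_sum_states w (fun u => if colorings u ≤ 2 then 1 else 0)
    (Finset.range (crossings w)) (fun p => flip (F p)) (by
      intro p hp q hq hpq
      rw [Finset.mem_range] at hp hq
      refine hinj hp hq (Finset.ext fun k => ?_)
      by_cases hk : k < crossings w
      · have := hpq k hk
        simpa [flip] using this
      · have h1 : k ∉ F p := fun h => hk (Finset.mem_range.1 ((hF p hp).2 h))
        have h2 : k ∉ F q := fun h => hk (Finset.mem_range.1 ((hF q hq).2 h))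
        simp [h1, h2])
  have hB (p) (hp : p ∈ Finset.range (crossings w)) :
      (if colorings (smooth w fun k => some (flip (F p) k)) ≤ 2 then 1 else 0) = 1 :=
    if_pos (hF p (Finset.mem_range.1 hp)).1
  rw [Finset.sum_congr rfl hB] at hsum
  simpa [treeCount] using hsum


/-! ### The bracket of a tangle -/

theorem shift_append (k : ℕ) (u v : Word) : shift k (u ++ v) = shift k u ++ shift k v :=
  List.map_append

theorem shift_shift (j k : ℕ) (w : Word) : shift j (shift k w) = shift (k + j) w := by
  simp only [shift, List.map_map]
  refine List.map_congr_left fun l _ => ?_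
  cases l <;> simp [Layer.shift, add_assoc]

theorem shift_zero (w : Word) : shift 0 w = w := by
  rw [shift]
  conv_rhs => rw [← List.map_id w]
  refine List.map_congr_left fun l _ => ?_
  cases l <;> rfl

theorem IsTangle.shift {m n : ℕ} {w : Word} (h : IsTangle m n w) (k : ℕ) :
    IsTangle (m + k) (n + k) (shift k w) := by
  induction w generalizing m with
  | nil => cases h; rfl
  | cons l w ih =>
    cases l with
    | cup i =>
      refine ⟨by have := h.1; omega, ?_⟩
      rw [show m + k + 2 = m + 2 + k by ring]; exact ih h.2
    | cap i =>
      have := h.1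
      refine ⟨by omega, ?_⟩
      rw [show m + k - 2 = m - 2 + k by omega]; exact ih h.2
    | cross s i => exact ⟨by have := h.1; omega, ih h.2⟩

theorem IsTangle.shift_two {T : Word} (h : IsTangle 2 2 T) {j m : ℕ} (hj : j + 2 ≤ m) :
    IsTangle m m (Knot.shift j T) := by
  have := (h.shift j).add_right (m - (j + 2))
  rwa [show 2 + j + (m - (j + 2)) = m by omega] at this

theorem IsFlat.shift {w : Word} (h : IsFlat w) (k : ℕ) : IsFlat (shift k w) := by
  intro l hl s i e
  obtain ⟨l', h1, rfl⟩ := List.mem_map.1 hl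
  cases l' with
  | cup => cases e
  | cap => cases e
  | cross s' i' => exact h _ h1 s' i' rfl

theorem crossings_append (u v : Word) : crossings (u ++ v) = crossings u + crossings v := by
  induction u with
  | nil => simp [crossings]
  | cons l u ih => cases l <;> simp [crossings, ih]; omega

theorem crossings_shift (k : ℕ) (w : Word) : crossings (shift k w) = crossings w := by
  induction w with
  | nil => rfl
  | cons l w ih => cases l <;> simpa [shift, crossings, Layer.shift] using ih

theorem exists_cross_of_crossings {w : Word} (h : 0 < crossings w) :
    ∃ a s i b, w = a ++ cross s i :: b := by
  induction w with
  | nil => simp [crossings] at h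
  | cons l w ih =>
    cases l with
    | cup i => obtain ⟨a, s, k, b, rfl⟩ := ih h; exact ⟨cup i :: a, s, k, b, rfl⟩
    | cap i => obtain ⟨a, s, k, b, rfl⟩ := ih h; exact ⟨cap i :: a, s, k, b, rfl⟩
    | cross s i => exact ⟨[], s, i, w, rfl⟩

theorem isFlat_of_crossings {w : Word} (h : crossings w = 0) : IsFlat w := by
  rintro l hl s i rfl
  obtain ⟨a, b, rfl⟩ := List.append_of_mem hl
  simp [crossings_append, crossings] at h

theorem FlatRed.shift {u v : Word} {k : ℕ} (h : FlatRed u k v) (j : ℕ) :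
    FlatRed (shift j u) k (shift j v) := by
  induction h with
  | refl u => exact .refl _
  | @head a b l r v k k' hr _ ih =>
    simp only [shift_append] at ih ⊢
    refine .head ?_ ih
    cases hr <;> simp only [Knot.shift, Layer.shift, List.map_cons, List.map_nil,
      show ∀ i : ℕ, i + 1 + j = i + j + 1 by intro i; omega] <;> constructor <;> omega

theorem kb_of_flat {l r : Word} (hl : IsFlat l) (hr : IsFlat r) {c : ℂ} {a b : Word} {m n : ℕ}
    (ha : IsTangle 0 m a) (hb : IsTangle n 0 b)
    (H : ∀ p q, IsTangle 0 m p → IsTangle n 0 q →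
      weight (p ++ l ++ q) = c * weight (p ++ r ++ q)) :
    kb (a ++ l ++ b) = c * kb (a ++ r ++ b) := by
  rw [kb_append, kb_append, ← stateSum_mul_left]
  refine stateSum_congr fun p hp => ?_
  rw [← stateSum_mul_left]
  refine stateSum_congr fun q hq => ?_
  rw [stateSum_flat hl, stateSum_flat hr, H _ _ (ha.of_mem_states hp) (hb.of_mem_states hq)]
  ring

/-- A loop inside the tangle makes every term vanish. The condition `m ≠ 0` keeps the surroundings
non-empty, as `weight_loop` requires. -/
theorem kb_of_flatRed {l r : Word} {k : ℕ} (h : FlatRed l k r) (hl : IsFlat l) (hr : IsFlat r)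
    {a b : Word} {m n : ℕ} (ha : IsTangle 0 m a) (hm : m ≠ 0) (h' : IsTangle m n l)
    (hb : IsTangle n 0 b) :
    kb (a ++ l ++ b) = (if k = 0 then 1 else 0) * kb (a ++ r ++ b) := by
  refine kb_of_flat hl hr ha hb fun p q hp hq => ?_
  have hne : p ≠ [] := by rintro rfl; exact hm hp.symm
  have := two_le_colorings ((hp.append (h.isTangle h')).append hq) (by simp [hne])
  rw [weight, h.colorings]
  rcases k with _ | k
  · simp [weight]
  · rw [if_neg, if_neg (by omega), zero_mul]
    have := Nat.one_le_two_pow (n := k)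
    rw [pow_succ]
    nlinarith

/-- `T` may be replaced by `f` times the tangle `0` plus `g` times the tangle `∞`. -/
def Expands (T : Word) (f g : ℂ) : Prop :=
  ∀ (a b : Word) (j m : ℕ), IsTangle 0 m a → j + 2 ≤ m → IsTangle m 0 b →
    kb (a ++ shift j T ++ b) = f * kb (a ++ [cap j, cup j] ++ b) + g * kb (a ++ b)

/-- Smoothing the crossings one after another leaves crossingless tangles, which are `0` or `∞` up
to loops. The coefficients do not depend on the surroundings. -/
theorem exists_expands {T : Word} (hT : IsTangle 2 2 T) : ∃ f g, Expands T f g := by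
  induction hn : crossings T using Nat.strong_induction_on generalizing T with
  | _ n ih =>
    by_cases h0 : crossings T = 0
    · have hf := isFlat_of_crossings h0
      obtain ⟨k, h | h⟩ := exists_flatRed_zero_or_infty hf hT
      · refine ⟨if k = 0 then 1 else 0, 0, fun a b j m ha hj hb => ?_⟩
        rw [kb_of_flatRed (h.shift j) (hf.shift j) _ ha (by omega) (hT.shift_two hj) hb]
        · simp [shift, zeroTangle, Layer.shift]
        · simp [IsFlat, shift, zeroTangle, Layer.shift]
      · refine ⟨0, if k = 0 then 1 else 0, fun a b j m ha hj hb => ?_⟩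
        rw [kb_of_flatRed (h.shift j) (hf.shift j) isFlat_nil ha (by omega) (hT.shift_two hj) hb]
        simp [shift, inftyTangle]
    · obtain ⟨u, s, i, v, rfl⟩ := exists_cross_of_crossings (Nat.pos_of_ne_zero h0)
      simp only [crossings_append, crossings] at hn
      obtain ⟨f1, g1, h1⟩ := ih _ (by simp only [crossings_append]; omega) hT.smoothInfty rfl
      obtain ⟨f2, g2, h2⟩ := ih _ (by simp only [crossings_append, crossings]; omega)
        hT.smoothZero rfl
      refine ⟨rootA ^ sgn s * f1 + rootA ^ (-sgn s) * f2,
        rootA ^ sgn s * g1 + rootA ^ (-sgn s) * g2, fun a b j m ha hj hb => ?_⟩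
      have e1 := h1 a b j m ha hj hb
      have e2 := h2 a b j m ha hj hb
      have e := kb_skein (a ++ shift j u) (shift j v ++ b) s (i + j)
      simp only [shift, List.map_append, List.map_cons, Layer.shift, List.append_assoc,
        List.cons_append] at e e1 e2 ⊢
      rw [e, e1, e2]
      ring

theorem kb_flat {w : Word} (hw : IsFlat w) : kb w = weight w := by
  rw [kb, stateSum_flat hw]; simp

/-- The numerator of `0` has two loops and vanishes, and the numerator of `∞` is a circle. For the
denominator the roles are exchanged. -/
theorem Expands.numerator {T : Word} {f g : ℂ} (h : Expands T f g) : kb (numerator T) = g := by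
  have := h [cup 0] [cap 0] 0 2 ⟨le_rfl, rfl⟩ le_rfl ⟨le_rfl, rfl⟩
  rw [shift_zero] at this
  rw [Knot.numerator, this, kb_flat (by simp [IsFlat]), kb_flat (by simp [IsFlat]), weight,
    if_neg (by decide), weight, if_pos (by decide)]
  ring

theorem Expands.denominator {T : Word} {f g : ℂ} (h : Expands T f g) :
    kb (denominator T) = f := by
  have := h [cup 0, cup 2] [cap 0, cap 0] 1 4 ⟨le_rfl, le_rfl, rfl⟩ (by omega)
    ⟨by omega, le_rfl, rfl⟩
  rw [Knot.denominator, this, kb_flat (by simp [IsFlat]), kb_flat (by simp [IsFlat]), weight,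
    if_pos (by decide), weight, if_neg (by decide)]
  ring

theorem expands_one (s : Bool) : Expands (oneTangle s) (rootA ^ (-sgn s)) (rootA ^ sgn s) := by
  intro a b j m ha hj hb
  have := kb_skein a b s j
  simpa [shift, oneTangle, Layer.shift, add_comm] using this

theorem isTangle_tangleSum {T S : Word} (hT : IsTangle 2 2 T) (hS : IsTangle 2 2 S) :
    IsTangle 2 2 (tangleSum T S) := by
  have h1 : IsTangle 2 4 [cup 1] := ⟨by omega, rfl⟩
  have h2 : IsTangle 4 2 [cap 1] := ⟨by omega, rfl⟩
  exact ((h1.append (hT.add_right 2)).append (hS.shift 2)).append h2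

theorem isTangle_tangleProd {T S : Word} (hT : IsTangle 2 2 T) (hS : IsTangle 2 2 S) :
    IsTangle 2 2 (tangleProd T S) := hS.append hT

/-- In the product expansion `0 + 0` is `0`, both mixed sums are `∞`, and `∞ + ∞` contains a loop
and vanishes. -/
theorem Expands.tangleSum {T S : Word} {f g f' g' : ℂ} (h : Expands T f g)
    (h' : Expands S f' g') (hS : IsTangle 2 2 S) :
    Expands (tangleSum T S) (f * f') (f * g' + g * f') := by
  intro a b j m ha hj hb
  have hcap : IsTangle (m + 2) 0 (cap (j + 1) :: b) := ⟨by omega, by simpa using hb⟩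
  have c0 : IsTangle 0 (m + 2) (a ++ [cup (j + 1)]) := ha.append ⟨by omega, rfl⟩
  have c1 : IsTangle 0 (m + 2) (a ++ [cup (j + 1)] ++ [cap j, cup j]) :=
    c0.append ⟨by omega, by omega, by show m + 2 - 2 + 2 = m + 2; omega⟩
  have e1 := h (a ++ [cup (j + 1)]) (shift (2 + j) S ++ cap (j + 1) :: b) j (m + 2) c0 (by omega)
    ((hS.shift_two (by omega)).append hcap)
  have e2 := h' _ _ (2 + j) (m + 2) c1 (by omega) hcap
  have e3 := h' _ _ (2 + j) (m + 2) c0 (by omega) hcap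
  have t1 : TrEq [cup (j + 1), cap j, cup j, cap (2 + j), cup (2 + j), cap (j + 1)]
      [cap j, cup j] := by
    rw [add_comm 2 j]
    refine TrEq.trans (by
      simpa using (trEq_zigzag_right j).congr []
        [cup j, cap (j + 2), cup (j + 2), cap (j + 1)]) ?_
    refine TrEq.trans (by
      simpa using (trEq_comm_cup_cap (le_refl j)).congr [] [cup (j + 2), cap (j + 1)]) ?_
    simpa using (trEq_zigzag_right (j + 1)).congr [cap j, cup j] []
  have t2 : TrEq [cup (j + 1), cap j, cup j, cap (j + 1)] [] :=
    TrEq.trans (by simpa using (trEq_zigzag_right j).congr [] [cup j, cap (j + 1)])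
      (trEq_zigzag_left j)
  have t3 : TrEq [cup (j + 1), cap (2 + j), cup (2 + j), cap (j + 1)] [] := by
    rw [add_comm 2 j]
    exact TrEq.trans (by
      simpa using (trEq_zigzag_left (j + 1)).congr [] [cup (j + 2), cap (j + 1)])
      (trEq_zigzag_right (j + 1))
  have k1 := kb_of_flat (c := 1) (by simp [IsFlat]) (by simp [IsFlat]) ha hb fun p q _ _ =>
    (weight_of_trEq t1 p q).trans (one_mul _).symm
  have k2 := kb_of_flat (c := 1) (by simp [IsFlat]) (by simp [IsFlat]) ha hb fun p q _ _ =>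
    (weight_of_trEq t2 p q).trans (one_mul _).symm
  have k3 := kb_of_flat (c := 1) (by simp [IsFlat]) (by simp [IsFlat]) ha hb fun p q _ _ =>
    (weight_of_trEq t3 p q).trans (one_mul _).symm
  have k4 := kb_of_flat (l := [cup (j + 1), cap (j + 1)]) (r := []) (c := 0) (by simp [IsFlat])
    (by simp [IsFlat]) ha hb fun p q hp hq => by
      rw [weight_loop (by simpa using hp.append hq), zero_mul]
      rintro hn
      rw [List.append_eq_nil_iff] at hn
      rw [hn.1] at hp
      have : 0 = m := hp
      omega
  have e0 : a ++ shift j (Knot.tangleSum T S) ++ b =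
      a ++ [cup (j + 1)] ++ shift j T ++ (shift (2 + j) S ++ cap (j + 1) :: b) := by
    rw [← shift_shift j 2]
    simp [Knot.tangleSum, shift, Layer.shift, add_comm]
  rw [e0, e1]
  simp only [List.append_assoc, List.cons_append, List.nil_append, List.append_nil] at *
  rw [e2, e3, k1, k2, k3, k4]
  ring

theorem Expands.tangleProd {T S : Word} {f g f' g' : ℂ} (h : Expands T f g)
    (h' : Expands S f' g') (hT : IsTangle 2 2 T) :
    Expands (tangleProd T S) (f * g' + g * f') (g * g') := by
  intro a b j m ha hj hb
  have c1 : IsTangle 0 m (a ++ [cap j, cup j]) :=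
    ha.append ⟨by omega, by omega, by show m - 2 + 2 = m; omega⟩
  have e1 := h' a (shift j T ++ b) j m ha (by omega) ((hT.shift_two (by omega)).append hb)
  have e2 := h _ _ j m c1 (by omega) hb
  have e3 := h _ _ j m ha (by omega) hb
  have k4 := kb_of_flat (l := [cap j, cup j, cap j, cup j]) (r := []) (c := 0) (by simp [IsFlat])
    (by simp [IsFlat]) ha hb fun p q hp hq => by
      have := weight_loop (a := p ++ [cap j]) (b := [cup j] ++ q) (by
        have h3 : IsTangle m m [cap j, cup j] :=
          ⟨by omega, by omega, by show m - 2 + 2 = m; omega⟩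
        simpa using (hp.append h3).append hq) (by simp) j
      rw [zero_mul, ← this]
      simp
  have e0 : a ++ shift j (Knot.tangleProd T S) ++ b = a ++ shift j S ++ (shift j T ++ b) := by
    simp [Knot.tangleProd, shift]
  rw [e0, e1]
  simp only [List.append_assoc, List.cons_append, List.nil_append, List.append_nil] at *
  rw [e2, e3, k4]
  ring

/-! ### Fractions -/

/-- Up to a phase, the bracket of `T` is `Q` times the tangle `0` plus `i P` times the tangle
`∞`. -/
def HasFraction (T : Word) (P Q : ℝ) : Prop :=
  IsTangle 2 2 T ∧ ∃ u : ℂ, ‖u‖ = 1 ∧ Expands T (u * Q) (u * Complex.I * P)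

/-- Since `A² = i`, the two coefficients of a crossing have the ratio `i` or `-i`. This is the
reason for the factor `i` in `HasFraction`: it makes the fraction of a crossing real. -/
theorem rootA_zpow_sgn (s : Bool) :
    rootA ^ sgn s = rootA ^ (-sgn s) * Complex.I * ((sgn s : ℝ) : ℂ) := by
  have h := rootA_sq
  have h0 := rootA_ne_zero
  cases s
  · simp only [sgn, Bool.false_eq_true, if_false, neg_neg, zpow_one, zpow_neg_one, rootA_inv]
    push_cast
    ring
  · simp only [sgn, if_true, zpow_one, zpow_neg_one, rootA_inv]
    push_cast
    linear_combination rootA * Complex.I_sq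

theorem hasFraction_one (s : Bool) : HasFraction (oneTangle s) (sgn s) 1 := by
  refine ⟨⟨le_rfl, rfl⟩, rootA ^ (-sgn s), norm_rootA_zpow _, ?_⟩
  have := expands_one s
  rw [rootA_zpow_sgn] at this
  simpa using this

theorem HasFraction.tangleSum {T S : Word} {P Q P' Q' : ℝ} (h : HasFraction T P Q)
    (h' : HasFraction S P' Q') : HasFraction (tangleSum T S) (P * Q' + P' * Q) (Q * Q') := by
  obtain ⟨hT, u, hu, he⟩ := h
  obtain ⟨hS, v, hv, he'⟩ := h'
  refine ⟨isTangle_tangleSum hT hS, u * v, by rw [norm_mul, hu, hv, one_mul], ?_⟩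
  convert he.tangleSum he' hS using 1 <;> push_cast <;> ring

theorem HasFraction.tangleProd {T S : Word} {P Q P' Q' : ℝ} (h : HasFraction T P Q)
    (h' : HasFraction S P' Q') : HasFraction (tangleProd T S) (P * P') (P * Q' + P' * Q) := by
  obtain ⟨hT, u, hu, he⟩ := h
  obtain ⟨hS, v, hv, he'⟩ := h'
  -- The coefficient of `∞` is a product of two coefficients that each contain `i`, so one `i`
  -- passes into the phase.
  refine ⟨isTangle_tangleProd hT hS, u * v * Complex.I, by simp [hu, hv], ?_⟩
  convert he.tangleProd he' hT using 1 <;> push_cast <;> ring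

theorem isLinkDiagram_numerator {T : Word} (h : IsTangle 2 2 T) : IsLinkDiagram (numerator T) := by
  have h1 : IsTangle 0 2 [cup 0] := ⟨le_rfl, rfl⟩
  have h2 : IsTangle 2 0 [cap 0] := ⟨by omega, rfl⟩
  exact (h1.append h).append h2

theorem isLinkDiagram_denominator {T : Word} (h : IsTangle 2 2 T) :
    IsLinkDiagram (denominator T) := by
  have h1 : IsTangle 0 4 [cup 0, cup 2] := ⟨le_rfl, by omega, rfl⟩
  have h2 : IsTangle 4 0 [cap 0, cap 0] := ⟨by omega, by omega, rfl⟩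
  exact (h1.append (h.shift_two (by omega))).append h2

theorem HasFraction.determinant_numerator {T : Word} {P Q : ℝ} (h : HasFraction T P Q) :
    determinant (numerator T) = |P| := by
  obtain ⟨hT, u, hu, he⟩ := h
  rw [determinant_eq (isLinkDiagram_numerator hT), he.numerator]
  simp [hu]

/-! ### Fractions of alternating tangles -/

/-- Complex numbers whose norms add up have a common phase. -/
theorem exists_phase {x y : ℂ} (h : ‖x + y‖ = ‖x‖ + ‖y‖) :
    ∃ u : ℂ, ‖u‖ = 1 ∧ x = u * ‖x‖ ∧ y = u * ‖y‖ := by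
  by_cases hx : x = 0
  · by_cases hy : y = 0
    · exact ⟨1, by simp, by simp [hx], by simp [hy]⟩
    · have : (‖y‖ : ℂ) ≠ 0 := by simpa using hy
      exact ⟨y / ‖y‖, by simp [hy], by simp [hx], by field_simp⟩
  · have hx' : (‖x‖ : ℂ) ≠ 0 := by simpa using hx
    refine ⟨x / ‖x‖, by simp [hx], by field_simp, ?_⟩
    have := sameRay_iff_norm_smul_eq.1 (sameRay_iff_norm_add.2 h)
    simp only [Complex.real_smul] at this
    field_simp
    linear_combination this

theorem AltRun.shift {w : Word} {x y : List Bool} (h : AltRun w x y) (p : List Bool)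
    : AltRun (shift p.length w) (p ++ x) (p ++ y) := by
  induction w generalizing x with
  | nil => cases h; rfl
  | cons l w ih =>
    cases l with
    | cup i =>
      obtain ⟨b, hb⟩ := h
      refine ⟨b, ?_⟩
      have := ih hb
      rw [add_comm i, List.take_length_add_append, List.drop_length_add_append]
      simpa [Knot.shift] using this
    | cap i =>
      obtain ⟨⟨b, h1, h2⟩, h3⟩ := h
      refine ⟨⟨b, ?_, ?_⟩, ?_⟩
      · rw [add_comm i, List.getElem?_append_right (by omega)]; simpa using h1
      · rw [add_comm i, List.getElem?_append_right (by omega), add_assoc]; simpa using h2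
      · have := ih h3
        rw [add_comm i, add_assoc, List.take_length_add_append, List.drop_length_add_append]
        simpa [Knot.shift] using this
    | cross s i =>
      obtain ⟨h1, h2, h3⟩ := h
      refine ⟨?_, ?_, ih h3⟩
      · rw [add_comm i, List.getElem?_append_right (by omega)]; simpa using h1
      · rw [add_comm i, List.getElem?_append_right (by omega), add_assoc]; simpa using h2

theorem isAlternating_numerator_one_add {T : Word} (h : IsAlternatingTangle T) :
    IsAlternating (numerator (tangleSum (oneTangle true) T)) := by
  have h2 := AltRun.shift h [false, true]
  have e : numerator (tangleSum (oneTangle true) T) =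
      [cup 0, cup 1, cross true 0] ++ (shift 2 T ++ [cap 1, cap 0]) := by
    simp [numerator, tangleSum, oneTangle]
  rw [IsAlternating, e]
  exact altRun_append.2 ⟨_, ⟨false, true, rfl, rfl, rfl⟩,
    altRun_append.2 ⟨_, h2, ⟨true, rfl, rfl⟩, ⟨false, rfl, rfl⟩, rfl⟩⟩

/-- The closure of `1 + T` is alternating, and smoothing its first crossing gives the two closures
of `T`. Additivity of determinants says that `|A f + A⁻¹ g| = |f| + |g|`, so `A f` and `A⁻¹ g` have
the same phase. With `A² = i` this means that `g` is `i` times a non-negative multiple of the phase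
of `f`. -/
theorem hasFraction_of_isAlternatingTangle {T : Word} (hT : IsTangle 2 2 T)
    (h : IsAlternatingTangle T) :
    HasFraction T (determinant (numerator T)) (determinant (denominator T)) := by
  obtain ⟨f, g, he⟩ := exists_expands hT
  have hl := isLinkDiagram_numerator
    (isTangle_tangleSum (show IsTangle 2 2 (oneTangle true) from ⟨le_rfl, rfl⟩) hT)
  have ha := isAlternating_numerator_one_add h
  have e0 : numerator (tangleSum (oneTangle true) T) =
      [cup 0, cup 1] ++ cross true 0 :: (shift 2 T ++ [cap 1, cap 0]) := by
    simp [numerator, tangleSum, oneTangle]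
  rw [e0] at hl ha
  have hs := determinant_skein hl ha
  rw [determinant_eq hl, determinant_eq hl.smoothInfty, determinant_eq hl.smoothZero, kb_skein] at hs
  have e1 := he [cup 0, cup 1] [cap 1, cap 0] 2 4 ⟨le_rfl, by omega, rfl⟩ le_rfl
    ⟨by omega, le_rfl, rfl⟩
  have e2 := he [cup 0, cup 1, cap 0, cup 0] [cap 1, cap 0] 2 4
    ⟨le_rfl, by omega, by omega, by omega, rfl⟩ le_rfl ⟨by omega, le_rfl, rfl⟩
  have w1 : kb ([cup 0, cup 1] ++ [cap 2, cup 2] ++ [cap 1, cap 0]) = 1 := by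
    rw [kb_flat (by simp [IsFlat]), weight, if_pos (by decide)]
  have w2 : kb ([cup 0, cup 1] ++ [cap 1, cap 0]) = 0 := by
    rw [kb_flat (by simp [IsFlat]), weight, if_neg (by decide)]
  have w3 : kb ([cup 0, cup 1, cap 0, cup 0] ++ [cap 2, cup 2] ++ [cap 1, cap 0]) = 0 := by
    rw [kb_flat (by simp [IsFlat]), weight, if_neg (by decide)]
  have w4 : kb ([cup 0, cup 1, cap 0, cup 0] ++ [cap 1, cap 0]) = 1 := by
    rw [kb_flat (by simp [IsFlat]), weight, if_pos (by decide)]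
  rw [w1, w2] at e1
  rw [w3, w4] at e2
  simp only [List.cons_append, List.nil_append] at e1 e2 hs
  rw [e1, e2] at hs
  simp only [mul_one, mul_zero, add_zero, zero_add] at hs
  have n1 : ‖rootA ^ sgn true * f‖ = ‖f‖ := by rw [norm_mul, norm_rootA_zpow, one_mul]
  have n2 : ‖rootA ^ (-sgn true) * g‖ = ‖g‖ := by rw [norm_mul, norm_rootA_zpow, one_mul]
  obtain ⟨u, hu, h1, h2⟩ := exists_phase (hs.trans (by rw [n1, n2]))
  rw [n1] at h1
  rw [n2] at h2
  rw [determinant_eq (isLinkDiagram_numerator hT), determinant_eq (isLinkDiagram_denominator hT),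
    he.numerator, he.denominator]
  refine ⟨hT, u * rootA⁻¹, by rw [norm_mul, hu, norm_inv, norm_rootA]; norm_num, ?_⟩
  have hA := rootA_ne_zero
  simp only [sgn, if_true, zpow_one, zpow_neg_one] at h1 h2
  have e3 : u * rootA⁻¹ * ‖f‖ = f := by
    rw [mul_right_comm, ← h1]; field_simp
  have e4 : u * rootA⁻¹ * Complex.I * ‖g‖ = g := by
    have : u * rootA⁻¹ * Complex.I * ‖g‖ = rootA⁻¹ * Complex.I * (u * ‖g‖) := by ring
    rw [this, ← h2, ← rootA_sq]; field_simp
  rwa [e3, e4]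


/-! ### Fractions of rational tangles -/

theorem HasFraction.of_mul {T : Word} {P Q c : ℝ} (hc : |c| = 1)
    (h : HasFraction T (c * P) (c * Q)) : HasFraction T P Q := by
  obtain ⟨hT, u, hu, he⟩ := h
  refine ⟨hT, u * c, by simp [hu, hc], ?_⟩
  convert he using 1 <;> push_cast <;> ring

theorem abs_sgn (s : Bool) : |(sgn s : ℝ)| = 1 := by cases s <;> simp [sgn]

theorem sgn_mul_sgn (s : Bool) : (sgn s : ℝ) * sgn s = 1 := by cases s <;> simp [sgn]

theorem crossings_tangleSum (T S : Word) :
    crossings (tangleSum T S) = crossings T + crossings S := by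
  simp [tangleSum, crossings_append, crossings_shift, crossings]

theorem crossings_tangleProd (T S : Word) :
    crossings (tangleProd T S) = crossings T + crossings S := by
  simp [tangleProd, crossings_append, add_comm]

theorem crossings_one (s : Bool) : crossings (oneTangle s) = 1 := rfl

theorem HasFraction.add_one {s : Bool} {t : Word} {p q : ℕ} (h : HasFraction t (sgn s * p) q) :
    HasFraction (Knot.tangleSum t (oneTangle s)) (sgn s * (p + q : ℕ)) q ∧
      HasFraction (Knot.tangleSum (oneTangle s) t) (sgn s * (p + q : ℕ)) q := by
  constructor
  · convert h.tangleSum (hasFraction_one s) using 1 <;> push_cast <;> ring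
  · convert (hasFraction_one s).tangleSum h using 1 <;> push_cast <;> ring

theorem HasFraction.mul_one {s : Bool} {t : Word} {p q : ℕ} (h : HasFraction t (sgn s * p) q) :
    HasFraction (Knot.tangleProd t (oneTangle s)) (sgn s * p) (p + q : ℕ) ∧
      HasFraction (Knot.tangleProd (oneTangle s) t) (sgn s * p) (p + q : ℕ) := by
  constructor
  · refine HasFraction.of_mul (abs_sgn s) ?_
    convert h.tangleProd (hasFraction_one s) using 1 <;> (push_cast; ring)
  · refine HasFraction.of_mul (abs_sgn s) ?_
    convert (hasFraction_one s).tangleProd h using 1 <;> (push_cast; ring)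

/-- The fraction of a rational tangle diagram in lowest terms bounds the number of crossings. -/
theorem IsRational.exists_fraction {s : Bool} {t : Word} {x : ℚ} (h : IsRational s t x) :
    ∃ p q : ℕ, 0 < p ∧ 0 < q ∧ p.Coprime q ∧ x = p / q ∧ HasFraction t (sgn s * p) q ∧
      crossings t ≤ max p q ∧ (p = 1 → t = List.replicate q (cross s 0)) := by
  have hx (p q : ℕ) (hp : 0 < p) (hq : 0 < q) :
      1 / (1 / ((p : ℚ) / q) + 1) = p / (p + q : ℕ) := by
    have : (0 : ℚ) < p := by exact_mod_cast hp
    have : (0 : ℚ) < q := by exact_mod_cast hq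
    push_cast
    field_simp
    ring
  have hx' (p q : ℕ) (hq : 0 < q) : (p : ℚ) / q + 1 = (p + q : ℕ) / q := by
    have : (0 : ℚ) < q := by exact_mod_cast hq
    push_cast
    field_simp
  induction h with
  | one => exact ⟨1, 1, one_pos, one_pos, by simp, by simp, by simpa using hasFraction_one s,
      by simp [crossings_one], fun _ => rfl⟩
  | right _ ih =>
    obtain ⟨p, q, hp, hq, hpq, rfl, hf, hc, -⟩ := ih
    refine ⟨p + q, q, by omega, hq, by simpa using hpq, hx' p q hq, hf.add_one.1, ?_, by omega⟩
    rw [crossings_tangleSum, crossings_one]; omega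
  | left _ ih =>
    obtain ⟨p, q, hp, hq, hpq, rfl, hf, hc, -⟩ := ih
    refine ⟨p + q, q, by omega, hq, by simpa using hpq, hx' p q hq, hf.add_one.2, ?_, by omega⟩
    rw [crossings_tangleSum, crossings_one]; omega
  | bottom _ ih =>
    obtain ⟨p, q, hp, hq, hpq, rfl, hf, hc, h1⟩ := ih
    refine ⟨p, p + q, hp, by omega, by simpa using hpq, hx p q hp hq, hf.mul_one.1, ?_, ?_⟩
    · rw [crossings_tangleProd, crossings_one]; omega
    · rintro rfl
      rw [h1 rfl, add_comm, List.replicate_succ]; rfl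
  | top _ ih =>
    obtain ⟨p, q, hp, hq, hpq, rfl, hf, hc, h1⟩ := ih
    refine ⟨p, p + q, hp, by omega, by simpa using hpq, hx p q hp hq, hf.mul_one.2, ?_, ?_⟩
    · rw [crossings_tangleProd, crossings_one]; omega
    · rintro rfl
      rw [h1 rfl, add_comm, List.replicate_succ']; rfl

/-! ### Reduced connected alternating diagrams -/

theorem MarkedDiagram.diagram_eq (M : MarkedDiagram) :
    M.diagram = M.pre ++ cross M.sign M.pos :: M.post := by
  simp [MarkedDiagram.diagram, MarkedDiagram.replace, shift, oneTangle, Layer.shift]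

theorem MarkedDiagram.smoothZero_eq (M : MarkedDiagram) :
    M.smoothZero = M.pre ++ cap M.pos :: cup M.pos :: M.post := by
  simp [MarkedDiagram.smoothZero, MarkedDiagram.replace, shift, zeroTangle, Layer.shift]

theorem MarkedDiagram.smoothInfty_eq (M : MarkedDiagram) :
    M.smoothInfty = M.pre ++ M.post := by
  simp [MarkedDiagram.smoothInfty, MarkedDiagram.replace, shift, inftyTangle]

/-- The natural number that is the determinant of a reduced connected alternating diagram is at
least the number of crossings. -/
theorem exists_determinant_eq {w : Word} (hw : IsLinkDiagram w) (ha : IsAlternating w)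
    (hc : IsConnectedDiagram w) (hr : IsReduced 0 w) :
    ∃ d : ℕ, determinant w = d ∧ crossings w ≤ d ∧ 1 ≤ d := by
  have h2 : colorings w ≤ 2 := (hc.colorings hw).le
  refine ⟨treeCount w, determinant_eq_treeCount hw ha, ?_, one_le_treeCount hw h2⟩
  refine crossings_le_treeCount hw h2 ?_
  rintro a s i b rfl
  have h := hr ⟨a, s, i, b⟩ (MarkedDiagram.diagram_eq _)
  rw [IsConnectedDiagram] at hc
  rw [hc, MarkedDiagram.smoothZero_eq, MarkedDiagram.smoothInfty_eq,
    floating_le_one_iff hw.smoothZero, floating_le_one_iff hw.smoothInfty] at h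
  exact h.symm

/-! ### Almost alternating diagrams -/

namespace MarkedDiagram

/-- Changing the dealternator gives an alternating diagram, for which determinants add; as in the
case of alternating tangles this fixes the relative phase of the brackets of the two smoothings.
Crossings of the original sign have the opposite ratio of coefficients, so the sum becomes a
difference. -/
theorem determinant_replace {M : MarkedDiagram} (hM : IsLinkDiagram M.diagram)
    (h : M.IsDealternator) {t : Word} {P Q : ℝ} (ht : HasFraction t (sgn M.sign * P) Q) :
    determinant (M.replace t) =
      |Q * determinant M.smoothZero - P * determinant M.smoothInfty| := by
  rw [diagram_eq] at hM
  obtain ⟨m, h1, h2, h3⟩ := isTangle_append.1 hM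
  have ha : IsAlternating (M.pre ++ cross (!M.sign) M.pos :: M.post) := by
    have := h
    simpa [IsDealternator, replace, shift, oneTangle, Layer.shift] using this
  have hM' : IsLinkDiagram (M.pre ++ cross (!M.sign) M.pos :: M.post) := h1.append ⟨h2, h3⟩
  obtain ⟨hT, u, hu, he⟩ := ht
  have hl : IsLinkDiagram (M.replace t) := (h1.append (hT.shift_two h2)).append h3
  have hs := determinant_skein hM' ha
  rw [determinant_eq hM', determinant_eq hM.smoothInfty, determinant_eq hM.smoothZero,
    kb_skein] at hs
  rw [determinant_eq hl, smoothZero_eq, smoothInfty_eq, determinant_eq hM.smoothInfty,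
    determinant_eq hM.smoothZero]
  have e := he _ _ _ _ h1 h2 h3
  simp only [List.append_assoc, List.cons_append, List.nil_append] at e
  rw [replace, List.append_assoc, e]
  set x := kb (M.pre ++ M.post)
  set y := kb (M.pre ++ cap M.pos :: cup M.pos :: M.post)
  have n1 : ‖rootA ^ sgn (!M.sign) * x‖ = ‖x‖ := by rw [norm_mul, norm_rootA_zpow, one_mul]
  have n2 : ‖rootA ^ (-sgn (!M.sign)) * y‖ = ‖y‖ := by rw [norm_mul, norm_rootA_zpow, one_mul]
  obtain ⟨v, hv, e1, e2⟩ := exists_phase (hs.trans (by rw [n1, n2]))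
  rw [n1] at e1
  rw [n2] at e2
  have hA := rootA_ne_zero
  have hsg : sgn (!M.sign) = -sgn M.sign := by cases M.sign <;> rfl
  rw [hsg] at e1 e2
  have e1' : x = rootA ^ sgn M.sign * (v * ‖x‖) := by
    rw [← e1, ← mul_assoc, ← zpow_add₀ hA]; simp
  have e2' : y = rootA ^ (-sgn M.sign) * (v * ‖y‖) := by
    rw [← e2, ← mul_assoc, ← zpow_add₀ hA]; simp
  have key : u * Q * y + u * Complex.I * (sgn M.sign * P : ℝ) * x =
      u * v * rootA ^ (-sgn M.sign) * ((Q * ‖y‖ - P * ‖x‖ : ℝ) : ℂ) := by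
    have hss : ((sgn M.sign : ℝ) : ℂ) * ((sgn M.sign : ℝ) : ℂ) = 1 := by
      rw [← Complex.ofReal_mul, sgn_mul_sgn, Complex.ofReal_one]
    rw [rootA_zpow_sgn] at e1'
    nth_rewrite 1 [e1']
    nth_rewrite 1 [e2']
    push_cast at hss ⊢
    linear_combination (u * v * rootA ^ (-sgn M.sign) * P * ‖x‖) *
      (Complex.I_sq * ((sgn M.sign : ℂ) * sgn M.sign) - hss)
  rw [key]
  simp only [norm_mul, hu, hv, norm_rootA_zpow, one_mul, Complex.norm_real, Real.norm_eq_abs]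

/-- Rational extensions at a crossing of `1/2` or `2` replace the crossing by a rational tangle. -/
theorem exists_isRational_half {M N : MarkedDiagram} (hN : M.MarksCrossingOf (halfTangle M.sign) N)
    {E : Word} (hE : N.IsRationalExtension E) :
    ∃ (t : Word) (x : ℚ), 0 < x ∧ x < 1 ∧ IsRational M.sign t x ∧ E = M.replace t := by
  obtain ⟨u, v, s, j, h, rfl⟩ := hN
  obtain ⟨t, q, ht, rfl⟩ := hE
  have hq : 0 < q := by
    obtain ⟨p, q, hp, hq, -, rfl, -⟩ := ht.exists_fraction
    positivity
  have h1 : 1 / (1 / q + 1) < 1 := by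
    rw [div_lt_one (by positivity)]
    linarith [show 0 < 1 / q by positivity]
  have h0 : 0 < 1 / (1 / q + 1) := by positivity
  match u, v, h with
  | [], [c], h =>
    simp only [halfTangle, tangleProd, oneTangle, List.cons_append, List.nil_append,
      List.cons.injEq, cross.injEq, and_true] at h
    obtain ⟨⟨rfl, rfl⟩, rfl⟩ := h
    refine ⟨_, _, h0, h1, ht.top, ?_⟩
    simp [replace, shift, tangleProd, oneTangle]
  | [c], [], h =>
    simp only [halfTangle, tangleProd, oneTangle, List.cons_append, List.nil_append,
      List.cons.injEq, cross.injEq, and_true] at h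
    obtain ⟨rfl, rfl, rfl⟩ := h
    refine ⟨_, _, h0, h1, ht.bottom, ?_⟩
    simp [replace, shift, tangleProd, oneTangle]
  | [], [], h => simp [halfTangle, tangleProd, oneTangle] at h
  | [], _ :: _ :: _, h => simp [halfTangle, tangleProd, oneTangle] at h
  | [_], _ :: _, h => simp [halfTangle, tangleProd, oneTangle] at h
  | _ :: _ :: _, _, h => simp [halfTangle, tangleProd, oneTangle] at h

theorem exists_isRational_two {M N : MarkedDiagram} (hN : M.MarksCrossingOf (twoTangle M.sign) N)
    {E : Word} (hE : N.IsRationalExtension E) :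
    ∃ (t : Word) (x : ℚ), 1 < x ∧ IsRational M.sign t x ∧ E = M.replace t := by
  obtain ⟨u, v, s, j, h, rfl⟩ := hN
  obtain ⟨t, q, ht, rfl⟩ := hE
  have hq : 0 < q := by
    obtain ⟨p, q, hp, hq, -, rfl, -⟩ := ht.exists_fraction
    positivity
  have e : twoTangle M.sign = [cup 1, cross M.sign 0, cross M.sign 2, cap 1] := rfl
  rw [e] at h
  match u, v, h with
  | [a], [b, c], h =>
    simp only [List.cons_append, List.nil_append, List.cons.injEq, cross.injEq, and_true] at h
    obtain ⟨rfl, ⟨rfl, rfl⟩, rfl, rfl⟩ := h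
    refine ⟨_, _, by linarith, ht.right, ?_⟩
    simp [replace, shift, tangleSum, oneTangle, Layer.shift]
  | [a, b], [c], h =>
    simp only [List.cons_append, List.nil_append, List.cons.injEq, cross.injEq, and_true] at h
    obtain ⟨rfl, rfl, ⟨rfl, rfl⟩, rfl⟩ := h
    refine ⟨_, _, by linarith, ht.left, ?_⟩
    have e : M.replace (tangleSum (oneTangle M.sign) t) = M.pre ++ (cup (1 + M.pos) ::
        cross M.sign (0 + M.pos) :: shift M.pos (shift 2 t) ++ [cap (1 + M.pos)]) ++ M.post := by
      simp [replace, shift, tangleSum, oneTangle, Layer.shift]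
    rw [e, shift_shift]
    simp [replace, shift, Layer.shift]
  | [], _, h => simp at h
  | [_], [], h => simp at h
  | [_], [_], h => simp at h
  | [_], _ :: _ :: _ :: _, h => simp at h
  | [_, _], [], h => simp at h
  | [_, _], _ :: _ :: _, h => simp at h
  | [_, _, _], _, h => simp at h
  | _ :: _ :: _ :: _ :: _, _, h => simp at h

theorem crossings_replace (M : MarkedDiagram) (t : Word) :
    crossings (M.replace t) = crossings M.pre + crossings t + crossings M.post := by
  simp [replace, crossings_append, crossings_shift, add_assoc]

/-- Both smoothings are reduced, connected and alternating, so their determinants `a` and `b` are at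
least the number of crossings other than the dealternator. An extension inserts a tangle of absolute
fraction `p/q` with at most `max p q` crossings, and the marked `1/2` or `2` ensures that `q - p`
has the same sign as `a - b`. The two terms of `(q - p)b + q(a - b)` then bound the two kinds of
crossings, or `(p - q)a + p(b - a)` in the opposite case. -/
theorem crossings_le_determinant_of_rationalExtension {M : MarkedDiagram}
    (hM : IsLinkDiagram M.diagram) (h : M.IsDealternator) (hr : M.IsDealternatorReduced)
    (hc : M.IsDealternatorConnected) (hq : IsQuasiAlternating M.diagram) :
    determinant M.smoothZero ≠ determinant M.smoothInfty ∧
      (determinant M.smoothInfty < determinant M.smoothZero →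
        ∀ N : MarkedDiagram, M.MarksCrossingOf (halfTangle M.sign) N →
          ∀ E : Word, N.IsRationalExtension E → (crossings E : ℝ) ≤ determinant E) ∧
      (determinant M.smoothZero < determinant M.smoothInfty →
        ∀ N : MarkedDiagram, M.MarksCrossingOf (twoTangle M.sign) N →
          ∀ E : Word, N.IsRationalExtension E → (crossings E : ℝ) ≤ determinant E) := by
  have hM' := hM
  rw [diagram_eq] at hM'
  obtain ⟨a, ha, ha1, -⟩ := exists_determinant_eq (by rw [smoothZero_eq]; exact hM'.smoothZero)
    hr.1.1 hc.1.2 hr.1.2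
  obtain ⟨b, hb, hb1, -⟩ := exists_determinant_eq (by rw [smoothInfty_eq]; exact hM'.smoothInfty)
    hr.2.1 hc.2.2 hr.2.2
  have hca : crossings M.smoothZero = crossings M.pre + crossings M.post := by
    simp [smoothZero, crossings_replace, zeroTangle, crossings]
  have hcb : crossings M.smoothInfty = crossings M.pre + crossings M.post := by
    simp [smoothInfty, crossings_replace, inftyTangle, crossings]
  rw [hca] at ha1
  rw [hcb] at hb1
  have hdet {t : Word} {p q : ℕ} (ht : HasFraction t (sgn M.sign * p) q) :
      determinant (M.replace t) = |(q : ℝ) * a - p * b| := by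
    rw [determinant_replace hM h ht, ha, hb]
  rw [ha, hb]
  refine ⟨?_, ?_, ?_⟩
  -- The dealternator itself has fraction one up to sign, so the determinant of the given diagram is
  -- `|a - b|`.
  · have h1 := hdet (p := 1) (q := 1) (by simpa using hasFraction_one M.sign)
    have h2 := hq.determinant_pos
    rw [diagram, h1] at h2
    intro e
    rw [e] at h2
    simp at h2
  · intro hab N hN E hE
    obtain ⟨t, x, hx0, hx1, ht, rfl⟩ := exists_isRational_half hN hE
    obtain ⟨p, q, hp, hq, -, rfl, hf, hct, -⟩ := ht.exists_fraction
    rw [hdet hf, crossings_replace]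
    have hpq : p < q := by
      rw [div_lt_one (by positivity)] at hx1
      exact_mod_cast hx1
    refine le_trans ?_ (le_abs_self _)
    have hab' : b < a := by exact_mod_cast hab
    have : crossings M.pre + crossings t + crossings M.post + p * b ≤ q * a := by
      have h1 : crossings t ≤ q := by omega
      obtain ⟨a, rfl⟩ := Nat.exists_eq_add_of_lt hab'
      obtain ⟨q, rfl⟩ := Nat.exists_eq_add_of_lt hpq
      nlinarith
    have : ((crossings M.pre + crossings t + crossings M.post + p * b : ℕ) : ℝ) ≤ (q * a : ℕ) := by
      exact_mod_cast this
    push_cast at this ⊢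
    linarith
  · intro hab N hN E hE
    obtain ⟨t, x, hx1, ht, rfl⟩ := exists_isRational_two hN hE
    obtain ⟨p, q, hp, hq, -, rfl, hf, hct, -⟩ := ht.exists_fraction
    rw [hdet hf, crossings_replace]
    have hpq : q < p := by
      rw [one_lt_div (by positivity)] at hx1
      exact_mod_cast hx1
    refine le_trans ?_ (neg_le_abs _)
    have hab' : a < b := by exact_mod_cast hab
    have : crossings M.pre + crossings t + crossings M.post + q * a ≤ p * b := by
      have h1 : crossings t ≤ p := by omega
      obtain ⟨b, rfl⟩ := Nat.exists_eq_add_of_lt hab'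
      obtain ⟨p, rfl⟩ := Nat.exists_eq_add_of_lt hpq
      nlinarith
    have : ((crossings M.pre + crossings t + crossings M.post + q * a : ℕ) : ℝ) ≤ (p * b : ℕ) := by
      exact_mod_cast this
    push_cast at this ⊢
    linarith

end MarkedDiagram


/-! ### Isotopies -/

theorem Isotopic.refl (m n : ℕ) (w : Word) : Isotopic m n w w := Relation.EqvGen.refl w

theorem Isotopic.trans {m n : ℕ} {u v w : Word} (h : Isotopic m n u v) (h' : Isotopic m n v w) :
    Isotopic m n u w := Relation.EqvGen.trans _ _ _ h h'

theorem Isotopic.symm {m n : ℕ} {u v : Word} (h : Isotopic m n u v) : Isotopic m n v u :=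
  Relation.EqvGen.symm _ _ h

theorem Isotopic.congr {m n p q : ℕ} {u v : Word} (h : Isotopic p q u v) {a b : Word}
    (ha : IsTangle m p a) (hb : IsTangle q n b) : Isotopic m n (a ++ u ++ b) (a ++ v ++ b) := by
  induction h with
  | rel u v h =>
    obtain ⟨hu, hv, c, d, l, r, hlr, rfl, rfl⟩ := h
    exact Relation.EqvGen.rel _ _ ⟨(ha.append hu).append hb, (ha.append hv).append hb, a ++ c,
      d ++ b, l, r, hlr, by simp, by simp⟩
  | refl u => exact .refl _ _ _
  | symm u v _ ih => exact ih.symm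
  | trans u v w _ _ ih ih' => exact ih.trans ih'

theorem Isotopic.append_left {m n p : ℕ} {u v : Word} (h : Isotopic p n u v) {a : Word}
    (ha : IsTangle m p a) : Isotopic m n (a ++ u) (a ++ v) := by
  simpa using h.congr ha (b := []) rfl

theorem Isotopic.append_right {m n q : ℕ} {u v : Word} (h : Isotopic m q u v) {b : Word}
    (hb : IsTangle q n b) : Isotopic m n (u ++ b) (v ++ b) := by
  simpa using h.congr (a := []) rfl hb

theorem PlanarMove.isotopic {m n : ℕ} {u v : Word} (h : PlanarMove u v) (hu : IsTangle m n u)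
    (hv : IsTangle m n v) : Isotopic m n u v :=
  Relation.EqvGen.rel _ _ ⟨hu, hv, [], [], u, v, Or.inl h, by simp, by simp⟩

theorem ReidemeisterMove.isotopic {m n : ℕ} {u v : Word} (h : ReidemeisterMove u v)
    (hu : IsTangle m n u) (hv : IsTangle m n v) : Isotopic m n u v :=
  Relation.EqvGen.rel _ _ ⟨hu, hv, [], [], u, v, Or.inr h, by simp, by simp⟩

theorem crossingNumber_le {D D' : Word} (h : Isotopic 0 0 D D') :
    crossingNumber D ≤ crossings D' := Nat.sInf_le ⟨D', h, rfl⟩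

/-- The maximum passes the layers one at a time. It removes two strands to their left, which
accounts for the change of the shift by two. -/
theorem isotopic_cap_comm {p n : ℕ} {w : Word} (hw : IsTangle p n w) {i k : ℕ} (hi : i ≤ k) :
    Isotopic (p + k + 2) (n + k) (shift (k + 2) w ++ [cap i]) (cap i :: shift k w) := by
  induction w generalizing p with
  | nil => exact .refl _ _ _
  | cons l w ih =>
    have hm : PlanarMove [cap i, l.shift k] [l.shift (k + 2), cap i] := by
      have := PlanarMove.comm (cap i) (l.shift k) (by
        cases l <;> simp only [Layer.pos, Layer.shift] <;> omega)
      cases l <;> simpa [Layer.shift, arityIn, arityOut, add_assoc] using this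
    obtain ⟨p', h1, h2⟩ := isTangle_append.1 (show IsTangle p n ([l] ++ w) from hw)
    have t1 : IsTangle (p + k + 2) (p' + k + 2) [l.shift (k + 2)] := h1.shift (k + 2)
    have t2 : IsTangle (p + k) (p' + k) [l.shift k] := h1.shift k
    have e1 := (ih h2).append_left t1
    have c1 : IsTangle (p + k + 2) (p + k) [cap i] := ⟨by omega, rfl⟩
    have c2 : IsTangle (p' + k + 2) (p' + k) [cap i] := ⟨by omega, rfl⟩
    have e2 := (hm.isotopic (c1.append t2) (t1.append c2)).symm.append_right (h2.shift k)
    exact e1.trans e2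

theorem isTangle_replicate {n i : ℕ} (hi : i + 2 ≤ n) (s : Bool) (k : ℕ) :
    IsTangle n n (List.replicate k (cross s i)) := by
  induction k with
  | zero => rfl
  | succ k ih => exact ⟨hi, ih⟩

/-- Conjugation in the braid group. -/
theorem isotopic_conj_one {n i : ℕ} (hi : i + 3 ≤ n) (s : Bool) :
    Isotopic n n [cross s i, cross s (i + 1), cross (!s) i]
      [cross (!s) (i + 1), cross s i, cross s (i + 1)] := by
  have c (s : Bool) : IsTangle n n [cross s i] := ⟨by omega, rfl⟩
  have d (s : Bool) : IsTangle n n [cross s (i + 1)] := ⟨by omega, rfl⟩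
  have r1 := ((ReidemeisterMove.two (!s) (i + 1)).isotopic
    ((d (!s)).append (d (!!s))) rfl).symm.append_right
      (((c s).append (d s)).append (c (!s)))
  have r2 := ((ReidemeisterMove.three s i).isotopic (((c s).append (d s)).append (c s))
    (((d s).append (c s)).append (d s))).symm.congr (d (!s)) (c (!s))
  have r3 := ((ReidemeisterMove.two s i).isotopic ((c s).append (c (!s))) rfl).append_left
    (((d (!s)).append (c s)).append (d s))
  simp only [Bool.not_not, List.cons_append, List.nil_append] at r1 r2 r3
  exact (r1.trans r2).trans r3

/-- Conjugating a power: a cancelling pair is inserted before the last twist, which reduces it to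
the case of a single twist, and the pair created between the two parts cancels. -/
theorem isotopic_conj {n i : ℕ} (hi : i + 3 ≤ n) (s : Bool) (k : ℕ) :
    Isotopic n n (cross s i :: List.replicate k (cross s (i + 1)) ++ [cross (!s) i])
      (cross (!s) (i + 1) :: List.replicate k (cross s i) ++ [cross s (i + 1)]) := by
  have c (s : Bool) : IsTangle n n [cross s i] := ⟨by omega, rfl⟩
  have d (s : Bool) : IsTangle n n [cross s (i + 1)] := ⟨by omega, rfl⟩
  have C (s : Bool) (k : ℕ) : IsTangle n n (List.replicate k (cross s i)) :=
    isTangle_replicate (by omega) s k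
  have D (s : Bool) (k : ℕ) : IsTangle n n (List.replicate k (cross s (i + 1))) :=
    isTangle_replicate (by omega) s k
  induction k with
  | zero =>
    have r1 := (ReidemeisterMove.two s i).isotopic ((c s).append (c (!s))) rfl
    have r2 := (ReidemeisterMove.two (!s) (i + 1)).isotopic ((d (!s)).append (d (!!s))) rfl
    rw [Bool.not_not] at r2
    exact r1.trans r2.symm
  | succ k ih =>
    have r1 := ((ReidemeisterMove.two (!s) i).isotopic
      ((c (!s)).append (c (!!s))) rfl).symm.congr ((c s).append (D s k)) ((d s).append (c (!s)))
    have r2 := ih.append_right (((c s).append (d s)).append (c (!s)))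
    have r3 := (isotopic_conj_one hi s).append_left (((d (!s)).append (C s k)).append (d s))
    have r4 := ((ReidemeisterMove.two s (i + 1)).isotopic ((d s).append (d (!s))) rfl).congr
      ((d (!s)).append (C s k)) ((c s).append (d s))
    simp only [Bool.not_not, List.cons_append, List.nil_append, List.append_assoc,
      List.append_nil, List.replicate_succ'] at r1 r2 r3 r4 ⊢
    exact ((r1.trans r2).trans r3).trans r4

/-- Adding the tangles `-1` and `1/(k + 1)` and removing a superfluous crossing. -/
theorem isotopic_neg_one_add (k : ℕ) :
    Isotopic 2 2 (tangleSum (oneTangle false) (List.replicate (k + 1) (cross true 0)))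
      ([cup 0, cross false 2] ++ List.replicate k (cross true 1) ++ [cap 2]) := by
  have hs (k : ℕ) : shift 2 (List.replicate k (cross true 0)) = List.replicate k (cross true 2) := by
    simp [shift, Layer.shift]
  have h1 (i : ℕ) (s : Bool) (k : ℕ) (hi : i + 2 ≤ 4) :
    IsTangle 4 4 (List.replicate k (cross s i)) := isTangle_replicate hi s k
  have u0 : IsTangle 2 4 [cup 0] := ⟨by omega, rfl⟩
  have u1 : IsTangle 2 4 [cup 1] := ⟨by omega, rfl⟩
  have c (s : Bool) (i : ℕ) (hi : i + 2 ≤ 4) : IsTangle 4 4 [cross s i] := ⟨hi, rfl⟩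
  have p1 : IsTangle 4 2 [cap 1] := ⟨by omega, rfl⟩
  have p2 : IsTangle 4 2 [cap 2] := ⟨by omega, rfl⟩
  -- The crossing `-1` slides around the minimum and the topmost crossing of the twist slides around
  -- the maximum. They become inverse crossings that conjugate the other `k` crossings of the twist.
  -- After conjugation the last crossing is a kink at the maximum and is removed.
  have r1 := ((PlanarMove.slide_cup true 0).isotopic (u0.append (c true 1 (by omega)))
    (u1.append (c false 0 (by omega)))).symm.append_right
      ((h1 2 true (k + 1) (by omega)).append p1)
  have r2 := ((PlanarMove.slide_cap true 1).isotopic ((c true 2 (by omega)).append p1)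
    ((c false 1 (by omega)).append p2)).append_left
      ((u0.append (c true 1 (by omega))).append (h1 2 true k (by omega)))
  have r3 := (isotopic_conj (n := 4) (i := 1) (by omega) true k).congr u0 p2
  have r4 := ((ReidemeisterMove.one_cap true 2).isotopic ((c true 2 (by omega)).append p2)
    p2).append_left ((u0.append (c false 2 (by omega))).append (h1 1 true k (by omega)))
  rw [tangleSum, hs]
  simp only [Bool.not_true, Nat.reduceAdd, List.cons_append, List.nil_append, List.append_assoc,
    List.replicate_succ', oneTangle] at r1 r2 r3 r4 ⊢
  exact ((r1.trans r2).trans r3).trans r4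

theorem isotopic_tangleSum_assoc {B C : Word} (hB : IsTangle 2 2 B) (hC : IsTangle 2 2 C)
    (s : Bool) : Isotopic 2 2 (tangleSum (oneTangle s) (tangleSum B C))
      (tangleSum (tangleSum (oneTangle s) B) C) := by
  have u1 : IsTangle 2 4 [cup 1] := ⟨by omega, rfl⟩
  have u1' : IsTangle 4 6 [cup 1] := ⟨by omega, rfl⟩
  have u3 : IsTangle 4 6 [cup 3] := ⟨by omega, rfl⟩
  have c4 : IsTangle 4 4 [cross s 0] := ⟨by omega, rfl⟩
  have c6 : IsTangle 6 6 [cross s 0] := ⟨by omega, rfl⟩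
  have p3 : IsTangle 6 4 [cap 3] := ⟨by omega, rfl⟩
  have p1 : IsTangle 6 4 [cap 1] := ⟨by omega, rfl⟩
  have p1' : IsTangle 4 2 [cap 1] := ⟨by omega, rfl⟩
  have B6 : IsTangle 6 6 (shift 2 B) := hB.shift_two (by omega)
  have C6 : IsTangle 6 6 (shift 4 C) := hC.shift_two (by omega)
  have r1 := ((PlanarMove.comm (cross s 0) (cup 1) (by simp [Layer.pos])).isotopic
    (c4.append u3) (u3.append c6)).congr u1 ((((B6.append C6).append p3)).append p1')
  have r2 := ((PlanarMove.comm (cup 1) (cup 1) (by simp [Layer.pos])).isotopic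
    (u1.append u3) (u1.append u1')).append_right
      (c6.append ((((B6.append C6).append p3)).append p1'))
  have r3 := ((PlanarMove.comm (cap 1) (cap 1) (by simp [Layer.pos])).isotopic
    (p1.append p1') (p3.append p1')).symm.append_left
      ((((u1.append u1').append c6).append B6).append C6)
  have r4 := (isotopic_cap_comm hC (show 1 ≤ 2 by omega)).congr
    (((u1.append u1').append c6).append B6) p1'
  have e1 : tangleSum (oneTangle s) (tangleSum B C) =
      [cup 1, cross s 0, cup 3] ++ shift 2 B ++ shift 4 C ++ [cap 3, cap 1] := by
    rw [tangleSum, tangleSum, shift_append, shift_append, shift_append, shift_shift]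
    simp [shift, Layer.shift, oneTangle]
  have e2 : tangleSum (tangleSum (oneTangle s) B) C =
      [cup 1, cup 1, cross s 0] ++ shift 2 B ++ [cap 1] ++ shift 2 C ++ [cap 1] := by
    simp [tangleSum, oneTangle]
  rw [e1, e2]
  simp only [Layer.shift, arityIn, arityOut, Nat.reduceAdd, List.cons_append, List.nil_append,
    List.append_assoc] at r1 r2 r3 r4 ⊢
  exact ((r1.trans r2).trans r3).trans r4

theorem Isotopic.numerator {u v : Word} (h : Isotopic 2 2 u v) :
    Isotopic 0 0 (numerator u) (numerator v) :=
  h.congr (a := [cup 0]) (b := [cap 0]) ⟨le_rfl, rfl⟩ ⟨le_rfl, rfl⟩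

theorem Isotopic.tangleSum_right {u v T : Word} (h : Isotopic 2 2 u v) (hT : IsTangle 2 2 T) :
    Isotopic 2 2 (tangleSum u T) (tangleSum v T) := by
  have add_two : Isotopic 4 4 u v := by
    clear hT
    induction h with
    | rel u v h =>
      obtain ⟨hu, hv, h⟩ := h
      exact Relation.EqvGen.rel _ _ ⟨hu.add_right 2, hv.add_right 2, h⟩
    | refl u => exact .refl _ _ _
    | symm u v _ ih => exact ih.symm
    | trans u v w _ _ ih ih' => exact ih.trans ih'
  have u1 : IsTangle 2 4 [cup 1] := ⟨by omega, rfl⟩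
  have p1 : IsTangle 4 2 [cap 1] := ⟨by omega, rfl⟩
  simpa [tangleSum] using add_two.congr u1 ((hT.shift 2).append p1)

/-- The bound is one less than the number of crossings of the diagram itself, which is exactly what
the case of total numerator one lacks. -/
theorem crossingNumber_neg_one_add_le {T : Word} (hT : IsTangle 2 2 T) (k : ℕ) :
    crossingNumber (numerator (tangleSum (oneTangle false)
      (tangleSum (List.replicate (k + 1) (cross true 0)) T))) ≤ k + 1 + crossings T := by
  have h1 := isotopic_tangleSum_assoc (isTangle_replicate (i := 0) le_rfl true (k + 1)) hT false
  have h2 := (isotopic_neg_one_add k).tangleSum_right hT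
  refine (crossingNumber_le (h1.trans h2).numerator).trans (le_of_eq ?_)
  have (j : ℕ) : crossings (List.replicate k (cross true j)) = k := by
    clear h1 h2
    induction k with
    | zero => rfl
    | succ k ih => simp [List.replicate_succ, crossings, ih]
  simp only [numerator, tangleSum, crossings_append, crossings_shift, crossings, this]
  omega

/-! ### Inserted rational tangles -/

/-- The total fraction `P / Q` of a family of rational tangle diagrams. -/
theorem exists_fraction_foldr {ts : List Word} (h : IsRationalFamily ts) {S : Word} {a b : ℝ}
    (hS : HasFraction S a b) :
    ∃ P Q C : ℕ, HasFraction (ts.foldr tangleSum S) (P * b + Q * a) (Q * b) ∧ 1 ≤ P ∧ 2 ≤ Q ∧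
      C ≤ Q ∧ crossings (ts.foldr tangleSum S) = C + crossings S ∧
      (2 ≤ P ∨ ts = [List.replicate Q (cross true 0)]) := by
  obtain ⟨hne, h⟩ := h
  induction ts with
  | nil => exact absurd rfl hne
  | cons t ts ih =>
    obtain ⟨x, hx0, hx1, hx⟩ := h t (by simp)
    obtain ⟨p, q, hp, hq, -, rfl, hf, hc, h1⟩ := hx.exists_fraction
    have hpq : p < q := by
      rw [div_lt_one (by positivity)] at hx1
      exact_mod_cast hx1
    simp only [sgn, if_true, Int.cast_one, one_mul] at hf
    by_cases hts : ts = []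
    · subst hts
      refine ⟨p, q, crossings t, ?_, hp, by omega, by omega, crossings_tangleSum _ _, ?_⟩
      · simpa [mul_comm a] using hf.tangleSum hS
      · by_cases h2 : 2 ≤ p
        · exact Or.inl h2
        · exact Or.inr (by rw [h1 (by omega)])
    · obtain ⟨P, Q, C, hF, hP, hQ, hC, hcr, -⟩ := ih hts fun t ht => h t (by simp [ht])
      -- The fraction is added without cancelling common factors; with two or more summands the
      -- numerator is always at least two.
      refine ⟨p * Q + P * q, q * Q, crossings t + C, ?_, ?_, ?_, ?_, ?_, Or.inl ?_⟩
      · have := hf.tangleSum hF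
        simp only [List.foldr_cons]
        convert this using 1 <;> push_cast <;> ring
      · nlinarith
      · nlinarith
      -- Both denominators are at least two, so `q + Q ≤ q * Q`.
      · have : crossings t ≤ q := by omega
        nlinarith
      · rw [List.foldr_cons, crossings_tangleSum, hcr, add_assoc]
      · nlinarith

theorem HasFraction.determinant_inserted {ts : List Word} {S : Word} {P Q : ℝ}
    (h : HasFraction (ts.foldr Knot.tangleSum S) P Q) :
    determinant (insertedDiagram ts S) = |P - Q| := by
  have := ((hasFraction_one false).tangleSum h).determinant_numerator
  rw [insertedDiagram, this]
  congr 1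
  simp [sgn]
  ring

theorem crossings_inserted (ts : List Word) (S : Word) :
    crossings (insertedDiagram ts S) = crossings (ts.foldr tangleSum S) + 1 := by
  rw [insertedDiagram, numerator, crossings_append, crossings_append, crossings_tangleSum,
    crossings_one]
  simp [crossings, add_comm]

theorem crossingNumber_le_crossings (D : Word) : crossingNumber D ≤ crossings D :=
  crossingNumber_le (.refl 0 0 D)

theorem AltRun.append_right {w : Word} {x y : List Bool} (h : AltRun w x y) {n : ℕ}
    (hw : IsTangle x.length n w) (r : List Bool) : AltRun w (x ++ r) (y ++ r) := by
  induction w generalizing x with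
  | nil => cases h; rfl
  | cons l w ih =>
    cases l with
    | cup i =>
      obtain ⟨b, hb⟩ := h
      have hi := hw.1
      refine ⟨b, ?_⟩
      rw [List.take_append_of_le_length hi, List.drop_append_of_le_length hi, ← List.append_assoc]
      refine ih hb ?_
      convert hw.2 using 1
      simp; omega
    | cap i =>
      obtain ⟨⟨b, h1, h2⟩, h3⟩ := h
      have hi := hw.1
      refine ⟨⟨b, ?_, ?_⟩, ?_⟩
      · rwa [List.getElem?_append_left (by omega)]
      · rwa [List.getElem?_append_left (by omega)]
      · rw [List.take_append_of_le_length (by omega), List.drop_append_of_le_length hi,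
          ← List.append_assoc]
        refine ih h3 ?_
        convert hw.2 using 1
        simp; omega
    | cross s i =>
      obtain ⟨h1, h2, h3⟩ := h
      have hi := hw.1
      refine ⟨?_, ?_, ih h3 hw.2⟩
      · rwa [List.getElem?_append_left (by omega)]
      · rwa [List.getElem?_append_left (by omega)]

theorem isAlternating_numerator {T : Word} (h : IsAlternatingTangle T) :
    IsAlternating (numerator T) :=
  altRun_append.2 ⟨_, altRun_append.2 ⟨_, ⟨false, rfl⟩, h⟩, ⟨false, rfl, rfl⟩, rfl⟩

theorem isAlternating_denominator {T : Word} (hT : IsTangle 2 2 T) (h : IsAlternatingTangle T) :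
    IsAlternating (denominator T) :=
  altRun_append.2 ⟨_, altRun_append.2 ⟨_, ⟨true, true, rfl⟩,
    (AltRun.shift h [true]).append_right (hT.shift 1) [false]⟩, ⟨true, rfl, rfl⟩,
      ⟨true, rfl, rfl⟩, rfl⟩

/-- With `a` and `b` the determinants of the numerator and the denominator of `T`, the determinant
is `P b + Q (a - b)`. The first term pays for the crossings of `T`, of which there are at most `b`
because the denominator is reduced, and the second term pays for the at most `Q` inserted crossings.
-/
theorem crossingNumber_inserted_le_determinant {T : Word} {ts : List Word}
    (hT : IsStronglyAlternating T) (hts : IsRationalFamily ts)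
    (hdet : determinant (denominator T) < determinant (numerator T)) :
    (crossingNumber (insertedDiagram ts T) : ℝ) ≤ determinant (insertedDiagram ts T) := by
  obtain ⟨hw, halt, hnc, hnr, hdc, hdr⟩ := hT
  have hF := hasFraction_of_isAlternatingTangle hw halt
  have hnl := isLinkDiagram_numerator hw
  have hdl := isLinkDiagram_denominator hw
  obtain ⟨b, hb, hb1, hb2⟩ := exists_determinant_eq hdl (isAlternating_denominator hw halt) hdc hdr
  have ha := determinant_eq_treeCount hnl (isAlternating_numerator halt)
  have hcd : crossings (denominator T) = crossings T := by
    simp [denominator, crossings_append, crossings_shift, crossings]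
  rw [hcd] at hb1
  rw [ha, hb] at hF hdet
  set a := treeCount (numerator T)
  obtain ⟨P, Q, C, hS, hP, hQ, hC, hcr, hcase⟩ := exists_fraction_foldr hts hF
  rw [hS.determinant_inserted]
  refine le_trans ?_ (le_abs_self _)
  have hab : b < a := by exact_mod_cast hdet
  obtain ⟨d, hd⟩ := Nat.exists_eq_add_of_lt hab
  have key : crossingNumber (insertedDiagram ts T) ≤ P * b + Q * (d + 1) := by
    rcases hcase with h2 | h1
    -- For `P ≥ 2` the second copy of `b` pays for the crossing `-1`. For `P = 1` nothing is left
    -- over, and the isotopy that saves a crossing is used instead.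
    · refine (crossingNumber_le_crossings _).trans ?_
      rw [crossings_inserted, hcr]
      nlinarith
    · obtain ⟨k, rfl⟩ : ∃ k, Q = k + 1 := ⟨Q - 1, by omega⟩
      rw [h1, insertedDiagram, List.foldr_cons, List.foldr_nil]
      refine (crossingNumber_neg_one_add_le hw k).trans ?_
      nlinarith
  have : (crossingNumber (insertedDiagram ts T) : ℝ) ≤ (P * b + Q * (d + 1) : ℕ) := by
    exact_mod_cast key
  rw [hd]
  push_cast at this ⊢
  linarith


/-! ### Closures of connected tangle diagrams -/

theorem sum_powerset_mem {K : ℕ} (f : Bool → ℕ) :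
    ∑ s ∈ (Finset.range (K + 1)).powerset, f (decide (0 ∈ s)) = 2 ^ K * (f false + f true) := by
  rw [sum_powerset_range_erase (Nat.succ_pos K)]
  have (s) (hs : s ∈ ((Finset.range (K + 1)).erase 0).powerset) :
      f (decide (0 ∈ s)) + f (decide (0 ∈ insert 0 s)) = f false + f true := by
    simp [notMem_of_mem_powerset_erase hs]
  rw [Finset.sum_congr rfl this]
  simp

theorem sum_powerset_mem_mem {K : ℕ} (f : Bool → Bool → ℕ) :
    ∑ s ∈ (Finset.range (K + 2)).powerset, f (decide (0 ∈ s)) (decide (1 ∈ s)) =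
      2 ^ K * (f false false + f false true + (f true false + f true true)) := by
  rw [sum_powerset_range_erase (Nat.succ_pos (K + 1))]
  have (s) (hs : s ∈ ((Finset.range (K + 2)).erase 0).powerset) :
      f (decide (0 ∈ s)) (decide (1 ∈ s)) + f (decide (0 ∈ insert 0 s)) (decide (1 ∈ insert 0 s)) =
        f false (decide (1 ∈ s)) + f true (decide (1 ∈ s)) := by
    simp [notMem_of_mem_powerset_erase hs]
  rw [Finset.sum_congr rfl this]
  have h1 : 1 ∈ (Finset.range (K + 2)).erase 0 := by simp
  rw [← Finset.insert_erase h1, Finset.sum_powerset_insert (Finset.notMem_erase _ _),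
    ← Finset.sum_add_distrib]
  have (s) (hs : s ∈ (((Finset.range (K + 2)).erase 0).erase 1).powerset) :
      f false (decide (1 ∈ s)) + f true (decide (1 ∈ s)) +
        (f false (decide (1 ∈ insert 1 s)) + f true (decide (1 ∈ insert 1 s))) =
        f false false + f false true + (f true false + f true true) := by
    have h1 : 1 ∉ s := fun h => Finset.notMem_erase _ _ (Finset.mem_powerset.1 hs h)
    simp only [h1, decide_false, Finset.mem_insert, true_or, decide_true]
    ring
  rw [Finset.sum_congr rfl this]
  simp

/-- The colouring of two strands. -/
def bits (a b : Bool) : ℕ → Bool := ofList [a, b]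

/-- The sum runs over all colourings of the tangle projection, and connectedness leaves only the two
constant ones. -/
theorem IsConnectedTangle.sum_tr {T : Word} (hT : IsTangle 2 2 T) (h : IsConnectedTangle T) :
    tr T (fun _ => 1) (bits false false) + tr T (fun _ => 1) (bits false true) +
      (tr T (fun _ => 1) (bits true false) + tr T (fun _ => 1) (bits true true)) = 2 := by
  have key := sweep_colorings (fun _ => 1) (K := T.length + 2) T [0, 1] 2 hT (by simp) (by omega)
  have hlen := length_sweep T [0, 1] 2 (by simp) hT
  obtain ⟨h0, h1⟩ := h
  obtain ⟨x, y, hxy⟩ := List.length_eq_two.1 hlen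
  rw [hxy] at h1
  have e : x = y := h1 x (by simp) y (by simp)
  have hs := sum_powerset_mem_mem (K := T.length) fun a b => tr T (fun _ => 1) (bits a b)
  have e2 : ∀ s, pad s [0, 1] = bits (decide (0 ∈ s)) (decide (1 ∈ s)) := fun s => rfl
  simp only [e2] at key
  rw [hs, h0, hxy, e] at key
  simp only [List.toFinset_cons, List.toFinset_nil, insert_empty_eq, Finset.mem_singleton,
    Finset.insert_eq_of_mem, Finset.card_singleton, Finset.sum_const, Finset.card_powerset,
    Finset.card_range, smul_eq_mul, mul_one, zero_add, pow_one,
    Finset.card_pair (show (0 : ℕ) ≠ 1 by omega)] at key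
  have h2 : (2 : ℕ) ^ T.length * 4 ≠ 0 := by positivity
  refine Nat.eq_of_mul_eq_mul_left (Nat.pos_of_ne_zero h2) ?_
  rw [pow_add] at key
  linear_combination key

theorem tr_eq_bits {T : Word} (hT : IsTangle 2 2 T) (x : ℕ → Bool) {φ : (ℕ → Bool) → ℕ}
    (hφ : Local 2 φ) : tr T φ x = tr T φ (bits (x 0) (x 1)) := by
  refine tr_local hT hφ _ _ fun j hj => ?_
  rcases j with _ | _ | j
  · rfl
  · rfl
  · omega

/-- Put `k` further strands on the left. -/
def prepend (k : ℕ) (x y : ℕ → Bool) : ℕ → Bool := fun j => if j < k then x j else y (j - k)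

theorem tr_shift (k : ℕ) (w : Word) (φ : (ℕ → Bool) → ℕ) (x y : ℕ → Bool) :
    tr (shift k w) φ (prepend k x y) = tr w (fun z => φ (prepend k x z)) y := by
  have h0 : ∀ (i : ℕ) (y : ℕ → Bool), prepend k x y (i + k) = y i := by
    intro i y; simp [prepend]
  have h1 : ∀ (i : ℕ) (y : ℕ → Bool), prepend k x y (i + k + 1) = y (i + 1) := by
    intro i y; rw [add_right_comm]; exact h0 _ _
  have h2 : ∀ (i : ℕ) (b : Bool) (y : ℕ → Bool),
      ins (i + k) b (prepend k x y) = prepend k x (ins i b y) := by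
    intro i b y; funext j; simp only [ins, prepend]; grind
  have h3 : ∀ (i : ℕ) (y : ℕ → Bool),
      del (i + k) (prepend k x y) = prepend k x (del i y) := by
    intro i y; funext j; simp only [del, prepend]; grind
  induction w generalizing y with
  | nil => rfl
  | cons l w ih =>
    rw [shift] at ih
    cases l <;> simp only [shift, List.map_cons, Layer.shift, tr, h0, h1, h2, h3, ih]

/-- Strands to the right of a diagram keep their colours. -/
theorem tr_congr_right {m n : ℕ} {w : Word} (hw : IsTangle m n w) {φ ψ : (ℕ → Bool) → ℕ}
    {x : ℕ → Bool} (h : ∀ z : ℕ → Bool, (∀ j, z (n + j) = x (m + j)) → φ z = ψ z) :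
    tr w φ x = tr w ψ x := by
  induction w generalizing m x with
  | nil => cases hw; exact h x fun _ => rfl
  | cons l w ih =>
    cases l with
    | cup i =>
      have hi := hw.1
      have this (b : Bool) : ∀ j, ins i b x (m + 2 + j) = x (m + j) := by
        intro j; simp only [ins]; rw [if_neg (by omega), if_neg (by omega)]; congr 1; omega
      simp only [tr]
      rw [ih hw.2 fun z hz => h z fun j => by rw [hz, this],
        ih hw.2 fun z hz => h z fun j => by rw [hz, this]]
    | cap i =>
      have hi := hw.1
      have : ∀ j, del i x (m - 2 + j) = x (m + j) := by
        intro j; simp only [del]; rw [if_neg (by omega)]; congr 1; omega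
      simp only [tr]
      rw [ih hw.2 fun z hz => h z fun j => by rw [hz, this]]
    | cross s i =>
      simp only [tr]
      rw [ih hw.2 h]

theorem sweep_append (u v : Word) (ls : List ℕ) (k : ℕ) :
    ∃ k', sweep (u ++ v) ls k =
      ((sweep u ls k).1 + (sweep v (sweep u ls k).2 k').1, (sweep v (sweep u ls k).2 k').2) := by
  induction u generalizing ls k with
  | nil => exact ⟨k, by simp [sweep]⟩
  | cons l u ih =>
    cases l with
    | cup i => exact ih _ _
    | cap i =>
      obtain ⟨k', h⟩ := ih (((ls.take i ++ ls.drop (i + 2)).map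
        fun z => if z = ls.getD (i + 1) 0 then ls.getD i 0 else z)) k
      refine ⟨k', ?_⟩
      simp only [List.cons_append, sweep, h]
      congr 1
      omega
    | cross s i => exact ih _ _

/-- Colourings with all four endpoints of the same colour. -/
theorem tr_closed_add {T : Word} (hT : IsTangle 2 2 T) :
    let φ (a : Bool) (z : ℕ → Bool) : ℕ := if z 0 = a ∧ z 1 = a then 1 else 0
    tr T (φ false) (bits false false) + tr T (φ true) (bits true true) =
      2 * 2 ^ floating 2 T := by
  intro φ
  have h3 : IsTangle 3 3 T := hT.add_right 1
  -- The third strand is the one kept on the right by `floating`. The two crossings on top glue the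
  -- upper endpoints to it, which forces all endpoints to have one colour.
  have hw : IsTangle [0, 0, 0].length 3 (T ++ [cross true 0, cross true 1]) :=
    h3.append ⟨by omega, by omega, rfl⟩
  have key := sweep_colorings (fun _ => 1) (K := (T ++ [cross true 0, cross true 1]).length + 1) _ _
    1 hw (by simp) (by omega)
  have hlen := length_sweep T [0, 0, 0] 1 (by simp) h3
  obtain ⟨p, q, r, hpqr⟩ := List.length_eq_three.1 hlen
  obtain ⟨k', hk⟩ := sweep_append T [cross true 0, cross true 1] [0, 0, 0] 1
  have hfl : (sweep T [0, 0, 0] 1).1 = floating 2 T := rfl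
  have hsw : sweep [cross true 0, cross true 1] [p, q, r] k' = (0, [p, p, p]) := by
    simp only [sweep, List.map_cons, List.map_nil, List.getD_cons_zero, List.getD_cons_succ,
      zero_add]
    by_cases h1 : p = q <;> by_cases h2 : r = q <;> simp [h1, h2]
  rw [hk, hfl, hpqr, hsw] at key
  have e2 : ∀ s, tr (T ++ [cross true 0, cross true 1]) (fun _ => 1) (pad s [0, 0, 0]) =
      (fun a => tr T (φ a) (bits a a)) (decide (0 ∈ s)) := by
    intro s
    show tr _ _ (ofList [decide (0 ∈ s), decide (0 ∈ s), decide (0 ∈ s)]) = _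
    generalize decide (0 ∈ s) = a
    rw [tr_append, tr_congr_right (ψ := φ a) hT fun z hz => ?_, tr_eq_bits hT]
    · rfl
    · intro x y h
      simp only [φ, h 0 (by omega), h 1 (by omega)]
    · have : z 2 = a := by simpa [ofList] using hz 0
      simp only [tr, φ, this, zero_add]
      by_cases h1 : z 0 = z 1 <;> by_cases h2 : z 1 = a <;> simp [h1, h2]
  simp only [e2] at key
  rw [sum_powerset_mem fun a => tr T (φ a) (bits a a)] at key
  simp only [List.toFinset_cons, List.toFinset_nil, insert_empty_eq, Finset.mem_singleton,
    Finset.insert_eq_of_mem, Finset.card_singleton, Finset.sum_const, Finset.card_powerset,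
    Finset.card_range, smul_eq_mul, mul_one, add_zero, pow_one] at key
  have h2 : (2 : ℕ) ^ (T ++ [cross true 0, cross true 1]).length * 2 ≠ 0 := by positivity
  refine Nat.eq_of_mul_eq_mul_left (Nat.pos_of_ne_zero h2) ?_
  rw [pow_succ, pow_succ] at key
  linear_combination key

theorem eq_prepend (k : ℕ) (y : ℕ → Bool) : y = prepend k y fun j => y (j + k) := by
  funext j
  simp only [prepend]
  split_ifs with h
  · rfl
  · congr 1; omega

theorem tr_closing {T : Word} (hT : IsTangle 2 2 T) (y : ℕ → Bool) :
    tr (shift 2 T ++ [cap 1, cap 0]) (fun _ => 1) y =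
      tr T (fun z => if z 0 = y 1 ∧ z 1 = y 0 then 1 else 0) (bits (y 2) (y 3)) := by
  have e : (fun z => tr [cap 1, cap 0] (fun _ => 1) (prepend 2 y z)) =
      fun z => if z 0 = y 1 ∧ z 1 = y 0 then 1 else 0 := by
    funext z
    have h0 : prepend 2 y z 1 = y 1 := rfl
    have h1 : prepend 2 y z (1 + 1) = z 0 := rfl
    have h2 : del 1 (prepend 2 y z) 0 = y 0 := rfl
    have h3 : del 1 (prepend 2 y z) (0 + 1) = z 1 := rfl
    simp only [tr, h0, h1, h2, h3, eq_comm (a := z 0), eq_comm (a := z 1)]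
    by_cases h1 : y 1 = z 0 <;> by_cases h2 : y 0 = z 1 <;> simp [h1, h2]
  rw [tr_append]
  conv_lhs => rw [eq_prepend 2 y]
  rw [tr_shift, e, tr_eq_bits hT]
  intro x z h
  simp only [h 0 (by omega), h 1 (by omega)]

/-- The crossing of the tangle `1` joins all four endpoints of `T`, so the closed projection has
exactly one piece besides the floating ones. -/
theorem colorings_one_add {T : Word} (hT : IsTangle 2 2 T) (s : Bool) :
    colorings ([cup 0, cup 1, cross s 0] ++ (shift 2 T ++ [cap 1, cap 0])) =
      2 * 2 ^ floating 2 T := by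
  rw [← tr_closed_add hT]
  simp only [colorings, tr, tr_closing hT, List.cons_append, List.nil_append]
  simp [ins]

/-- Each closing arc ends at endpoints of `T`, so a colouring of a closure is determined by its
restriction to `T`, and `T` has only two colourings. -/
theorem IsConnectedTangle.colorings_closures {T : Word} (hT : IsTangle 2 2 T)
    (h : IsConnectedTangle T) :
    colorings ([cup 0, cup 1] ++ (shift 2 T ++ [cap 1, cap 0])) ≤ 2 ∧
      colorings ([cup 0, cup 1] ++ cap 0 :: cup 0 :: (shift 2 T ++ [cap 1, cap 0])) ≤ 2 ∧
      colorings (numerator T) ≤ 2 ∧ colorings (denominator T) ≤ 2 := by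
  have hs := h.sum_tr hT
  have hle : ∀ (p : (ℕ → Bool) → Prop) [DecidablePred p] (x : ℕ → Bool),
      tr T (fun z => if p z then 1 else 0) x ≤ tr T (fun _ => 1) x := fun p _ x =>
    tr_mono T (fun z => by split_ifs <;> omega) x
  have hb : ∀ x, tr T (fun _ => 1) x = tr T (fun _ => 1) (bits (x 0) (x 1)) := fun x =>
    tr_eq_bits hT x (local_const 2 1)
  refine ⟨?_, ?_, ?_, ?_⟩
  · simp only [colorings, tr, tr_closing hT, List.cons_append, List.nil_append]
    refine le_trans ?_ hs.le
    refine (add_le_add (add_le_add (hle _ _) (hle _ _)) (add_le_add (hle _ _) (hle _ _))).trans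
      (le_of_eq ?_)
    simp [ins]
    ring
  · simp only [colorings, tr, tr_closing hT, List.cons_append, List.nil_append]
    have h1 : ∀ x, tr T (fun z => if z 0 = false ∧ z 1 = false then 1 else 0) x +
        tr T (fun z => if z 0 = true ∧ z 1 = true then 1 else 0) x ≤ tr T (fun _ => 1) x := by
      intro x
      rw [← tr_add]
      refine tr_mono T (fun z => ?_) x
      cases z 0 <;> cases z 1 <;> simp
    have h2 := h1 (bits false false)
    have h3 := h1 (bits true true)
    simp [ins, del]
    omega
  · have h1 : colorings (numerator T) ≤
        tr T (fun _ => 1) (ins 0 false fun _ => false) +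
          tr T (fun _ => 1) (ins 0 true fun _ => false) := by
      simp only [numerator, colorings, tr, tr_append, List.cons_append, List.nil_append]
      exact add_le_add (hle _ _) (hle _ _)
    rw [hb (ins 0 false _), hb (ins 0 true _)] at h1
    simp [ins] at h1
    omega
  · have e : denominator T = [cup 0, cup 2] ++ (shift 1 T ++ [cap 0, cap 0]) := by
      simp [denominator]
    have e1 : ∀ y, tr (shift 1 T ++ [cap 0, cap 0]) (fun _ => 1) y ≤
        tr T (fun _ => 1) (bits (y 1) (y 2)) := by
      intro y
      rw [tr_append]
      conv_lhs => rw [eq_prepend 1 y]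
      rw [tr_shift]
      refine (tr_mono T (ψ := fun _ => 1) (fun z => ?_) _).trans (le_of_eq (hb _))
      simp only [tr]
      split_ifs <;> omega
    rw [e]
    simp only [colorings, tr, List.cons_append, List.nil_append]
    refine le_trans ?_ hs.le
    refine (add_le_add (add_le_add (e1 _) (e1 _)) (add_le_add (e1 _) (e1 _))).trans
      (le_of_eq ?_)
    simp [ins]


theorem IsConnectedTangle.floating_eq_zero {T : Word} (hT : IsTangle 2 2 T)
    (h : IsConnectedTangle T) : floating 2 T = 0 := by
  have h1 := colorings_one_add hT true
  have h2 := (h.colorings_closures hT).1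
  have h3 := colorings_smoothInfty [cup 0, cup 1] (shift 2 T ++ [cap 1, cap 0]) true 0
  have h4 : colorings ([cup 0, cup 1, cross true 0] ++ (shift 2 T ++ [cap 1, cap 0])) =
    colorings ([cup 0, cup 1] ++ cross true 0 :: (shift 2 T ++ [cap 1, cap 0])) := rfl
  by_contra hne
  have : 2 ^ 1 ≤ 2 ^ floating 2 T := Nat.pow_le_pow_right (by omega) (by omega)
  omega

/-- Every crossing of the closure of `1 + T` is the crossing of `1` or a crossing of `T`. -/
theorem eq_of_one_add_eq {T a b : Word} {s : Bool} {i : ℕ}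
    (h : [cup 0, cup 1] ++ cross true 0 :: (shift 2 T ++ [cap 1, cap 0]) = a ++ cross s i :: b) :
    (a = [cup 0, cup 1] ∧ i = 0 ∧ b = shift 2 T ++ [cap 1, cap 0]) ∨
      ∃ u k v, T = u ++ cross s k :: v ∧ i = k + 2 ∧
        a = [cup 0, cup 1, cross true 0] ++ shift 2 u ∧ b = shift 2 v ++ [cap 1, cap 0] := by
  match a, h with
  | [], h => simp at h
  | [_], h => simp at h
  | [_, _], h =>
    simp only [List.cons_append, List.nil_append, List.cons.injEq, cross.injEq] at h
    obtain ⟨rfl, rfl, ⟨rfl, rfl⟩, rfl⟩ := h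
    exact Or.inl ⟨rfl, rfl, rfl⟩
  | _ :: _ :: _ :: a', h =>
    simp only [List.cons_append, List.nil_append, List.cons.injEq] at h
    obtain ⟨rfl, rfl, rfl, h⟩ := h
    rcases List.append_eq_append_iff.1 h with ⟨c, rfl, hc⟩ | ⟨c, hc, hb⟩
    · rcases c with _ | ⟨_, _ | ⟨_, _ | ⟨_, _⟩⟩⟩ <;> simp at hc
    · rcases c with _ | ⟨l, c⟩
      · simp at hb
      · simp only [List.cons_append, List.cons.injEq] at hb
        obtain ⟨rfl, rfl⟩ := hb
        obtain ⟨u, v', rfl, rfl, hv⟩ := List.map_eq_append_iff.1 hc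
        obtain ⟨l, v, rfl, hl, rfl⟩ := List.map_eq_cons_iff.1 hv
        cases l with
        | cup k => cases hl
        | cap k => cases hl
        | cross s' k =>
          simp only [Layer.shift, cross.injEq] at hl
          obtain ⟨rfl, rfl⟩ := hl
          exact Or.inr ⟨u, k, v, rfl, rfl, rfl, rfl⟩

/-- The determinants of the closures of a connected reduced alternating tangle diagram. -/
theorem exists_determinant_closures {T : Word} (hT : IsTangle 2 2 T) (ha : IsAlternatingTangle T)
    (hc : IsConnectedTangle T) (hr : IsReduced 2 T) :
    ∃ x y : ℕ, HasFraction T x y ∧ 1 ≤ x ∧ 1 ≤ y ∧ crossings T + 1 ≤ x + y := by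
  have hF := hasFraction_of_isAlternatingTangle hT ha
  have hcl := hc.colorings_closures hT
  have hnl := isLinkDiagram_numerator hT
  have hdl := isLinkDiagram_denominator hT
  rw [determinant_eq_treeCount hnl (isAlternating_numerator ha),
    determinant_eq_treeCount hdl (isAlternating_denominator hT ha)] at hF
  refine ⟨_, _, hF, one_le_treeCount hnl hcl.2.2.1, one_le_treeCount hdl hcl.2.2.2, ?_⟩
  have e : numerator (tangleSum (oneTangle true) T) =
      [cup 0, cup 1] ++ cross true 0 :: (shift 2 T ++ [cap 1, cap 0]) := by
    simp [numerator, tangleSum, oneTangle]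
  have hl := isLinkDiagram_numerator
    (isTangle_tangleSum (show IsTangle 2 2 (oneTangle true) from ⟨le_rfl, rfl⟩) hT)
  have h1 := ((hasFraction_one true).tangleSum hF).determinant_numerator
  rw [determinant_eq_treeCount hl (isAlternating_numerator_one_add ha)] at h1
  rw [e] at h1 hl
  have h2 := crossings_le_treeCount hl (by
      have h3 := colorings_smoothInfty [cup 0, cup 1] (shift 2 T ++ [cap 1, cap 0]) true 0
      have h4 := hcl.1
      omega) (by
    intro a s i b h
    -- The added crossing is not nugatory because both closures of `T` are connected. For a crossing
    -- of `T`, reducedness relative to the endpoints passes to the closure by `colorings_one_add`.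
    rcases eq_of_one_add_eq h with ⟨rfl, rfl, rfl⟩ | ⟨u, k, v, rfl, rfl, rfl, rfl⟩
    · exact ⟨hcl.1, hcl.2.1⟩
    · have h5 := hr ⟨u, s, k, v⟩ (MarkedDiagram.diagram_eq _)
      rw [MarkedDiagram.smoothZero_eq, MarkedDiagram.smoothInfty_eq, hc.floating_eq_zero hT] at h5
      have h6 := colorings_one_add hT.smoothInfty true
      have h7 := colorings_one_add hT.smoothZero true
      rw [Nat.le_zero.1 h5.1] at h7
      rw [Nat.le_zero.1 h5.2] at h6
      constructor
      · refine le_of_eq (Eq.trans ?_ h6)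
        simp [shift_append]
      · refine le_of_eq (Eq.trans ?_ h7)
        simp [shift, Layer.shift])
  -- The closure of `1 + T` has determinant `x + y` and one crossing more than `T`; this is the
  -- source of the `+ 1`.
  have h8 : treeCount ([cup 0, cup 1] ++ cross true 0 :: (shift 2 T ++ [cap 1, cap 0])) =
      treeCount (numerator T) + treeCount (denominator T) := by
    simp only [sgn, if_true, Int.cast_one, one_mul, mul_one] at h1
    rw [abs_of_nonneg (by positivity)] at h1
    have : ((treeCount ([cup 0, cup 1] ++ cross true 0 :: (shift 2 T ++ [cap 1, cap 0])) : ℕ) : ℝ)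
      = (treeCount (numerator T) + treeCount (denominator T) : ℕ) := by
      rw [h1]; push_cast; ring
    exact_mod_cast this
  rw [h8] at h2
  simp only [crossings_append, crossings, crossings_shift] at h2
  omega

/-! ### The tangles `T ⋆ t` -/

theorem HTwist.fraction {n : ℕ} {W W' : Word} (h : HTwist n W W') {p q : ℕ}
    (hf : HasFraction W p q) : HasFraction W' (p + n * q : ℕ) q ∧
      crossings W' = crossings W + n := by
  induction h with
  | zero W => exact ⟨by simpa using hf, rfl⟩
  | right _ ih =>
    obtain ⟨h1, h2⟩ := ih hf
    refine ⟨?_, by rw [crossings_tangleSum, h2, crossings_one, add_assoc]⟩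
    convert h1.tangleSum (hasFraction_one true) using 1 <;> simp [sgn]
    ring
  | left _ ih =>
    obtain ⟨h1, h2⟩ := ih hf
    refine ⟨?_, by rw [crossings_tangleSum, h2, crossings_one]; ring⟩
    convert (hasFraction_one true).tangleSum h1 using 1 <;> simp [sgn]
    ring

theorem VTwist.fraction {n : ℕ} {W W' : Word} (h : VTwist n W W') {p q : ℕ}
    (hf : HasFraction W p q) : HasFraction W' p (q + n * p : ℕ) ∧
      crossings W' = crossings W + n := by
  induction h with
  | zero W => exact ⟨by simpa using hf, rfl⟩
  | bottom _ ih =>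
    obtain ⟨h1, h2⟩ := ih hf
    refine ⟨?_, by rw [crossings_tangleProd, h2, crossings_one, add_assoc]⟩
    convert h1.tangleProd (hasFraction_one true) using 1 <;> simp [sgn]
    ring
  | top _ ih =>
    obtain ⟨h1, h2⟩ := ih hf
    refine ⟨?_, by rw [crossings_tangleProd, h2, crossings_one]; ring⟩
    convert (hasFraction_one true).tangleProd h1 using 1 <;> simp [sgn]
    ring

/-- Adding twists acts on the fraction of `T` by a Möbius transformation. Its matrix has determinant
one, and `p/q` is the value of the continued fraction. The number `s` counts the added twists; each
of them raises `p` or `q` by at least one. -/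
theorem Star.exists_fraction {T W : Word} {l : List ℕ} (h : Star T l W) (hl : ∀ a ∈ l, 1 ≤ a)
    {x y : ℕ} (hT : HasFraction T x y) :
    ∃ p q p' q' s : ℕ, p' * q = p * q' + 1 ∧ contFrac l = p / q ∧ s + 1 ≤ p + q ∧ 0 < q ∧
      HasFraction W (p' * x + p * y : ℕ) (q' * x + q * y : ℕ) ∧ crossings W = crossings T + s ∧
      (l ≠ [] → 0 < p ∧ p < q ∧ 0 < q') := by
  induction h with
  | nil => exact ⟨0, 1, 1, 0, 0, by simp, by simp [contFrac], by simp, one_pos, by simpa using hT,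
      rfl, fun h => absurd rfl h⟩
  | @cons a b l W W' W'' _ hH hV ih =>
    obtain ⟨p, q, p', q', s, h1, h2, h3, h4, h5, h6, -⟩ := ih fun a ha => hl a (by simp [ha])
    have ha : 1 ≤ a := hl a (by simp)
    have hb : 1 ≤ b := hl b (by simp)
    obtain ⟨f1, c1⟩ := hH.fraction h5
    obtain ⟨f2, c2⟩ := hV.fraction f1
    have hbq : 0 < b * q := by positivity
    refine ⟨p + b * q, q + a * (p + b * q), p' + b * q', q' + a * (p' + b * q'), s + b + a, ?_, ?_,
      ?_, by positivity, ?_, by rw [c2, c1, h6]; ring, fun _ => ⟨by positivity, ?_, ?_⟩⟩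
    · linear_combination h1
    · have hq : (0 : ℚ) < q := by exact_mod_cast h4
      have hb' : (0 : ℚ) < b := by exact_mod_cast hb
      rw [contFrac, contFrac, h2]
      push_cast
      field_simp
      ring
    · nlinarith
    · convert f2 using 2 <;> ring
    · nlinarith
    · have : 0 < p' := by
        rcases Nat.eq_zero_or_pos p' with h | h
        · rw [h] at h1; omega
        · exact h
      positivity

/-- The tangle in front of `T ⋆ t` has fraction `1 - t`, so together with `-1` it contributes `-t =
-p/q`. Since the transformation has determinant one, `A/B - p/q = x/(qB)`, and the determinant of
the link is `P q B + Q x`. The term `Q x` pays for the inserted tangles, and `q B` is large enough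
for everything else. -/
theorem crossingNumber_star_le_determinant {T : Word} {l : List ℕ} {W r : Word} {ts : List Word}
    (hT : IsTangle 2 2 T) (ha : IsAlternatingTangle T) (hc : IsConnectedTangle T)
    (hr : IsReduced 2 T) (hne : l ≠ []) (hl : ∀ a ∈ l, 1 ≤ a) (hW : Star T l W)
    (hrat : IsRational true r ((1 - contFrac l) / contFrac l)) (hts : IsRationalFamily ts) :
    (crossingNumber (insertedDiagram ts (tangleSum (tangleProd r (oneTangle true)) W)) : ℝ) ≤
      determinant (insertedDiagram ts (tangleSum (tangleProd r (oneTangle true)) W)) := by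
  obtain ⟨x, y, hF, hx, hy, hxy⟩ := exists_determinant_closures hT ha hc hr
  obtain ⟨p, q, p', q', s, h1, h2, h3, hq, hFW, hcW, h4⟩ := hW.exists_fraction hl hF
  obtain ⟨hp, hpq, hq'⟩ := h4 hne
  obtain ⟨u, v, hu, hv, huv, he, hFr, hcr, -⟩ := hrat.exists_fraction
  obtain ⟨d, rfl⟩ := Nat.exists_eq_add_of_lt hpq
  -- Here `q = p + d + 1`. The relation `p' q = p q' + 1` makes `q - p` and `p` coprime, so they are
  -- the lowest terms of the fraction of `r` and bound its crossings.
  have hcop : Nat.Coprime (d + 1) p := by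
    rw [← Nat.isCoprime_iff_coprime]
    have h : (p' * (p + d + 1) : ℤ) = p * q' + 1 := by exact_mod_cast h1
    exact ⟨p', p' - q', by push_cast; linear_combination h⟩
  have huv' : u = d + 1 ∧ v = p := by
    have e1 : u * p = (d + 1) * v := by
      have hp' : (p : ℚ) ≠ 0 := by positivity
      have hv' : (v : ℚ) ≠ 0 := by positivity
      have hq' : ((p + d + 1 : ℕ) : ℚ) ≠ 0 := by positivity
      rw [h2] at he
      field_simp at he
      push_cast at he
      have : (u * p : ℚ) = (d + 1) * v := by linarith
      exact_mod_cast this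
    have d1 : u ∣ d + 1 := huv.dvd_of_dvd_mul_right (Dvd.intro _ e1)
    have d2 : d + 1 ∣ u := hcop.dvd_of_dvd_mul_right (Dvd.intro _ e1.symm)
    have e2 := Nat.dvd_antisymm d1 d2
    refine ⟨e2, ?_⟩
    rw [e2] at e1
    exact (Nat.eq_of_mul_eq_mul_left (by omega) e1).symm
  obtain ⟨rfl, rfl⟩ := huv'
  set A := p' * x + v * y
  set B := q' * x + (v + d + 1) * y with hB
  have hFS : HasFraction (tangleSum (tangleProd r (oneTangle true)) W)
      ((d + 1) * B + A * (v + d + 1)) ((v + d + 1) * B) := by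
    convert (hFr.tangleProd (hasFraction_one true)).tangleSum hFW using 1 <;>
      (simp only [sgn, if_true]; push_cast; ring)
  obtain ⟨P, Q, C, hS, hP, hQ, hC, hcS, -⟩ := exists_fraction_foldr hts hFS
  rw [hS.determinant_inserted]
  refine le_trans ?_ (le_abs_self _)
  -- The determinant-one relation, multiplied by `x`; the terms in `y` cancel.
  have hAB : (A : ℝ) * (v + d + 1) = v * B + x := by
    have : A * (v + d + 1) = v * B + x := by
      simp only [A, B]
      linear_combination x * h1
    exact_mod_cast this
  have hdet : (P * ((v + d + 1) * B) + Q * ((d + 1) * B + A * (v + d + 1)) : ℝ) -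
      Q * ((v + d + 1) * B) = (P * ((v + d + 1) * B) + Q * x : ℕ) := by
    push_cast
    rw [hAB]; ring
  rw [hdet]
  refine le_trans (Nat.cast_le.2 (crossingNumber_le_crossings _)) (Nat.cast_le.2 ?_)
  rw [crossings_inserted, hcS, crossings_tangleSum, crossings_tangleProd, crossings_one, hcW]
  have b1 : x + (v + d + 1) * y ≤ B := by rw [hB]; nlinarith
  have b2 : (v + d + 1) * (x + (v + d + 1) * y) ≤ P * ((v + d + 1) * B) := by
    calc (v + d + 1) * (x + (v + d + 1) * y) ≤ (v + d + 1) * B := Nat.mul_le_mul_left _ b1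
      _ ≤ P * ((v + d + 1) * B) := Nat.le_mul_of_pos_left _ hP
  have b3 : Q ≤ Q * x := Nat.le_mul_of_pos_right _ hx
  -- The bound is `max (d + 1) v`, and `v` is positive.
  have b4 : crossings r ≤ v + d := by omega
  -- With `q = v + d + 1`, the crossings of `r`, of the twists and of `T`, together with the two
  -- single crossings, number at most `3 q + x + y - 2`. The inequality needs `q ≥ 2`, which holds
  -- since `0 < p < q`.
  have b5 : 3 * (v + d + 1) + x + y ≤ (v + d + 1) * (x + (v + d + 1) * y) + 2 := by
    obtain ⟨x, rfl⟩ := Nat.exists_eq_add_of_le hx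
    obtain ⟨y, rfl⟩ := Nat.exists_eq_add_of_le hy
    obtain ⟨k, hk⟩ : ∃ k, v + d + 1 = k + 2 := ⟨v + d - 1, by omega⟩
    rw [hk]
    nlinarith [Nat.zero_le (k * x), Nat.zero_le (k * k), Nat.zero_le (k * y),
      Nat.zero_le (k * k * y)]
  omega

end Knot

theorem mainTheorem7 :
    -- the proposition on rational extensions of the dealternator extension
    (∀ M : Knot.MarkedDiagram, Knot.IsLinkDiagram M.diagram →
      M.IsDealternator → M.IsDealternatorReduced → M.IsDealternatorConnected →
      Knot.IsQuasiAlternating M.diagram →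
      Knot.determinant M.smoothZero ≠ Knot.determinant M.smoothInfty ∧
      (Knot.determinant M.smoothInfty < Knot.determinant M.smoothZero →
        ∀ N : Knot.MarkedDiagram, M.MarksCrossingOf (Knot.halfTangle M.sign) N →
          ∀ E : Knot.Word, N.IsRationalExtension E →
            (Knot.crossings E : ℝ) ≤ Knot.determinant E) ∧
      (Knot.determinant M.smoothZero < Knot.determinant M.smoothInfty →
        ∀ N : Knot.MarkedDiagram, M.MarksCrossingOf (Knot.twoTangle M.sign) N →
          ∀ E : Knot.Word, N.IsRationalExtension E →
            (Knot.crossings E : ℝ) ≤ Knot.determinant E)) ∧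
    -- the links `N(-1 + t₁ + ⋯ + t_m + T)`
    (∀ (T : Knot.Word) (ts : List Knot.Word),
      Knot.IsStronglyAlternating T → Knot.IsRationalFamily ts →
      Knot.IsQuasiAlternating (Knot.numerator (Knot.tangleSum (Knot.oneTangle false) T)) →
      Knot.IsPrimeDiagram (Knot.numerator T) →
      Knot.determinant (Knot.denominator T) < Knot.determinant (Knot.numerator T) →
      (Knot.crossingNumber (Knot.insertedDiagram ts T) : ℝ) ≤
        Knot.determinant (Knot.insertedDiagram ts T)) ∧
    -- the links generated by an arbitrary alternating tangle diagram
    (∀ (T : Knot.Word) (as : List ℕ) (W r : Knot.Word) (ts : List Knot.Word),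
      Knot.IsTangle 2 2 T → Knot.IsAlternatingTangle T → Knot.IsConnectedTangle T →
      Knot.IsReduced 2 T → Knot.IsLocallyUnknotted T →
      as ≠ [] → (∀ a ∈ as, 1 ≤ a) → Knot.Star T as W →
      Knot.IsRational true r ((1 - Knot.contFrac as) / Knot.contFrac as) →
      Knot.IsRationalFamily ts →
      (Knot.crossingNumber (Knot.insertedDiagram ts
          (Knot.tangleSum (Knot.tangleProd r (Knot.oneTangle true)) W)) : ℝ) ≤
        Knot.determinant (Knot.insertedDiagram ts
          (Knot.tangleSum (Knot.tangleProd r (Knot.oneTangle true)) W))) :=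
  ⟨fun _ hM h hr hc hq =>
    Knot.MarkedDiagram.crossings_le_determinant_of_rationalExtension hM h hr hc hq,
  fun _ _ hT hts _ _ hdet => Knot.crossingNumber_inserted_le_determinant hT hts hdet,
  fun _ _ _ _ _ hT ha hc hr _ hne hl hW hrat hts =>
    Knot.crossingNumber_star_le_determinant hT ha hc hr hne hl hW hrat hts⟩
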